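/- Let $0<q<1$ (that is, $q=e^{-\omega}$ with $\omega>0$), write $q^z=e^{z\log q}$ for $z\in\mathbb C$, and put $(x;q)_\infty=\prod_{k\ge 0}(1-xq^k)$, $(x;q)_n=\prod_{k=0}^{n-1}(1-xq^k)$, $(x_1,\dots,x_m;q)_n=\prod_j (x_j;q)_n$ for $n\in\{0,1,2,\dots\}\cup\{\infty\}$, and $${}_3\phi_2\left[\begin{matrix}x_1,&x_2,&x_3\\&y_1,&y_2\end{matrix};q,z\right]=\sum_{k=0}^\infty\frac{(x_1,x_2,x_3;q)_k}{(q,y_1,y_2;q)_k}\,z^k .$$ **Theorem (extension of Watson's $q$-analogue of Barnes' first lemma).** Let $a,b,c,d,e,f\in\mathbb C$ satisfy $$\max\{|q^f|,|q^{c+f}|,|q^{d+f}|\}<1 .$$ Assume also that the right-hand side below is well defined: $\sin\pi(c-d)\ne0$, and none of the numbers $q^{a+c},q^{a+d},q^{b+c},q^{b+d},q^{c+e+f},q^{a+b+c+d}$ is of the form $q^{-n}$ with $n\in\{0,1,2,\dots\}$. Let $$F(s)=\frac{(q^{1-c+s},q^{1-d+s},q^{e+f+s};q)_\infty}{(q^{a+s},q^{b+s},q^{f+s};q)_\infty}\,\frac{\pi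 q^s}{\sin\pi(c-s)\,\sin\pi(d-s)} ,$$ and let $C$ be a contour from $-i\infty$ to $i\infty$ such that the poles of $F$ in the increasing sequences $c+k$, $d+k$ ($k=0,1,2,\dots$) lie to the right of $C$, and the poles of $F$ in the decreasing sequences $-x+\frac{2\pi i m}{\log q}-n$ ($x\in\{a,b,f\}$, $m\in\mathbb Z$, $n=0,1,2,\dots$) lie to the left of $C$. Then the integral below converges absolutely, the ${}_3\phi_2$ series converges, and $$\frac1{2\pi i}\int_C F(s)\,ds=\frac{q^c}{\sin\pi(d-c)}\,\frac{(q,q^{1+c-d},q^{d-c},q^{a+b+c+d},q^{c+e+f};q)_\infty}{(q^{a+c},q^{a+d},q^{b+c},q^{b+d},q^{c+f};q)_\infty}\;{}_3\phi_2\left[\begin{matrix}q^e,&q^{a+c},&q^{b+c}\\&q^{c+e+f},&q^{a+b+c+d}\end{matrix};q,q^{d+f}\right].$$ Here a contour from $-i\infty$ to $i\infty$ is a continuous, piecewise $C^1$ curve $\gamma:\mathbb R\to\mathbb C$ with bounded derivative such that $\gamma(t)=\sigma_{+}+it$ for all sufficiently large $t$ and $\gamma(t)=\sigma_{-}+it$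 for all sufficiently large negative $t$, for some real $\sigma_\pm$ (a vertical line deformed in a bounded region). A point $z$ not on the contour lies to its left, respectively right, if $\lim_{R\to\infty}\int_{-R}^{R}\frac{\gamma'(t)}{\gamma(t)-z}\,dt$ equals $\pi i$, respectively $-\pi i$; for simple curves these are the usual two sides. -/

import Mathlib

open Filter Topology

noncomputable section

/-- The infinite `q`-shifted factorial `(a; q)_∞ = ∏_{k ≥ 0} (1 - a q^k)`. -/
def qPochInf (a q : ℂ) : ℂ := ∏' k : ℕ, (1 - a * q ^ k)

/-- The finite `q`-shifted factorial `(a; q)_n = ∏_{0 ≤ k < n} (1 - a q^k)`. -/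
def qPoch (a q : ℂ) (n : ℕ) : ℂ := ∏ k ∈ Finset.range n, (1 - a * q ^ k)

/-- The `k`-th term of the basic hypergeometric series `_rφ_s[as; bs; q, z]`, where `r` and `s` are
the lengths of the lists `as` and `bs`. -/
def basicHypergeometricTerm (as bs : List ℂ) (q z : ℂ) (k : ℕ) : ℂ :=
  (as.map fun x => qPoch x q k).prod / ((q :: bs).map fun x => qPoch x q k).prod
    * ((-1) ^ k * q ^ (k.choose 2)) ^ (1 + (bs.length : ℤ) - (as.length : ℤ)) * z ^ k

/-- The basic hypergeometric series `_rφ_s[as; bs; q, z]`. -/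
def basicHypergeometric (as bs : List ℂ) (q z : ℂ) : ℂ :=
  ∑' k : ℕ, basicHypergeometricTerm as bs q z k

/-- A contour running from `-i∞` to `i∞`: a continuous, piecewise continuously differentiable
curve with bounded derivative which outside a bounded parameter interval runs upwards along
vertical lines (it is a vertical line that is deformed in a bounded region; the two ends may have
different abscissae). -/
structure IsUpwardContour (γ : ℝ → ℂ) : Prop where
  continuous : Continuous γ
  piecewise : ∃ S : Finset ℝ, ∀ t : ℝ, t ∉ S → ContDiffAt ℝ 1 γ t
  deriv_bounded : ∃ M : ℝ, ∀ t : ℝ, ‖deriv γ t‖ ≤ M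
  top_vertical : ∃ σ T : ℝ, ∀ t : ℝ, T ≤ t → γ t = (σ : ℂ) + (t : ℂ) * Complex.I
  bottom_vertical : ∃ σ T : ℝ, ∀ t : ℝ, t ≤ T → γ t = (σ : ℂ) + (t : ℂ) * Complex.I

/-- The point `z` lies to the left of the upward contour `γ`: it is not on `γ`, and the argument of
`ζ - z` increases by `π` along `γ`, that is, `∫_γ dζ / (ζ - z) = π i` as a symmetric limit.
For the vertical line `Re ζ = σ` this says `Re z < σ`. -/
def LiesLeftOf (z : ℂ) (γ : ℝ → ℂ) : Prop :=
  (∀ t : ℝ, γ t ≠ z) ∧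
    Tendsto (fun R : ℝ => ∫ t in (-R)..R, deriv γ t / (γ t - z)) atTop
      (𝓝 ((Real.pi : ℂ) * Complex.I))

/-- The point `z` lies to the right of the upward contour `γ`: it is not on `γ`, and the argument of
`ζ - z` decreases by `π` along `γ`, that is, `∫_γ dζ / (ζ - z) = -π i` as a symmetric limit.
For the vertical line `Re ζ = σ` this says `Re z > σ`. -/
def LiesRightOf (z : ℂ) (γ : ℝ → ℂ) : Prop :=
  (∀ t : ℝ, γ t ≠ z) ∧
    Tendsto (fun R : ℝ => ∫ t in (-R)..R, deriv γ t / (γ t - z)) atTop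
      (𝓝 (-((Real.pi : ℂ) * Complex.I)))

/-- The increasing sequence `x, x + 1, x + 2, …`. -/
def increasingSeq (x : ℂ) : Set ℂ := {z | ∃ k : ℕ, z = x + k}

/-- The zeros of `s ↦ (q^{x+s}; q)_∞` for `0 < q < 1`: the decreasing sequences
`-x + 2πim / log q - n`, `n = 0, 1, 2, …`, for the integers `m`. -/
def decreasingSeq (q : ℝ) (x : ℂ) : Set ℂ :=
  {z | ∃ (n : ℕ) (m : ℤ), z = -x + 2 * (Real.pi : ℂ) * Complex.I * m / (Real.log q : ℂ) - n}

/-- The integrand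
`(q^{1-c+s}, q^{1-d+s}, q^{e+f+s}; q)_∞ / (q^{a+s}, q^{b+s}, q^{f+s}; q)_∞
  · π q^s / (sin π(c-s) sin π(d-s))`. -/
def barnesIntegrand (q : ℝ) (a b c d e f s : ℂ) : ℂ :=
  qPochInf ((q : ℂ) ^ (1 - c + s)) q * qPochInf ((q : ℂ) ^ (1 - d + s)) q
      * qPochInf ((q : ℂ) ^ (e + f + s)) q
    / (qPochInf ((q : ℂ) ^ (a + s)) q * qPochInf ((q : ℂ) ^ (b + s)) q
      * qPochInf ((q : ℂ) ^ (f + s)) q)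
    * ((Real.pi : ℂ) * (q : ℂ) ^ s
      / (Complex.sin (Real.pi * (c - s)) * Complex.sin (Real.pi * (d - s))))

/-- The contour `γ` runs from `-i∞` to `i∞` so that the poles of `F` in `inc` lie to its right and
the poles of `F` in `dec` lie to its left. -/
structure IsBarnesContour (F : ℂ → ℂ) (inc dec : Set ℂ) (γ : ℝ → ℂ) : Prop where
  upward : IsUpwardContour γ
  right : ∀ z ∈ inc, meromorphicOrderAt F z < 0 → LiesRightOf z γ
  left : ∀ z ∈ dec, meromorphicOrderAt F z < 0 → LiesLeftOf z γ

end

/-!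
Put `t = q^s`, `x = q^c`, `y = q^d`, `α = q^a`, `β = q^b`, `A = q^e`, `h = q^f`. The Barnes
integrand is `barnesTerm q x y α β A h t` times the trigonometric factor
`π / (sin π(c-s) sin π(d-s))`, where `barnesTerm` is `t` times a ratio of infinite `q`-shifted factorials
in `t`. The proof moves the contour to `Re s = +∞` and sums the residues.

*The residues.* Zeros of `sin π(c-s)` at `c - 1, c - 2, …` are cancelled by `(q^{1-c+s}; q)_∞`, so
all poles lie in the increasing and decreasing sequences (`mem_of_meromorphicOrderAt_neg`), and the
residue at `c + k` is `-barnesTerm (x q^k) / sin π(d-c)`; at `d + k` it is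
`barnesTerm (y q^k) / sin π(d-c)`.

*The shift of the contour.* The ratio of `q`-shifted factorials depends on `q^s` only, hence is
periodic in the imaginary direction. A pole of it in the half-plane to the right of an end of the
contour could be translated along that end to a pole of the integrand on the wrong side of the
contour. So the ratio has no poles in a closed disc `|t| ≤ q^σ` and is bounded on a slightly larger
disc (`exists_norm_barnesRatio_le`), while the trigonometric factor has an integrable majorant. The
residue theorem for two contours (`tendsto_integral_sub_integral`) needs no homotopy: on a union of
two convex sets the integrand is the sum of a function with a primitive and of finitely many Laurent
tails, of which only the terms `1 / (s - p)` contribute, with the winding integrals that define the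
two sides of the contour. The integrals over `Re s = x + j`, `j → ∞`, tend to zero because of the
factor `t = q^s`, which gives `integral_barnesIntegrand`.

*The sum.* It remains to combine the sums of `barnesTerm` over `x q^k` and over `y q^k` into one
`₃φ₂` (`tsum_barnesTerm_sub_tsum_barnesTerm`). The quotient `(Aht; q)_∞ / (ht; q)_∞` is expanded by
the `q`-Gauss sum (`hasSum_qGaussTerm`) with numerator parameters `A` and `x / t`. This replaces `x`
by `x q^k` in the `k`-th term of the expansion, where the difference of the two sums over `t` is the
`q`-beta integral of Andrews and Askey (`qBetaIntegral_eq`). Both evaluations are obtained by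
iterating a contiguous relation that comes from a telescoping sum.
-/

/-! ### The `q`-shifted factorials -/

section qPochhammer

variable {q : ℂ}

lemma summable_norm_mul_pow (hq : ‖q‖ < 1) (a : ℂ) : Summable fun k : ℕ => ‖-(a * q ^ k)‖ := by
  simpa [norm_mul, norm_pow] using
    (summable_geometric_of_lt_one (norm_nonneg _) hq).mul_left ‖a‖

lemma multipliable_qPochInf (hq : ‖q‖ < 1) (a : ℂ) :
    Multipliable fun k : ℕ => 1 - a * q ^ k := by
  simpa [sub_eq_add_neg] using multipliable_one_add_of_summable (summable_norm_mul_pow hq a)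

lemma qPochInf_ne_zero (hq : ‖q‖ < 1) {a : ℂ} (h : ∀ k : ℕ, a * q ^ k ≠ 1) :
    qPochInf a q ≠ 0 := by
  have := tprod_one_add_ne_zero_of_summable (f := fun k : ℕ => -(a * q ^ k))
    (fun k => by rw [← sub_eq_add_neg]; exact sub_ne_zero.2 (h k).symm)
    (summable_norm_mul_pow hq a)
  simpa [qPochInf, sub_eq_add_neg] using this

lemma qPochInf_eq_qPoch_mul (hq : ‖q‖ < 1) (a : ℂ) (n : ℕ) :
    qPochInf a q = qPoch a q n * qPochInf (a * q ^ n) q := by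
  have h2 : (fun k : ℕ => 1 - a * q ^ n * q ^ k) = fun k : ℕ => 1 - a * q ^ (k + n) := by
    ext k; rw [pow_add, mul_assoc, mul_comm (q ^ n)]
  have h : Multipliable fun k : ℕ => 1 - a * q ^ (k + n) := h2 ▸ multipliable_qPochInf hq _
  have h3 : qPochInf (a * q ^ n) q = ∏' k : ℕ, (1 - a * q ^ (k + n)) := congrArg tprod h2
  rw [h3, qPoch, qPochInf]
  exact (Multipliable.prod_mul_tprod_nat_mul' (f := fun k : ℕ => 1 - a * q ^ k) (k := n) h).symm

lemma qPochInf_step (hq : ‖q‖ < 1) (a : ℂ) :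
    qPochInf a q = (1 - a) * qPochInf (a * q) q := by
  simpa [qPoch] using qPochInf_eq_qPoch_mul hq a 1

lemma qPochInf_eq_zero_iff (hq : ‖q‖ < 1) {a : ℂ} :
    qPochInf a q = 0 ↔ ∃ k : ℕ, a * q ^ k = 1 := by
  constructor
  · intro h
    by_contra! h'
    exact qPochInf_ne_zero hq h' h
  · rintro ⟨k, hk⟩
    rw [qPochInf_eq_qPoch_mul hq a (k + 1), qPoch, Finset.prod_range_succ, hk]
    simp

@[simp] lemma qPochInf_zero : qPochInf 0 q = 1 := by simp [qPochInf]

@[simp] lemma qPoch_zero_right (a : ℂ) : qPoch a q 0 = 1 := by simp [qPoch]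

lemma qPoch_succ (a : ℂ) (n : ℕ) : qPoch a q (n + 1) = qPoch a q n * (1 - a * q ^ n) := by
  simp [qPoch, Finset.prod_range_succ]

lemma qPoch_succ' (a : ℂ) (n : ℕ) : qPoch a q (n + 1) = (1 - a) * qPoch (a * q) q n := by
  simp [qPoch, Finset.prod_range_succ', pow_succ', mul_comm (1 - a), mul_assoc]

lemma qPoch_add (a : ℂ) (m n : ℕ) :
    qPoch a q (m + n) = qPoch a q m * qPoch (a * q ^ m) q n := by
  simp [qPoch, Finset.prod_range_add, pow_add, mul_assoc]

lemma qPoch_ne_zero {a : ℂ} (h : ∀ k : ℕ, a * q ^ k ≠ 1) (n : ℕ) : qPoch a q n ≠ 0 :=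
  Finset.prod_ne_zero_iff.2 fun k _ => sub_ne_zero.2 (h k).symm

lemma norm_qPoch_le (hq : ‖q‖ < 1) {a : ℂ} {R : ℝ} (ha : ‖a‖ ≤ R) (n : ℕ) :
    ‖qPoch a q n‖ ≤ Real.exp (R / (1 - ‖q‖)) := by
  have hs := summable_geometric_of_lt_one (norm_nonneg q) hq
  have hR : 0 ≤ R := (norm_nonneg a).trans ha
  calc ‖qPoch a q n‖ = ∏ k ∈ Finset.range n, ‖1 - a * q ^ k‖ := by simp [qPoch, norm_prod]
    _ ≤ ∏ k ∈ Finset.range n, (1 + R * ‖q‖ ^ k) := by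
        refine Finset.prod_le_prod (fun _ _ => norm_nonneg _) fun k _ => ?_
        refine (norm_sub_le _ _).trans ?_
        rw [norm_one, norm_mul, norm_pow]
        gcongr
    _ ≤ Real.exp (∑ k ∈ Finset.range n, R * ‖q‖ ^ k) :=
        Real.prod_one_add_le_exp_sum _ fun k => by positivity
    _ ≤ Real.exp (R / (1 - ‖q‖)) := by
        rw [Real.exp_le_exp, ← Finset.mul_sum, div_eq_mul_inv, ← tsum_geometric_of_lt_one
          (norm_nonneg q) hq]
        exact mul_le_mul_of_nonneg_left (hs.sum_le_tsum _ fun _ _ => by positivity) hR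

lemma tendsto_qPoch (hq : ‖q‖ < 1) (a : ℂ) :
    Tendsto (fun n => qPoch a q n) atTop (𝓝 (qPochInf a q)) :=
  (multipliable_qPochInf hq a).hasProd.tendsto_prod_nat

/-- A `q`-shifted factorial without zero factors stays away from zero. -/
lemma exists_le_norm_qPoch (hq : ‖q‖ < 1) {a : ℂ} (h : ∀ k : ℕ, a * q ^ k ≠ 1) :
    ∃ m > 0, ∀ n, m ≤ ‖qPoch a q n‖ := by
  have h0 : 0 < ‖qPochInf a q‖ := norm_pos_iff.2 (qPochInf_ne_zero hq h)
  have ht := (tendsto_qPoch hq a).norm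
  obtain ⟨N, hN⟩ := eventually_atTop.1 (ht.eventually (lt_mem_nhds (half_lt_self h0)))
  obtain ⟨m, hm0, hm⟩ : ∃ m > 0, ∀ n ∈ Finset.range N, m ≤ ‖qPoch a q n‖ := by
    clear hN
    induction N with
    | zero => exact ⟨1, one_pos, by simp⟩
    | succ N ih =>
      obtain ⟨m, hm0, hm⟩ := ih
      refine ⟨min m ‖qPoch a q N‖, lt_min hm0 (norm_pos_iff.2 (qPoch_ne_zero h N)), ?_⟩
      intro n hn
      rcases Finset.mem_range_succ_iff.1 hn |>.lt_or_eq with h1 | rfl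
      · exact (min_le_left _ _).trans (hm n (Finset.mem_range.2 h1))
      · exact min_le_right _ _
  refine ⟨min m (‖qPochInf a q‖ / 2), lt_min hm0 (half_pos h0), fun n => ?_⟩
  rcases lt_or_ge n N with h1 | h1
  · exact (min_le_left _ _).trans (hm n (Finset.mem_range.2 h1))
  · exact (min_le_right _ _).trans (hN n h1).le

lemma differentiable_qPochInf (hq : ‖q‖ < 1) : Differentiable ℂ fun a => qPochInf a q := by
  intro a
  have hs : Summable fun k : ℕ => (‖a‖ + 1) * ‖q‖ ^ k :=
    (summable_geometric_of_lt_one (norm_nonneg _) hq).mul_left _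
  have h := Summable.hasProdLocallyUniformlyOn_nat_one_add
    (f := fun (k : ℕ) (x : ℂ) => -(x * q ^ k))
    (K := Metric.ball a 1) Metric.isOpen_ball hs (.of_forall fun k x hx => by
      rw [norm_neg, norm_mul, norm_pow]
      gcongr
      have h1 := norm_sub_norm_le x a
      rw [mem_ball_iff_norm] at hx
      linarith) (fun k => by fun_prop)
  have h2 := h.differentiableOn (.of_forall fun s => by
    simpa [Finset.prod_fn] using DifferentiableOn.finsetProd (fun _ _ => by fun_prop))
    Metric.isOpen_ball
  have h3 := h2.differentiableAt (Metric.isOpen_ball.mem_nhds (Metric.mem_ball_self one_pos))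
  simpa [qPochInf, sub_eq_add_neg] using! h3

lemma continuous_qPochInf (hq : ‖q‖ < 1) : Continuous fun a => qPochInf a q :=
  (differentiable_qPochInf hq).continuous

lemma norm_qPochInf_le (hq : ‖q‖ < 1) {a : ℂ} {R : ℝ} (ha : ‖a‖ ≤ R) :
    ‖qPochInf a q‖ ≤ Real.exp (R / (1 - ‖q‖)) :=
  le_of_tendsto (tendsto_qPoch hq a).norm (.of_forall fun n => norm_qPoch_le hq ha n)

lemma tendsto_qPochInf_mul_pow (hq : ‖q‖ < 1) (a : ℂ) :
    Tendsto (fun n : ℕ => qPochInf (a * q ^ n) q) atTop (𝓝 1) := by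
  have h : Tendsto (fun n : ℕ => a * q ^ n) atTop (𝓝 0) := by
    simpa using (tendsto_pow_atTop_nhds_zero_of_norm_lt_one hq).const_mul a
  have h2 := ((continuous_qPochInf hq).tendsto 0).comp h
  rwa [qPochInf_zero] at h2

end qPochhammer

/-! ### The `q`-Gauss sum -/

section qGauss

variable {q : ℂ}

/-- The `k`-th term of the `q`-Gauss series `₂φ₁(A, B; C; q, C / (A B))`, parametrized by its
argument `z = C / (A B)` so that no division is needed. -/
noncomputable def qGaussTerm (q A B z : ℂ) (k : ℕ) : ℂ :=
  qPoch A q k * qPoch B q k / (qPoch q q k * qPoch (A * B * z) q k) * z ^ k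

lemma mul_pow_ne_one_of_norm_lt (hq : ‖q‖ < 1) {z : ℂ} (hz : ‖z‖ < 1) (k : ℕ) :
    z * q ^ k ≠ 1 := by
  intro h
  have : ‖z * q ^ k‖ < 1 := by
    rw [norm_mul, norm_pow]
    exact mul_lt_one_of_nonneg_of_lt_one_left (norm_nonneg _) hz
      (pow_le_one₀ (norm_nonneg _) hq.le)
  rw [h, norm_one] at this
  exact lt_irrefl _ this

lemma mul_pow_mul_pow_ne_one {a : ℂ} (h : ∀ k : ℕ, a * q ^ k ≠ 1) (n k : ℕ) :
    a * q ^ n * q ^ k ≠ 1 := by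
  rw [mul_assoc, ← pow_add]; exact h _

/-- The terms of the `q`-Gauss series decay geometrically, uniformly under `z ↦ z q^n`. -/
lemma exists_norm_qGaussTerm_le (hq : ‖q‖ < 1) (A B : ℂ) {z : ℂ}
    (hC : ∀ k : ℕ, A * B * z * q ^ k ≠ 1) :
    ∃ M, ∀ n k : ℕ, ‖qGaussTerm q A B (z * q ^ n) k‖ ≤ M * ‖z * q ^ n‖ ^ k := by
  obtain ⟨m, hm0, hm⟩ := exists_le_norm_qPoch hq hC
  obtain ⟨m', hm'0, hm'⟩ := exists_le_norm_qPoch hq (mul_pow_ne_one_of_norm_lt hq hq)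
  set MA := Real.exp (‖A‖ / (1 - ‖q‖))
  set MB := Real.exp (‖B‖ / (1 - ‖q‖))
  set MC := Real.exp (‖A * B * z‖ / (1 - ‖q‖))
  have hMC : 0 < MC := Real.exp_pos _
  refine ⟨MA * MB / (m' * (m / MC)), fun n k => ?_⟩
  have h1 : m / MC ≤ ‖qPoch (A * B * (z * q ^ n)) q k‖ := by
    have h2 := qPoch_add (q := q) (A * B * z) n k
    have h3 : ‖qPoch (A * B * z) q (n + k)‖ ≤ MC * ‖qPoch (A * B * (z * q ^ n)) q k‖ := by
      rw [h2, norm_mul, ← mul_assoc (A * B)]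
      gcongr
      exact norm_qPoch_le hq le_rfl n
    rw [div_le_iff₀' hMC]
    exact (hm _).trans h3
  rw [qGaussTerm, norm_mul, norm_div, norm_mul, norm_mul, norm_pow]
  gcongr
  · exact norm_qPoch_le hq le_rfl k
  · exact norm_qPoch_le hq le_rfl k
  · exact hm' k

lemma norm_mul_pow_lt_one (hq : ‖q‖ < 1) {z : ℂ} (hz : ‖z‖ < 1) (n : ℕ) : ‖z * q ^ n‖ < 1 := by
  rw [norm_mul, norm_pow]
  exact mul_lt_one_of_nonneg_of_lt_one_left (norm_nonneg _) hz
    (pow_le_one₀ (norm_nonneg _) hq.le)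

lemma summable_qGaussTerm (hq : ‖q‖ < 1) (A B : ℂ) {z : ℂ} (hz : ‖z‖ < 1)
    (hC : ∀ k : ℕ, A * B * z * q ^ k ≠ 1) : Summable (qGaussTerm q A B z) := by
  obtain ⟨M, hM⟩ := exists_norm_qGaussTerm_le hq A B hC
  refine .of_norm_bounded ((summable_geometric_of_lt_one (norm_nonneg _) hz).mul_left M) ?_
  simpa using hM 0

/-- The combination of neighbouring terms in the contiguous relation is a difference in `k`. -/
lemma qGaussTerm_telescope (hq : ‖q‖ < 1) (A B : ℂ) {z : ℂ}
    (hC : ∀ k : ℕ, A * B * z * q ^ k ≠ 1) (k : ℕ) :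
    (1 - A * B * z) * (1 - z) * qGaussTerm q A B z k
        - (1 - A * z) * (1 - B * z) * qGaussTerm q A B (z * q) k =
      (1 - A * B * z) * (qGaussTerm q A B z k * (1 - q ^ k)
        - qGaussTerm q A B z (k + 1) * (1 - q ^ (k + 1))) := by
  have hq1 := qPoch_ne_zero (mul_pow_ne_one_of_norm_lt hq hq) k
  have hC1 := qPoch_ne_zero hC k
  have hC2 : 1 - A * B * z * q ^ k ≠ 0 := sub_ne_zero.2 (hC k).symm
  have hC3 : 1 - A * B * z ≠ 0 := sub_ne_zero.2 (by simpa using (hC 0).symm)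
  have hq2 : 1 - q * q ^ k ≠ 0 := sub_ne_zero.2 (mul_pow_ne_one_of_norm_lt hq hq k).symm
  have h1 : qPoch (A * B * (z * q)) q k =
      qPoch (A * B * z) q k * (1 - A * B * z * q ^ k) / (1 - A * B * z) := by
    rw [eq_div_iff hC3, ← qPoch_succ, qPoch_succ', ← mul_assoc (A * B), mul_comm]
  simp only [qGaussTerm, h1, qPoch_succ, mul_pow, pow_succ' q k]
  generalize q ^ k = Q at *
  obtain ⟨D, hD⟩ : ∃ D, D = 1 - q * Q := ⟨_, rfl⟩
  obtain ⟨D', hD'⟩ : ∃ D', D' = 1 - A * B * z * Q := ⟨_, rfl⟩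
  rw [← hD] at hq2 ⊢
  rw [← hD'] at hC2 ⊢
  field_simp
  rw [hD']
  ring

/-- The contiguous relation of the `q`-Gauss series. -/
lemma tsum_qGaussTerm_step (hq : ‖q‖ < 1) (A B : ℂ) {z : ℂ} (hz : ‖z‖ < 1)
    (hC : ∀ k : ℕ, A * B * z * q ^ k ≠ 1) :
    (1 - A * B * z) * (1 - z) * ∑' k, qGaussTerm q A B z k =
      (1 - A * z) * (1 - B * z) * ∑' k, qGaussTerm q A B (z * q) k := by
  have hs := summable_qGaussTerm hq A B hz hC
  have hs' : Summable (qGaussTerm q A B (z * q)) :=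
    summable_qGaussTerm hq A B (by simpa using norm_mul_pow_lt_one hq hz 1) (fun k => by
      simpa [mul_assoc] using mul_pow_mul_pow_ne_one hC 1 k)
  have h := ((hs.hasSum.mul_left ((1 - A * B * z) * (1 - z))).sub
    (hs'.hasSum.mul_left ((1 - A * z) * (1 - B * z)))).tendsto_sum_nat
  simp_rw [qGaussTerm_telescope hq A B hC, ← Finset.mul_sum] at h
  have h2 : Tendsto (fun n : ℕ => (1 - A * B * z) * ∑ k ∈ Finset.range n,
      (qGaussTerm q A B z k * (1 - q ^ k)
        - qGaussTerm q A B z (k + 1) * (1 - q ^ (k + 1)))) atTop (𝓝 0) := by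
    simp_rw [Finset.sum_range_sub' fun k => qGaussTerm q A B z k * (1 - q ^ k)]
    have h3 := (hs.tendsto_atTop_zero.mul
      ((tendsto_pow_atTop_nhds_zero_of_norm_lt_one hq).const_sub 1)).const_sub
        (qGaussTerm q A B z 0 * (1 - q ^ 0))
    simpa using h3.const_mul (1 - A * B * z)
  exact sub_eq_zero.1 (tendsto_nhds_unique h h2)

/-- The `q`-Gauss sum `₂φ₁(A, B; C; q, z) = (C/A, C/B; q)_∞ / (C, z; q)_∞`, `z = C / (A B)`: iterate
the contiguous relation, under which the series tends to `1`. -/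
lemma hasSum_qGaussTerm (hq : ‖q‖ < 1) (A B : ℂ) {z : ℂ} (hz : ‖z‖ < 1)
    (hC : ∀ k : ℕ, A * B * z * q ^ k ≠ 1) :
    HasSum (qGaussTerm q A B z)
      (qPochInf (A * z) q * qPochInf (B * z) q / (qPochInf (A * B * z) q * qPochInf z q)) := by
  have hs := summable_qGaussTerm hq A B hz hC
  have hiter : ∀ n : ℕ, qPoch (A * B * z) q n * qPoch z q n * ∑' k, qGaussTerm q A B z k =
      qPoch (A * z) q n * qPoch (B * z) q n * ∑' k, qGaussTerm q A B (z * q ^ n) k := by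
    intro n
    induction n with
    | zero => simp
    | succ n ih =>
      have := tsum_qGaussTerm_step hq A B (norm_mul_pow_lt_one hq hz n) (fun k => by
        simpa [mul_assoc] using mul_pow_mul_pow_ne_one hC n k)
      rw [pow_succ, ← mul_assoc z]
      simp only [qPoch_succ]
      linear_combination (1 - A * B * z * q ^ n) * (1 - z * q ^ n) * ih +
        qPoch (A * z) q n * qPoch (B * z) q n * this
  have hlim : Tendsto (fun n : ℕ => ∑' k, qGaussTerm q A B (z * q ^ n) k) atTop (𝓝 1) := by
    obtain ⟨M, hM⟩ := exists_norm_qGaussTerm_le hq A B hC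
    have hM0 : 0 ≤ M := by simpa using (norm_nonneg _).trans (hM 0 0)
    have hle : ∀ n : ℕ, ‖z * q ^ n‖ ≤ ‖z‖ := fun n => by
      rw [norm_mul, norm_pow]
      exact mul_le_of_le_one_right (norm_nonneg _) (pow_le_one₀ (norm_nonneg _) hq.le)
    have := tendsto_tsum_of_dominated_convergence (𝓕 := atTop)
      (f := fun n k => qGaussTerm q A B (z * q ^ n) k) (g := fun k => if k = 0 then (1 : ℂ) else 0)
      (bound := fun k => M * ‖z‖ ^ k)
      ((summable_geometric_of_lt_one (norm_nonneg _) hz).mul_left M) ?_ ?_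
    · simpa using this
    · intro k
      rcases eq_or_ne k 0 with rfl | hk
      · simp [qGaussTerm]
      · simp only [hk, if_false]
        refine squeeze_zero_norm (fun n => hM n k) ?_
        have h1 : Tendsto (fun n : ℕ => ‖z * q ^ n‖) atTop (𝓝 0) := by
          simpa using ((tendsto_pow_atTop_nhds_zero_of_norm_lt_one hq).const_mul z).norm
        simpa [hk] using (h1.pow k).const_mul M
    · exact .of_forall fun n k => (hM n k).trans (by gcongr; exact hle n)
  have h1 := ((tendsto_qPoch hq (A * B * z)).mul (tendsto_qPoch hq z)).mul_const
    (∑' k, qGaussTerm q A B z k)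
  simp_rw [hiter] at h1
  have h2 := tendsto_nhds_unique h1
    (((tendsto_qPoch hq (A * z)).mul (tendsto_qPoch hq (B * z))).mul hlim)
  have hz' := qPochInf_ne_zero hq (mul_pow_ne_one_of_norm_lt hq hz)
  have hC' := qPochInf_ne_zero hq hC
  have h3 : ∑' k, qGaussTerm q A B z k =
      qPochInf (A * z) q * qPochInf (B * z) q / (qPochInf (A * B * z) q * qPochInf z q) := by
    rw [eq_div_iff (mul_ne_zero hC' hz')]
    linear_combination h2
  exact h3 ▸ hs.hasSum

end qGauss

/-! ### The nonterminating `q`-Vandermonde sum -/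

section qBeta

variable {q : ℂ}

/-- The summand of the `q`-beta integral of Andrews and Askey:
`t (qt/x, qt/y; q)_∞ / (αt, βt; q)_∞`. -/
noncomputable def qBetaTerm (q x y α β t : ℂ) : ℂ :=
  t * (qPochInf (q * t / x) q * qPochInf (q * t / y) q / (qPochInf (α * t) q * qPochInf (β * t) q))

lemma qBetaTerm_swap (x y α β t : ℂ) : qBetaTerm q x y α β t = qBetaTerm q y x α β t := by
  simp only [qBetaTerm]; ring

lemma qBetaTerm_comm_param (x y α β t : ℂ) : qBetaTerm q x y α β t = qBetaTerm q x y β α t := by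
  simp only [qBetaTerm]; ring

lemma norm_qPochInf_mul_pow_ge (hq : ‖q‖ < 1) (a : ℂ) (n : ℕ) :
    ‖qPochInf a q‖ / Real.exp (‖a‖ / (1 - ‖q‖)) ≤ ‖qPochInf (a * q ^ n) q‖ := by
  rw [div_le_iff₀' (Real.exp_pos _), qPochInf_eq_qPoch_mul hq a n, norm_mul]
  gcongr
  exact norm_qPoch_le hq le_rfl n

/-- The summands decay geometrically along `t, tq, tq², …`, uniformly under `α ↦ α q^n`. -/
lemma exists_norm_qBetaTerm_le (hq : ‖q‖ < 1) (x y α β : ℂ) {t : ℂ}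
    (hα : ∀ k : ℕ, α * t * q ^ k ≠ 1) (hβ : ∀ k : ℕ, β * t * q ^ k ≠ 1) :
    ∃ M, ∀ n k : ℕ, ‖qBetaTerm q x y (α * q ^ n) β (t * q ^ k)‖ ≤ M * ‖q‖ ^ k := by
  set M₁ := Real.exp (‖q * t / x‖ / (1 - ‖q‖))
  set M₂ := Real.exp (‖q * t / y‖ / (1 - ‖q‖))
  set m₁ := ‖qPochInf (α * t) q‖ / Real.exp (‖α * t‖ / (1 - ‖q‖))
  set m₂ := ‖qPochInf (β * t) q‖ / Real.exp (‖β * t‖ / (1 - ‖q‖))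
  have hm₁ : 0 < m₁ := div_pos (norm_pos_iff.2 (qPochInf_ne_zero hq hα)) (Real.exp_pos _)
  have hm₂ : 0 < m₂ := div_pos (norm_pos_iff.2 (qPochInf_ne_zero hq hβ)) (Real.exp_pos _)
  have hle : ∀ (u : ℂ) (k : ℕ), ‖q * (t * q ^ k) / u‖ ≤ ‖q * t / u‖ := fun u k => by
    rw [norm_div, norm_div, norm_mul, norm_mul, norm_mul, norm_pow]
    gcongr
    exact mul_le_of_le_one_right (norm_nonneg _) (pow_le_one₀ (norm_nonneg _) hq.le)
  refine ⟨‖t‖ * (M₁ * M₂ / (m₁ * m₂)), fun n k => ?_⟩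
  rw [qBetaTerm, norm_mul, norm_mul, norm_div, norm_mul, norm_mul, norm_pow, mul_right_comm]
  gcongr
  · exact norm_qPochInf_le hq (hle x k)
  · exact norm_qPochInf_le hq (hle y k)
  · have := norm_qPochInf_mul_pow_ge hq (α * t) (n + k)
    rwa [show α * t * q ^ (n + k) = α * q ^ n * (t * q ^ k) by ring] at this
  · have := norm_qPochInf_mul_pow_ge hq (β * t) k
    rwa [mul_assoc β] at this

lemma summable_qBetaTerm (hq : ‖q‖ < 1) (x y α β : ℂ) {t : ℂ}
    (hα : ∀ k : ℕ, α * t * q ^ k ≠ 1) (hβ : ∀ k : ℕ, β * t * q ^ k ≠ 1) :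
    Summable fun k : ℕ => qBetaTerm q x y α β (t * q ^ k) := by
  obtain ⟨M, hM⟩ := exists_norm_qBetaTerm_le hq x y α β hα hβ
  refine .of_norm_bounded ((summable_geometric_of_lt_one (norm_nonneg _) hq).mul_left M) ?_
  simpa using hM 0

/-- The difference of the two one-sided Jackson sums, up to a factor the Jackson integral of
`(qt/x, qt/y; q)_∞ / (αt, βt; q)_∞` from `y` to `x`. -/
noncomputable def qBetaIntegral (q x y α β : ℂ) : ℂ :=
  ∑' k : ℕ, qBetaTerm q x y α β (x * q ^ k) - ∑' k : ℕ, qBetaTerm q x y α β (y * q ^ k)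

lemma qBetaIntegral_swap (x y α β : ℂ) : qBetaIntegral q x y α β = -qBetaIntegral q y x α β := by
  simp only [qBetaIntegral, qBetaTerm_swap y x, neg_sub]

lemma qBetaIntegral_comm_param (x y α β : ℂ) :
    qBetaIntegral q x y α β = qBetaIntegral q x y β α := by
  simp only [qBetaIntegral, qBetaTerm_comm_param x y α]

/-- One half of the contiguous relation: the combination of summands is a `q`-difference, whose
boundary term vanishes at `t = x` and at `t = y`. -/
lemma tsum_qBetaTerm_step (hq : ‖q‖ < 1) {x y : ℂ} (hx : x ≠ 0) (hy : y ≠ 0) {α β t : ℂ}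
    (ht : t = x ∨ t = y)
    (hα : ∀ k : ℕ, α * t * q ^ k ≠ 1) (hβ : ∀ k : ℕ, β * t * q ^ k ≠ 1) :
    (1 - α * x) * (1 - α * y) * ∑' k : ℕ, qBetaTerm q x y α β (t * q ^ k)
      - (1 - α * β * x * y) * ∑' k : ℕ, qBetaTerm q x y (α * q) β (t * q ^ k) =
        -(α * x * y) := by
  have hs := summable_qBetaTerm hq x y α β hα hβ
  have hs' := summable_qBetaTerm hq x y (α * q) β (t := t) (fun k => by
    have := mul_pow_mul_pow_ne_one hα 1 k
    rwa [pow_one, mul_right_comm α] at this) hβ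
  have h := ((hs.hasSum.mul_left ((1 - α * x) * (1 - α * y))).sub
    (hs'.hasSum.mul_left (1 - α * β * x * y))).tendsto_sum_nat
  set G : ℕ → ℂ := fun k => α * x * y * (qPochInf (t / x * q ^ k) q * qPochInf (t / y * q ^ k) q /
    (qPochInf (α * t * q ^ k) q * qPochInf (β * t * q ^ k) q))
  have htel : ∀ k : ℕ, (1 - α * x) * (1 - α * y) * qBetaTerm q x y α β (t * q ^ k)
      - (1 - α * β * x * y) * qBetaTerm q x y (α * q) β (t * q ^ k) = G k - G (k + 1) := by
    intro k
    have e1 : qPochInf (t / x * q ^ k) q =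
        (1 - t / x * q ^ k) * qPochInf (t / x * q ^ (k + 1)) q := by
      rw [qPochInf_step hq (t / x * q ^ k), mul_assoc (t / x), ← pow_succ]
    have e2 : qPochInf (t / y * q ^ k) q =
        (1 - t / y * q ^ k) * qPochInf (t / y * q ^ (k + 1)) q := by
      rw [qPochInf_step hq (t / y * q ^ k), mul_assoc (t / y), ← pow_succ]
    have e3 : qPochInf (α * t * q ^ k) q =
        (1 - α * t * q ^ k) * qPochInf (α * t * q ^ (k + 1)) q := by
      rw [qPochInf_step hq (α * t * q ^ k), mul_assoc (α * t), ← pow_succ]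
    have e4 : qPochInf (β * t * q ^ k) q =
        (1 - β * t * q ^ k) * qPochInf (β * t * q ^ (k + 1)) q := by
      rw [qPochInf_step hq (β * t * q ^ k), mul_assoc (β * t), ← pow_succ]
    have n1 : qPochInf (α * t * q ^ (k + 1)) q ≠ 0 :=
      qPochInf_ne_zero hq (mul_pow_mul_pow_ne_one hα _)
    have n2 : qPochInf (β * t * q ^ (k + 1)) q ≠ 0 :=
      qPochInf_ne_zero hq (mul_pow_mul_pow_ne_one hβ _)
    have n3 : 1 - α * t * q ^ k ≠ 0 := sub_ne_zero.2 (hα k).symm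
    have n4 : 1 - β * t * q ^ k ≠ 0 := sub_ne_zero.2 (hβ k).symm
    have a1 : q * (t * q ^ k) / x = t / x * q ^ (k + 1) := by ring
    have a2 : q * (t * q ^ k) / y = t / y * q ^ (k + 1) := by ring
    have a3 : α * (t * q ^ k) = α * t * q ^ k := by ring
    have a4 : β * (t * q ^ k) = β * t * q ^ k := by ring
    have a5 : α * q * (t * q ^ k) = α * t * q ^ (k + 1) := by ring
    simp only [G, qBetaTerm, a1, a2, a3, a4, a5]
    rw [e1, e2, e3, e4]
    generalize q ^ k = Q at *
    generalize qPochInf (α * t * q ^ (k + 1)) q = X1 at *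
    generalize qPochInf (β * t * q ^ (k + 1)) q = X2 at *
    generalize qPochInf (t / x * q ^ (k + 1)) q = X3 at *
    generalize qPochInf (t / y * q ^ (k + 1)) q = X4 at *
    obtain ⟨D, hD⟩ : ∃ D, D = 1 - α * t * Q := ⟨_, rfl⟩
    obtain ⟨D', hD'⟩ : ∃ D', D' = 1 - β * t * Q := ⟨_, rfl⟩
    rw [← hD] at n3 ⊢
    rw [← hD'] at n4 ⊢
    field_simp
    rw [hD, hD']
    ring
  simp_rw [htel, Finset.sum_range_sub'] at h
  have hG0 : G 0 = 0 := by
    have h1 : qPochInf 1 q = 0 := (qPochInf_eq_zero_iff hq).2 ⟨0, by simp⟩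
    rcases ht with rfl | rfl
    · simp [G, div_self hx, h1]
    · simp [G, div_self hy, h1]
  have hG : Tendsto G atTop (𝓝 (α * x * y)) := by
    have := ((tendsto_qPochInf_mul_pow hq (t / x)).mul (tendsto_qPochInf_mul_pow hq (t / y))).div
      ((tendsto_qPochInf_mul_pow hq (α * t)).mul (tendsto_qPochInf_mul_pow hq (β * t))) (by simp)
    simpa [G] using this.const_mul (α * x * y)
  have := tendsto_nhds_unique h (hG.const_sub (G 0))
  rw [this, hG0, zero_sub]

lemma qBetaIntegral_step (hq : ‖q‖ < 1) {x y : ℂ} (hx : x ≠ 0) (hy : y ≠ 0) {α β : ℂ}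
    (hαx : ∀ k : ℕ, α * x * q ^ k ≠ 1) (hαy : ∀ k : ℕ, α * y * q ^ k ≠ 1)
    (hβx : ∀ k : ℕ, β * x * q ^ k ≠ 1) (hβy : ∀ k : ℕ, β * y * q ^ k ≠ 1) :
    (1 - α * x) * (1 - α * y) * qBetaIntegral q x y α β =
      (1 - α * β * x * y) * qBetaIntegral q x y (α * q) β := by
  have h1 := tsum_qBetaTerm_step hq hx hy (.inl rfl) hαx hβx
  have h2 := tsum_qBetaTerm_step hq hx hy (.inr rfl) hαy hβy
  rw [qBetaIntegral, qBetaIntegral]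
  linear_combination h1 - h2

lemma tendsto_tsum_qBetaTerm (hq : ‖q‖ < 1) (x y : ℂ) {α β t : ℂ}
    (hα : ∀ k : ℕ, α * t * q ^ k ≠ 1) (hβ : ∀ k : ℕ, β * t * q ^ k ≠ 1) :
    Tendsto (fun n : ℕ => ∑' k : ℕ, qBetaTerm q x y (α * q ^ n) β (t * q ^ k)) atTop
      (𝓝 (∑' k : ℕ, qBetaTerm q x y 0 β (t * q ^ k))) := by
  obtain ⟨M, hM⟩ := exists_norm_qBetaTerm_le hq x y α β hα hβ
  refine tendsto_tsum_of_dominated_convergence (bound := fun k => M * ‖q‖ ^ k)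
    ((summable_geometric_of_lt_one (norm_nonneg _) hq).mul_left M) (fun k => ?_)
    (.of_forall hM)
  have h := tendsto_qPochInf_mul_pow hq (α * (t * q ^ k))
  simp only [qBetaTerm, zero_mul, qPochInf_zero]
  refine (Tendsto.div tendsto_const_nhds (Tendsto.mul ?_ tendsto_const_nhds) ?_).const_mul _
  · simpa only [mul_right_comm α] using h
  · rw [one_mul, ← mul_assoc]
    exact qPochInf_ne_zero hq (mul_pow_mul_pow_ne_one hβ k)

/-- The dependence of the Jackson integral on `α`, from iterating the contiguous relation. -/
lemma qBetaIntegral_eq_zero_left (hq : ‖q‖ < 1) {x y : ℂ} (hx : x ≠ 0) (hy : y ≠ 0) {α β : ℂ}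
    (hαx : ∀ k : ℕ, α * x * q ^ k ≠ 1) (hαy : ∀ k : ℕ, α * y * q ^ k ≠ 1)
    (hβx : ∀ k : ℕ, β * x * q ^ k ≠ 1) (hβy : ∀ k : ℕ, β * y * q ^ k ≠ 1) :
    qPochInf (α * x) q * qPochInf (α * y) q * qBetaIntegral q x y α β =
      qPochInf (α * β * x * y) q * qBetaIntegral q x y 0 β := by
  have hiter : ∀ n : ℕ, qPoch (α * x) q n * qPoch (α * y) q n * qBetaIntegral q x y α β =
      qPoch (α * β * x * y) q n * qBetaIntegral q x y (α * q ^ n) β := by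
    intro n
    induction n with
    | zero => simp
    | succ n ih =>
      have := qBetaIntegral_step hq hx hy (α := α * q ^ n) (β := β)
        (fun k => by simpa only [mul_right_comm α] using mul_pow_mul_pow_ne_one hαx n k)
        (fun k => by simpa only [mul_right_comm α] using mul_pow_mul_pow_ne_one hαy n k) hβx hβy
      rw [pow_succ, ← mul_assoc α]
      simp only [qPoch_succ]
      linear_combination (1 - α * x * q ^ n) * (1 - α * y * q ^ n) * ih +
        qPoch (α * β * x * y) q n * this
  have h1 := ((tendsto_qPoch hq (α * x)).mul (tendsto_qPoch hq (α * y))).mul_const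
    (qBetaIntegral q x y α β)
  simp_rw [hiter] at h1
  exact tendsto_nhds_unique h1 ((tendsto_qPoch hq (α * β * x * y)).mul
    ((tendsto_tsum_qBetaTerm hq x y hαx hβx).sub (tendsto_tsum_qBetaTerm hq x y hαy hβy)))

/-- The telescoping sum of `u q^k (u q^{k+1}; q)_∞ = (u q^{k+1}; q)_∞ - (u q^k; q)_∞`. -/
lemma hasSum_mul_qPochInf (hq : ‖q‖ < 1) (u : ℂ) :
    HasSum (fun k : ℕ => u * q ^ k * qPochInf (u * q ^ (k + 1)) q) (1 - qPochInf u q) := by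
  have hs : Summable fun k : ℕ => u * q ^ k * qPochInf (u * q ^ (k + 1)) q := by
    refine .of_norm_bounded ((summable_geometric_of_lt_one (norm_nonneg _) hq).mul_left
      (‖u‖ * Real.exp (‖u‖ / (1 - ‖q‖)))) fun k => ?_
    rw [norm_mul, norm_mul, norm_pow, mul_right_comm]
    gcongr
    refine norm_qPochInf_le hq ?_
    rw [norm_mul, norm_pow]
    exact mul_le_of_le_one_right (norm_nonneg _) (pow_le_one₀ (norm_nonneg _) hq.le)
  have h := hs.hasSum.tendsto_sum_nat
  have htel : ∀ k : ℕ, u * q ^ k * qPochInf (u * q ^ (k + 1)) q =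
      qPochInf (u * q ^ (k + 1)) q - qPochInf (u * q ^ k) q := fun k => by
    rw [qPochInf_step hq (u * q ^ k), mul_assoc u (q ^ k) q, ← pow_succ]; ring
  simp_rw [htel, Finset.sum_range_sub fun k => qPochInf (u * q ^ k) q] at h
  have h2 := tendsto_nhds_unique h ((tendsto_qPochInf_mul_pow hq u).sub_const _)
  rw [pow_zero, mul_one] at h2
  rw [← h2]
  simpa only [htel] using hs.hasSum

/-- The choice `α = q / x`, `β = 0` cancels `(qt/x; q)_∞`, so that the Jackson sums telescope; the
value at `α = β = 0` follows from the dependence on `α`. -/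
lemma qBetaIntegral_zero_zero_of_ne (hq : ‖q‖ < 1) {x y : ℂ} (hx : x ≠ 0) (hy : y ≠ 0)
    (h : ∀ k : ℕ, q * y / x * q ^ k ≠ 1) :
    qBetaIntegral q x y 0 0 =
      (x - y) * qPochInf q q * qPochInf (q * x / y) q * qPochInf (q * y / x) q := by
  have hα : ∀ k : ℕ, q / x * x * q ^ k ≠ 1 := fun k => by
    rw [div_mul_cancel₀ _ hx]; exact mul_pow_ne_one_of_norm_lt hq hq k
  have hα' : ∀ k : ℕ, q / x * y * q ^ k ≠ 1 := fun k => by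
    rw [div_mul_eq_mul_div]; exact h k
  have h1 := qBetaIntegral_eq_zero_left hq hx hy (β := 0) hα hα' (by simp) (by simp)
  have hterm : ∀ t : ℂ, (∀ k : ℕ, q / x * t * q ^ k ≠ 1) →
      ∑' k : ℕ, qBetaTerm q x y (q / x) 0 (t * q ^ k) = y * (1 - qPochInf (t / y) q) := by
    intro t ht
    rw [← (hasSum_mul_qPochInf hq (t / y)).tsum_eq, ← tsum_mul_left]
    congr 1
    ext k
    have hne : qPochInf (q / x * (t * q ^ k)) q ≠ 0 := by
      rw [← mul_assoc]; exact qPochInf_ne_zero hq (mul_pow_mul_pow_ne_one ht k)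
    rw [qBetaTerm, mul_div_right_comm q _ x, zero_mul, qPochInf_zero, mul_one,
      mul_div_cancel_left₀ _ hne, show q * (t * q ^ k) / y = t / y * q ^ (k + 1) by ring]
    field_simp
  have h2 : qPochInf (1 : ℂ) q = 0 := (qPochInf_eq_zero_iff hq).2 ⟨0, by simp⟩
  rw [qBetaIntegral, hterm x hα, hterm y hα', div_self hy, h2, mul_zero, zero_mul, zero_mul,
    qPochInf_zero, one_mul, div_mul_cancel₀ _ hx, div_mul_eq_mul_div, qPochInf_step hq (x / y),
    div_mul_eq_mul_div, mul_comm x q] at h1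
  rw [← h1]
  field_simp
  ring

lemma qBetaIntegral_zero_zero (hq : ‖q‖ < 1) {x y : ℂ} (hx : x ≠ 0) (hy : y ≠ 0) :
    qBetaIntegral q x y 0 0 =
      (x - y) * qPochInf q q * qPochInf (q * x / y) q * qPochInf (q * y / x) q := by
  -- at most one of `q^{k+1} y / x = 1` and `q^{k+1} x / y = 1` can occur
  rcases le_or_gt ‖y‖ ‖x‖ with h | h
  · refine qBetaIntegral_zero_zero_of_ne hq hx hy (mul_pow_ne_one_of_norm_lt hq ?_)
    rw [norm_div, norm_mul, div_lt_one (norm_pos_iff.2 hx)]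
    exact (mul_lt_mul_of_pos_right hq (norm_pos_iff.2 hy)).trans_le (by simpa using h)
  · rw [qBetaIntegral_swap, qBetaIntegral_zero_zero_of_ne hq hy hx
      (mul_pow_ne_one_of_norm_lt hq ?_)]
    · ring
    rw [norm_div, norm_mul, div_lt_one (norm_pos_iff.2 hy)]
    exact (mul_lt_mul_of_pos_right hq (norm_pos_iff.2 hx)).trans_le (by simpa using h.le)

/-- The nonterminating `q`-Vandermonde sum, in the form of the Andrews–Askey `q`-beta integral. -/
lemma qBetaIntegral_eq (hq : ‖q‖ < 1) {x y : ℂ} (hx : x ≠ 0) (hy : y ≠ 0) {α β : ℂ}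
    (hαx : ∀ k : ℕ, α * x * q ^ k ≠ 1) (hαy : ∀ k : ℕ, α * y * q ^ k ≠ 1)
    (hβx : ∀ k : ℕ, β * x * q ^ k ≠ 1) (hβy : ∀ k : ℕ, β * y * q ^ k ≠ 1) :
    qBetaIntegral q x y α β =
      (x - y) * qPochInf (q * x / y) q * qPochInf (q * y / x) q * qPochInf q q
        * qPochInf (α * β * x * y) q /
        (qPochInf (α * x) q * qPochInf (α * y) q * qPochInf (β * x) q * qPochInf (β * y) q) := by
  have h1 := qBetaIntegral_eq_zero_left hq hx hy hαx hαy hβx hβy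
  have h2 := qBetaIntegral_eq_zero_left hq hx hy hβx hβy (β := 0) (by simp) (by simp)
  rw [qBetaIntegral_zero_zero hq hx hy, mul_zero, zero_mul, zero_mul, qPochInf_zero,
    qBetaIntegral_comm_param] at h2
  have n1 := qPochInf_ne_zero hq hαx
  have n2 := qPochInf_ne_zero hq hαy
  have n3 := qPochInf_ne_zero hq hβx
  have n4 := qPochInf_ne_zero hq hβy
  rw [eq_div_iff (by simp [n1, n2, n3, n4])]
  linear_combination (qPochInf (β * x) q * qPochInf (β * y) q) * h1 +
    qPochInf (α * β * x * y) q * h2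

end qBeta

/-! ### The three-term relation for `₃φ₂` series -/

section threeTerm

variable {q : ℂ}

/-- The factor `t (qt/x, qt/y, Aht; q)_∞ / (αt, βt, ht; q)_∞`; up to elementary factors, its values
at `t = x q^k` and `t = y q^k` are the residues of the Barnes integrand. -/
noncomputable def barnesTerm (q x y α β A h t : ℂ) : ℂ :=
  t * (qPochInf (q * t / x) q * qPochInf (q * t / y) q * qPochInf (A * h * t) q /
    (qPochInf (α * t) q * qPochInf (β * t) q * qPochInf (h * t) q))

/-- The coefficients in the expansion of `barnesTerm` into the functions `qBetaTerm` with `x`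
replaced by `x q^k`. -/
noncomputable def barnesCoeff (q x A h : ℂ) (k : ℕ) : ℂ :=
  qPoch A q k / (qPoch q q k * qPoch (A * h * x) q k) * (-(h * x)) ^ k * q ^ k.choose 2

/-- The factor `(x/t; q)_k` turns `(qt/x; q)_∞` into `(qt/(x q^k); q)_∞`. -/
lemma qPoch_div_mul_pow (hq : ‖q‖ < 1) (hq0 : q ≠ 0) {x t : ℂ} (hx : x ≠ 0) (ht : t ≠ 0) (k : ℕ) :
    qPoch (x / t) q k * t ^ k * qPochInf (q * t / x) q =
      (-x) ^ k * q ^ k.choose 2 * qPochInf (q * t / (x * q ^ k)) q := by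
  induction k with
  | zero => simp
  | succ k ih =>
    have h1 : qPochInf (q * t / (x * q ^ (k + 1))) q =
        (1 - t / (x * q ^ k)) * qPochInf (q * t / (x * q ^ k)) q := by
      have e : q * t / (x * q ^ (k + 1)) = t / (x * q ^ k) := by field_simp; ring
      rw [e, qPochInf_step hq, div_mul_eq_mul_div, mul_comm t]
    rw [qPoch_succ, pow_succ t, h1, Nat.choose_succ_succ' k 1, Nat.choose_one_right, pow_add q,
      pow_succ (-x)]
    have h2 : qPoch (x / t) q k * (1 - x / t * q ^ k) * (t ^ k * t) * qPochInf (q * t / x) q =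
      (qPoch (x / t) q k * t ^ k * qPochInf (q * t / x) q) * (t - x * q ^ k) := by
      field_simp
    rw [h2, ih]
    field_simp
    ring

lemma qGaussTerm_mul_qBetaTerm (hq : ‖q‖ < 1) (hq0 : q ≠ 0) {x t : ℂ} (hx : x ≠ 0) (ht : t ≠ 0)
    (y α β A h : ℂ) (k : ℕ) :
    qGaussTerm q A (x / t) (h * t) k * qBetaTerm q x y α β t =
      barnesCoeff q x A h k * qBetaTerm q (x * q ^ k) y α β t := by
  have h1 := qPoch_div_mul_pow hq hq0 hx ht k
  have h2 : A * (x / t) * (h * t) = A * h * x := by field_simp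
  rw [qGaussTerm, barnesCoeff, qBetaTerm, qBetaTerm, h2, mul_pow h t, neg_mul_eq_mul_neg h x,
    mul_pow h]
  linear_combination (qPoch A q k / (qPoch q q k * qPoch (A * h * x) q k) * h ^ k * t *
    qPochInf (q * t / y) q / (qPochInf (α * t) q * qPochInf (β * t) q)) * h1

/-- Expansion of `(Aht; q)_∞ / (ht; q)_∞` by the `q`-Gauss sum with numerator parameters `A` and
`x/t`; the factor `(x/t; q)_k` is absorbed into `(qt/x; q)_∞` and shifts `x` to `x q^k`. -/
lemma hasSum_barnesTerm (hq : ‖q‖ < 1) (hq0 : q ≠ 0) {x t : ℂ} (hx : x ≠ 0) (ht : t ≠ 0)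
    (y α β : ℂ) {A h : ℂ} (hht : ‖h * t‖ < 1)
    (hg : ∀ k : ℕ, A * h * x * q ^ k ≠ 1) :
    HasSum (fun k => barnesCoeff q x A h k * qBetaTerm q (x * q ^ k) y α β t)
      (qPochInf (h * x) q / qPochInf (A * h * x) q * barnesTerm q x y α β A h t) := by
  have h2 : A * (x / t) * (h * t) = A * h * x := by field_simp
  have h3 : x / t * (h * t) = h * x := by field_simp
  have h1 := (hasSum_qGaussTerm hq A (x / t) hht (by simpa only [h2] using hg)).mul_right
    (qBetaTerm q x y α β t)
  simp_rw [qGaussTerm_mul_qBetaTerm hq hq0 hx ht] at h1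
  have h4 : qPochInf (h * x) q / qPochInf (A * h * x) q * barnesTerm q x y α β A h t =
      qPochInf (A * (h * t)) q * qPochInf (x / t * (h * t)) q /
        (qPochInf (A * (x / t) * (h * t)) q * qPochInf (h * t) q) * qBetaTerm q x y α β t := by
    rw [h2, h3, barnesTerm, qBetaTerm, ← mul_assoc A]
    ring
  rwa [h4]

/-- The growth of `(a/p; q)_k` as `p → 0` is compensated by `p^k`, uniformly in `k`. -/
lemma norm_qPoch_div_mul_pow_le (hq : ‖q‖ < 1) (a : ℂ) {p : ℂ} (hp : p ≠ 0) (hp1 : ‖p‖ ≤ 1)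
    (k : ℕ) : ‖qPoch (a / p) q k * p ^ k‖ ≤ Real.exp (‖a‖ / (1 - ‖q‖)) := by
  have hs := summable_geometric_of_lt_one (norm_nonneg q) hq
  have h1 : qPoch (a / p) q k * p ^ k = ∏ m ∈ Finset.range k, (p - a * q ^ m) := by
    rw [qPoch, ← Finset.card_range k, ← Finset.prod_const, Finset.card_range,
      ← Finset.prod_mul_distrib]
    exact Finset.prod_congr rfl fun m _ => by field_simp
  rw [h1, norm_prod]
  calc ∏ m ∈ Finset.range k, ‖p - a * q ^ m‖
      ≤ ∏ m ∈ Finset.range k, (1 + ‖a‖ * ‖q‖ ^ m) := by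
        refine Finset.prod_le_prod (fun _ _ => norm_nonneg _) fun m _ => ?_
        refine (norm_sub_le _ _).trans ?_
        rw [norm_mul, norm_pow]
        gcongr
    _ ≤ Real.exp (∑ m ∈ Finset.range k, ‖a‖ * ‖q‖ ^ m) :=
        Real.prod_one_add_le_exp_sum _ fun m => by positivity
    _ ≤ _ := by
        rw [Real.exp_le_exp, ← Finset.mul_sum, div_eq_mul_inv, ← tsum_geometric_of_lt_one
          (norm_nonneg q) hq]
        exact mul_le_mul_of_nonneg_left (hs.sum_le_tsum _ fun _ _ => by positivity) (norm_nonneg _)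

/-- The double series obtained by expanding `barnesTerm` along `t, tq, tq², …` converges
absolutely. -/
lemma summable_barnesCoeff_mul (hq : ‖q‖ < 1) (hq0 : q ≠ 0) {x t : ℂ} (hx : x ≠ 0) (ht : t ≠ 0)
    (y : ℂ) {α β A h : ℂ} (hht : ‖h * t‖ < 1) (hg : ∀ k : ℕ, A * h * x * q ^ k ≠ 1)
    (hα : ∀ k : ℕ, α * t * q ^ k ≠ 1) (hβ : ∀ k : ℕ, β * t * q ^ k ≠ 1) :
    Summable fun p : ℕ × ℕ =>
      barnesCoeff q x A h p.2 * qBetaTerm q (x * q ^ p.2) y α β (t * q ^ p.1) := by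
  obtain ⟨M, hM⟩ := exists_norm_qBetaTerm_le hq x y α β hα hβ
  obtain ⟨m, hm0, hm⟩ := exists_le_norm_qPoch hq hg
  obtain ⟨m', hm'0, hm'⟩ := exists_le_norm_qPoch hq (mul_pow_ne_one_of_norm_lt hq hq)
  set MA := Real.exp (‖A‖ / (1 - ‖q‖))
  set MB := Real.exp (‖x / t‖ / (1 - ‖q‖))
  have hsum : Summable fun p : ℕ × ℕ => ‖q‖ ^ p.1 * ‖h * t‖ ^ p.2 :=
    (summable_geometric_of_lt_one (norm_nonneg _) hq).mul_of_nonneg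
      (summable_geometric_of_lt_one (norm_nonneg _) hht)
      (fun _ => by positivity) (fun _ => by positivity)
  refine .of_norm_bounded (hsum.mul_left (MA * MB / (m' * m) * M)) fun ⟨j, k⟩ => ?_
  have htj : t * q ^ j ≠ 0 := mul_ne_zero ht (pow_ne_zero _ hq0)
  dsimp only
  rw [← qGaussTerm_mul_qBetaTerm hq hq0 hx htj, norm_mul]
  have h1 : ‖qGaussTerm q A (x / (t * q ^ j)) (h * (t * q ^ j)) k‖ ≤
      MA * MB / (m' * m) * ‖h * t‖ ^ k := by
    have e : qGaussTerm q A (x / (t * q ^ j)) (h * (t * q ^ j)) k =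
        qPoch A q k * (qPoch (x / t / q ^ j) q k * (q ^ j) ^ k) /
          (qPoch q q k * qPoch (A * h * x) q k) * (h * t) ^ k := by
      have h2 : A * (x / (t * q ^ j)) * (h * (t * q ^ j)) = A * h * x := by field_simp
      rw [qGaussTerm, h2, ← mul_assoc h, mul_pow _ (q ^ j), div_div]
      ring
    rw [e, norm_mul, norm_div, norm_mul, norm_mul (qPoch q q k), norm_pow]
    gcongr
    · exact norm_qPoch_le hq le_rfl k
    · refine norm_qPoch_div_mul_pow_le hq _ (pow_ne_zero _ hq0) ?_ k
      rw [norm_pow]; exact pow_le_one₀ (norm_nonneg _) hq.le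
    · exact hm' k
    · exact hm k
  have h2 : ‖qBetaTerm q x y α β (t * q ^ j)‖ ≤ M * ‖q‖ ^ j := by simpa using hM 0 j
  calc _ ≤ (MA * MB / (m' * m) * ‖h * t‖ ^ k) * (M * ‖q‖ ^ j) := by gcongr
    _ = _ := by ring

/-- Summation of the expansion along `t, tq, tq², …`, with the two sums interchanged. -/
lemma hasSum_barnesTerm_sum (hq : ‖q‖ < 1) (hq0 : q ≠ 0) {x t : ℂ} (hx : x ≠ 0) (ht : t ≠ 0)
    (y : ℂ) {α β A h : ℂ} (hht : ‖h * t‖ < 1) (hhx : ‖h * x‖ < 1)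
    (hg : ∀ k : ℕ, A * h * x * q ^ k ≠ 1)
    (hα : ∀ k : ℕ, α * t * q ^ k ≠ 1) (hβ : ∀ k : ℕ, β * t * q ^ k ≠ 1) :
    (Summable fun j : ℕ => barnesTerm q x y α β A h (t * q ^ j)) ∧
    HasSum (fun k => barnesCoeff q x A h k *
        ∑' j : ℕ, qBetaTerm q (x * q ^ k) y α β (t * q ^ j))
      (qPochInf (h * x) q / qPochInf (A * h * x) q *
        ∑' j : ℕ, barnesTerm q x y α β A h (t * q ^ j)) := by
  have hs := summable_barnesCoeff_mul hq hq0 hx ht y hht hg hα hβ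
  have hc : qPochInf (h * x) q / qPochInf (A * h * x) q ≠ 0 :=
    div_ne_zero (qPochInf_ne_zero hq (mul_pow_ne_one_of_norm_lt hq hhx)) (qPochInf_ne_zero hq hg)
  have h1 := hs.hasSum.prod_fiberwise fun j => hasSum_barnesTerm hq hq0 hx
    (mul_ne_zero ht (pow_ne_zero j hq0)) y α β (A := A)
    (by rw [← mul_assoc]; exact norm_mul_pow_lt_one hq hht j) hg
  have hs1 : Summable fun j : ℕ => barnesTerm q x y α β A h (t * q ^ j) :=
    (summable_mul_left_iff hc).1 h1.summable
  refine ⟨hs1, ?_⟩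
  rw [← tsum_mul_left, h1.tsum_eq]
  have h2 := hs.prod_symm.hasSum.prod_fiberwise fun k =>
    ((hs.prod_symm.prod_factor k).hasSum)
  dsimp only [Prod.swap] at h2
  simp_rw [tsum_mul_left] at h2
  have h3 := (Equiv.prodComm ℕ ℕ).tsum_eq fun p : ℕ × ℕ =>
      barnesCoeff q x A h p.2 * qBetaTerm q (x * q ^ p.2) y α β (t * q ^ p.1)
  rw [← h3]
  exact h2

/-- The quasi-periodicity of the theta function `(q^{k+1} x / y, y / (q^k x); q)_∞`. -/
lemma theta_mul_pow (hq : ‖q‖ < 1) (hq0 : q ≠ 0) {x y : ℂ} (hx : x ≠ 0) (hy : y ≠ 0) (k : ℕ) :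
    (-x) ^ k * q ^ k.choose 2 * ((x * q ^ k - y) * qPochInf (q * (x * q ^ k) / y) q *
        qPochInf (q * y / (x * q ^ k)) q) =
      y ^ k * ((x - y) * qPochInf (q * x / y) q * qPochInf (q * y / x) q) := by
  induction k with
  | zero => simp
  | succ k ih =>
    rw [pow_succ y, mul_right_comm (y ^ k), ← ih, Nat.choose_succ_succ' k 1, Nat.choose_one_right,
      pow_add q, pow_succ (-x)]
    have e1 : qPochInf (q * (x * q ^ k) / y) q = (1 - x * q ^ (k + 1) / y) *
        qPochInf (q * (x * q ^ (k + 1)) / y) q := by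
      rw [qPochInf_step hq, show q * (x * q ^ k) / y * q = q * (x * q ^ (k + 1)) / y by ring,
        show q * (x * q ^ k) / y = x * q ^ (k + 1) / y by ring]
    have e2 : qPochInf (q * y / (x * q ^ (k + 1))) q = (1 - y / (x * q ^ k)) *
        qPochInf (q * y / (x * q ^ k)) q := by
      have e : q * y / (x * q ^ (k + 1)) = y / (x * q ^ k) := by field_simp; ring
      rw [e, qPochInf_step hq, div_mul_eq_mul_div, mul_comm y]
    rw [e1, e2]
    field_simp
    ring

/-- The contribution of the `k`-th term of the expansion is the `k`-th term of the `₃φ₂` series, up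
to a factor independent of `k`. -/
lemma qBetaIntegral_mul_pow (hq : ‖q‖ < 1) (hq0 : q ≠ 0) {x y : ℂ} (hx : x ≠ 0) (hy : y ≠ 0)
    {α β A h : ℂ}
    (hαx : ∀ k : ℕ, α * x * q ^ k ≠ 1) (hαy : ∀ k : ℕ, α * y * q ^ k ≠ 1)
    (hβx : ∀ k : ℕ, β * x * q ^ k ≠ 1) (hβy : ∀ k : ℕ, β * y * q ^ k ≠ 1)
    (hs : ∀ k : ℕ, α * β * x * y * q ^ k ≠ 1) (k : ℕ) :
    barnesCoeff q x A h k * qBetaIntegral q (x * q ^ k) y α β =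
      (x - y) * qPochInf (q * x / y) q * qPochInf (q * y / x) q * qPochInf q q
        * qPochInf (α * β * x * y) q /
        (qPochInf (α * x) q * qPochInf (α * y) q * qPochInf (β * x) q * qPochInf (β * y) q) *
      basicHypergeometricTerm [A, α * x, β * x] [A * h * x, α * β * x * y] q (h * y) k := by
  have n1 := qPochInf_ne_zero hq (mul_pow_mul_pow_ne_one hαx k)
  have n2 := qPochInf_ne_zero hq hαy
  have n3 := qPochInf_ne_zero hq (mul_pow_mul_pow_ne_one hβx k)
  have n4 := qPochInf_ne_zero hq hβy
  have n5 := qPoch_ne_zero hαx k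
  have n6 := qPoch_ne_zero hβx k
  have n7 := qPoch_ne_zero hs k
  rw [qBetaIntegral_eq hq (mul_ne_zero hx (pow_ne_zero k hq0)) hy
    (by simpa only [mul_assoc] using mul_pow_mul_pow_ne_one hαx k) hαy
    (by simpa only [mul_assoc] using mul_pow_mul_pow_ne_one hβx k) hβy]
  have hth := theta_mul_pow hq hq0 hx hy k
  have a1 : α * (x * q ^ k) = α * x * q ^ k := by ring
  have a2 : β * (x * q ^ k) = β * x * q ^ k := by ring
  have a3 : α * β * (x * q ^ k) * y = α * β * x * y * q ^ k := by ring
  rw [a1, a2, a3, qPochInf_eq_qPoch_mul hq (α * x) k, qPochInf_eq_qPoch_mul hq (β * x) k,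
    qPochInf_eq_qPoch_mul hq (α * β * x * y) k]
  simp only [basicHypergeometricTerm, barnesCoeff, List.map_cons, List.map_nil, List.prod_cons,
    List.prod_nil, List.length_cons, List.length_nil, mul_one]
  rw [show (1 + ((0 + 1 + 1 : ℕ) : ℤ) - ((0 + 1 + 1 + 1 : ℕ) : ℤ)) = 0 by norm_num, zpow_zero,
    mul_one, mul_pow h y, neg_mul_eq_mul_neg h x, mul_pow h]
  generalize qPochInf (α * x * q ^ k) q = X1 at *
  generalize qPochInf (β * x * q ^ k) q = X2 at *
  generalize qPochInf (α * y) q = X3 at *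
  generalize qPochInf (β * y) q = X4 at *
  generalize qPoch (α * β * x * y) q k = X5 at *
  generalize qPoch (α * x) q k = X6 at *
  generalize qPoch (β * x) q k = X7 at *
  generalize qPochInf (α * β * x * y * q ^ k) q = X8 at *
  have e : ∀ R S U V : ℂ, R / S * (h ^ k * (-x) ^ k) * q ^ k.choose 2 *
      (U * qPochInf q q * X8 / V) =
      R / S * h ^ k * qPochInf q q * X8 / V * ((-x) ^ k * q ^ k.choose 2 * U) := by
    intros; ring
  rw [e, hth]
  field_simp

/-- The summands with `j < k` vanish, since `(q^{1+j-k}; q)_∞ = 0`. -/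
lemma tsum_qBetaTerm_mul_pow (hq : ‖q‖ < 1) (hq0 : q ≠ 0) {x : ℂ} (hx : x ≠ 0) (y : ℂ) {α β : ℂ}
    (hαx : ∀ k : ℕ, α * x * q ^ k ≠ 1) (hβx : ∀ k : ℕ, β * x * q ^ k ≠ 1) (k : ℕ) :
    ∑' j : ℕ, qBetaTerm q (x * q ^ k) y α β (x * q ^ j) =
      ∑' j : ℕ, qBetaTerm q (x * q ^ k) y α β (x * q ^ k * q ^ j) := by
  have hs := summable_qBetaTerm hq (x * q ^ k) y α β hαx hβx
  rw [← hs.sum_add_tsum_nat_add k, Finset.sum_eq_zero, zero_add]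
  · congr 1; ext j; rw [mul_assoc x, ← pow_add, add_comm j]
  · intro j hj
    have hj' := Finset.mem_range.1 hj
    have : qPochInf (q * (x * q ^ j) / (x * q ^ k)) q = 0 := by
      refine (qPochInf_eq_zero_iff hq).2 ⟨k - (j + 1), ?_⟩
      rw [div_mul_eq_mul_div, div_eq_one_iff_eq (mul_ne_zero hx (pow_ne_zero k hq0))]
      have : q ^ k = q * q ^ j * q ^ (k - (j + 1)) := by
        rw [← pow_succ', ← pow_add, Nat.add_sub_cancel' hj']
      rw [this]; ring
    simp [qBetaTerm, this]

/-- The three-term relation: the sums of `barnesTerm` along `x q^k` and `y q^k` combine to a single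
`₃φ₂`. Both sums are expanded by `hasSum_barnesTerm`, and each resulting difference is evaluated by
the nonterminating `q`-Vandermonde sum. -/
theorem tsum_barnesTerm_sub_tsum_barnesTerm (hq : ‖q‖ < 1) (hq0 : q ≠ 0) {x y : ℂ} (hx : x ≠ 0)
    (hy : y ≠ 0) {α β A h : ℂ} (hhx : ‖h * x‖ < 1) (hhy : ‖h * y‖ < 1)
    (hg : ∀ k : ℕ, A * h * x * q ^ k ≠ 1)
    (hαx : ∀ k : ℕ, α * x * q ^ k ≠ 1) (hαy : ∀ k : ℕ, α * y * q ^ k ≠ 1)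
    (hβx : ∀ k : ℕ, β * x * q ^ k ≠ 1) (hβy : ∀ k : ℕ, β * y * q ^ k ≠ 1)
    (hs : ∀ k : ℕ, α * β * x * y * q ^ k ≠ 1) :
    ∑' k : ℕ, barnesTerm q x y α β A h (x * q ^ k)
        - ∑' k : ℕ, barnesTerm q x y α β A h (y * q ^ k) =
      (x - y) * qPochInf (q * x / y) q * qPochInf (q * y / x) q * qPochInf q q
        * qPochInf (α * β * x * y) q * qPochInf (A * h * x) q /
        (qPochInf (α * x) q * qPochInf (α * y) q * qPochInf (β * x) q * qPochInf (β * y) q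
          * qPochInf (h * x) q) *
      basicHypergeometric [A, α * x, β * x] [A * h * x, α * β * x * y] q (h * y) := by
  have h1 := (hasSum_barnesTerm_sum hq hq0 hx hx y hhx hhx hg hαx hβx).2
  have h2 := (hasSum_barnesTerm_sum hq hq0 hx hy y hhy hhx hg hαy hβy).2
  have h3 := h1.sub h2
  simp_rw [tsum_qBetaTerm_mul_pow hq hq0 hx y hαx hβx, ← mul_sub] at h3
  have h4 := h3.tsum_eq
  simp only [← qBetaIntegral.eq_1] at h4
  simp_rw [qBetaIntegral_mul_pow hq hq0 hx hy hαx hαy hβx hβy hs, tsum_mul_left] at h4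
  have n1 := qPochInf_ne_zero hq (mul_pow_ne_one_of_norm_lt hq hhx)
  have n2 := qPochInf_ne_zero hq hg
  have key : ∀ P D n g X S : ℂ, n ≠ 0 → g ≠ 0 → P / D * S = n / g * X →
      X = P * g / (D * n) * S := by
    intro P D n g X S hn hg h
    rw [div_mul_eq_mul_div n, eq_div_iff hg] at h
    refine mul_left_cancel₀ hn (h.symm.trans ?_)
    field_simp
  exact key _ _ _ _ _ _ n1 n2 h4

lemma summable_basicHypergeometricTerm_three_two (hq : ‖q‖ < 1) (A B C : ℂ) {D E z : ℂ}
    (hz : ‖z‖ < 1) (hD : ∀ k : ℕ, D * q ^ k ≠ 1) (hE : ∀ k : ℕ, E * q ^ k ≠ 1) :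
    Summable (basicHypergeometricTerm [A, B, C] [D, E] q z) := by
  obtain ⟨m₁, h₁, hm₁⟩ := exists_le_norm_qPoch hq (mul_pow_ne_one_of_norm_lt hq hq)
  obtain ⟨m₂, h₂, hm₂⟩ := exists_le_norm_qPoch hq hD
  obtain ⟨m₃, h₃, hm₃⟩ := exists_le_norm_qPoch hq hE
  set M := fun A : ℂ => Real.exp (‖A‖ / (1 - ‖q‖))
  have hM : ∀ A k, ‖qPoch A q k‖ ≤ M A := fun A k => norm_qPoch_le hq le_rfl k
  refine .of_norm_bounded ((summable_geometric_of_lt_one (norm_nonneg _) hz).mul_left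
    (M A * (M B * M C) / (m₁ * (m₂ * m₃)))) fun k => ?_
  simp only [basicHypergeometricTerm, List.map_cons, List.map_nil, List.prod_cons,
    List.prod_nil, List.length_cons, List.length_nil, mul_one]
  rw [show (1 + ((0 + 1 + 1 : ℕ) : ℤ) - ((0 + 1 + 1 + 1 : ℕ) : ℤ)) = 0 by norm_num, zpow_zero,
    mul_one]
  simp only [norm_mul, norm_div, norm_pow]
  have hM0 : ∀ A, 0 ≤ M A := fun A => (Real.exp_pos _).le
  gcongr <;> first | exact hM _ _ | exact hM0 _ | exact hm₁ _ | exact hm₂ _ | exact hm₃ _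

end threeTerm

/-! ### Integrals along upward contours -/

section contour

open MeasureTheory

lemma intervalIntegrable_deriv_contour {γ : ℝ → ℂ} (hγ : IsUpwardContour γ) (a b : ℝ) :
    IntervalIntegrable (deriv γ) volume a b := by
  obtain ⟨M, hM⟩ := hγ.deriv_bounded
  refine (intervalIntegrable_const (c := M)).mono_fun
    (measurable_deriv γ).aestronglyMeasurable (.of_forall fun t => ?_)
  exact (hM t).trans (le_abs_self M)

lemma intervalIntegrable_mul_deriv_contour {γ : ℝ → ℂ} (hγ : IsUpwardContour γ) {f : ℝ → ℂ}
    (hf : Continuous f) (a b : ℝ) :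
    IntervalIntegrable (fun t => f t * deriv γ t) volume a b :=
  (intervalIntegrable_deriv_contour hγ a b).continuousOn_mul hf.continuousOn

/-- The fundamental theorem of calculus along a contour. -/
lemma integral_mul_deriv_contour {γ : ℝ → ℂ} (hγ : IsUpwardContour γ) {H h : ℂ → ℂ}
    (hH : ∀ t, HasDerivAt H (h (γ t)) (γ t)) (hh : Continuous fun t => h (γ t)) (a b : ℝ) :
    ∫ t in a..b, h (γ t) * deriv γ t = H (γ b) - H (γ a) := by
  obtain ⟨S, hS⟩ := hγ.piecewise
  refine integral_eq_of_hasDerivAt_off_countable (fun t => H (γ t)) _ S.countable_toSet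
    (fun t _ => ((hH t).continuousAt.comp hγ.continuous.continuousAt).continuousWithinAt) ?_
    (intervalIntegrable_mul_deriv_contour hγ hh a b)
  intro t ht
  exact (hH t).comp t ((hS t ht.2).differentiableAt (by norm_num)).hasDerivAt

lemma exists_contour_top {γ : ℝ → ℂ} (hγ : IsUpwardContour γ) :
    ∃ σ : ℝ, ∀ᶠ t in atTop, γ t = (σ : ℂ) + (t : ℂ) * Complex.I := by
  obtain ⟨σ, T, h⟩ := hγ.top_vertical
  exact ⟨σ, eventually_atTop.2 ⟨T, h⟩⟩

lemma exists_contour_bot {γ : ℝ → ℂ} (hγ : IsUpwardContour γ) :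
    ∃ σ : ℝ, ∀ᶠ t in atTop, γ (-t) = (σ : ℂ) - (t : ℂ) * Complex.I := by
  obtain ⟨σ, T, h⟩ := hγ.bottom_vertical
  refine ⟨σ, eventually_atTop.2 ⟨-T, fun t ht => ?_⟩⟩
  rw [h (-t) (by linarith)]
  push_cast; ring

/-- `log (w + R u) = log R + log u + o(1)` as `R → ∞`. -/
lemma tendsto_log_vertical (w : ℂ) {u : ℂ} (hu : u ∈ Complex.slitPlane) :
    Tendsto (fun R : ℝ => Complex.log (w + R * u) - Real.log R) atTop (𝓝 (Complex.log u)) := by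
  have h1 : Tendsto (fun R : ℝ => w * ((R⁻¹ : ℝ) : ℂ) + u) atTop (𝓝 u) := by
    have : Tendsto (fun R : ℝ => ((R⁻¹ : ℝ) : ℂ)) atTop (𝓝 ((0 : ℝ) : ℂ)) :=
      (Complex.continuous_ofReal.tendsto 0).comp tendsto_inv_atTop_zero
    simpa using (this.const_mul w).add_const u
  have h2 := (continuousAt_clog hu).tendsto.comp h1
  refine h2.congr' ?_
  have h3 : ∀ᶠ z in 𝓝 u, z ≠ 0 := by
    refine isOpen_ne.mem_nhds ?_
    rintro rfl
    simp at hu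
  filter_upwards [eventually_gt_atTop 0, h1.eventually h3] with R hR hne
  have hR' : (R : ℂ) ≠ 0 := by exact_mod_cast hR.ne'
  have : w + R * u = R * (w * ((R⁻¹ : ℝ) : ℂ) + u) := by push_cast; field_simp
  rw [this, Complex.log_ofReal_mul hR hne]
  simp

lemma I_mem_slitPlane : Complex.I ∈ Complex.slitPlane := by simp [Complex.mem_slitPlane_iff]

lemma neg_I_mem_slitPlane : -Complex.I ∈ Complex.slitPlane := by simp [Complex.mem_slitPlane_iff]

/-- A contour that does not meet the horizontal ray from `p` to the left has `p` on its left: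
`log (ζ - p)` is a primitive of `1 / (ζ - p)` along it. -/
lemma liesLeftOf_of_ray {γ : ℝ → ℂ} (hγ : IsUpwardContour γ) {p : ℂ}
    (h : ∀ t : ℝ, γ t - p ∈ Complex.slitPlane) : LiesLeftOf p γ := by
  have hne : ∀ t, γ t - p ≠ 0 := fun t => Complex.slitPlane_ne_zero (h t)
  refine ⟨fun t => sub_ne_zero.1 (hne t), ?_⟩
  have hint : ∀ R : ℝ, ∫ t in (-R)..R, deriv γ t / (γ t - p) =
      Complex.log (γ R - p) - Complex.log (γ (-R) - p) := by
    intro R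
    rw [← integral_mul_deriv_contour hγ (H := fun z => Complex.log (z - p))
      (h := fun z => (z - p)⁻¹)]
    · exact intervalIntegral.integral_congr fun t _ => by simp [div_eq_mul_inv, mul_comm]
    · intro t
      have := (Complex.hasDerivAt_log (h t)).comp (γ t) ((hasDerivAt_id (γ t)).sub_const p)
      simpa using! this
    · exact (hγ.continuous.sub continuous_const).inv₀ hne
  simp_rw [hint]
  obtain ⟨σ, hσ⟩ := exists_contour_top hγ
  obtain ⟨τ, hτ⟩ := exists_contour_bot hγ
  have h1 := (tendsto_log_vertical (σ - p) I_mem_slitPlane).sub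
    (tendsto_log_vertical (τ - p) neg_I_mem_slitPlane)
  have h2 : Complex.log Complex.I - Complex.log (-Complex.I) = Real.pi * Complex.I := by
    rw [Complex.log_I, Complex.log_neg_I]; ring
  rw [h2] at h1
  refine h1.congr' ?_
  filter_upwards [hσ, hτ] with R h3 h4
  rw [h3, h4, show (σ : ℂ) - p + R * Complex.I = σ + R * Complex.I - p by ring,
    show (τ : ℂ) - p + R * -Complex.I = τ - R * Complex.I - p by ring]
  ring

/-- A contour that does not meet the horizontal ray from `p` to the right has `p` on its right. -/
lemma liesRightOf_of_ray {γ : ℝ → ℂ} (hγ : IsUpwardContour γ) {p : ℂ}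
    (h : ∀ t : ℝ, p - γ t ∈ Complex.slitPlane) : LiesRightOf p γ := by
  have hne : ∀ t, p - γ t ≠ 0 := fun t => Complex.slitPlane_ne_zero (h t)
  refine ⟨fun t => (sub_ne_zero.1 (hne t)).symm, ?_⟩
  have hint : ∀ R : ℝ, ∫ t in (-R)..R, deriv γ t / (γ t - p) =
      Complex.log (p - γ R) - Complex.log (p - γ (-R)) := by
    intro R
    rw [← integral_mul_deriv_contour hγ (H := fun z => Complex.log (p - z))
      (h := fun z => -(p - z)⁻¹)]
    · refine intervalIntegral.integral_congr fun t _ => ?_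
      rw [← neg_sub p, div_neg, div_eq_mul_inv]; ring
    · intro t
      have := (Complex.hasDerivAt_log (h t)).comp (γ t) ((hasDerivAt_id (γ t)).const_sub p)
      simpa using! this
    · exact ((continuous_const.sub hγ.continuous).inv₀ hne).neg
  simp_rw [hint]
  obtain ⟨σ, hσ⟩ := exists_contour_top hγ
  obtain ⟨τ, hτ⟩ := exists_contour_bot hγ
  have h1 := (tendsto_log_vertical (p - σ) neg_I_mem_slitPlane).sub
    (tendsto_log_vertical (p - τ) I_mem_slitPlane)
  have h2 : Complex.log (-Complex.I) - Complex.log Complex.I = -(Real.pi * Complex.I) := by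
    rw [Complex.log_I, Complex.log_neg_I]; ring
  rw [h2] at h1
  refine h1.congr' ?_
  filter_upwards [hσ, hτ] with R h3 h4
  rw [h3, h4, show p - (σ : ℂ) + R * -Complex.I = p - (σ + R * Complex.I) by ring,
    show p - (τ : ℂ) + R * Complex.I = p - (τ - R * Complex.I) by ring]
  ring

lemma not_liesLeftOf_of_liesRightOf {γ : ℝ → ℂ} {p : ℂ} (h : LiesRightOf p γ) :
    ¬ LiesLeftOf p γ := by
  intro h'
  have h1 := tendsto_nhds_unique h.2 h'.2
  have h2 : (Real.pi : ℂ) * Complex.I ≠ 0 := by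
    simp [Real.pi_ne_zero]
  exact h2 (by linear_combination (-1 / 2 : ℂ) * h1)

/-- The vertical line `Re s = N`. -/
noncomputable def verticalLine (N : ℝ) (t : ℝ) : ℂ := (N : ℂ) + (t : ℂ) * Complex.I

lemma hasDerivAt_verticalLine (N t : ℝ) : HasDerivAt (verticalLine N) Complex.I t := by
  have h := ((Complex.ofRealCLM.hasDerivAt (x := t)).mul_const Complex.I).const_add (N : ℂ)
  rwa [Complex.ofRealCLM_apply, Complex.ofReal_one, one_mul] at h

lemma deriv_verticalLine (N t : ℝ) : deriv (verticalLine N) t = Complex.I :=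
  (hasDerivAt_verticalLine N t).deriv

lemma isUpwardContour_verticalLine (N : ℝ) : IsUpwardContour (verticalLine N) where
  continuous := by unfold verticalLine; fun_prop
  piecewise := by
    refine ⟨∅, fun t _ => ?_⟩
    have : ContDiff ℝ 1 (verticalLine N) :=
      contDiff_const.add (Complex.ofRealCLM.contDiff.mul contDiff_const)
    exact this.contDiffAt
  deriv_bounded := ⟨1, fun t => by simp [deriv_verticalLine]⟩
  top_vertical := ⟨N, 0, fun _ _ => rfl⟩
  bottom_vertical := ⟨N, 0, fun _ _ => rfl⟩

lemma verticalLine_re (N t : ℝ) : (verticalLine N t).re = N := by simp [verticalLine]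

lemma verticalLine_im (N t : ℝ) : (verticalLine N t).im = t := by simp [verticalLine]

lemma liesLeftOf_verticalLine {N : ℝ} {p : ℂ} (hp : p.re < N) :
    LiesLeftOf p (verticalLine N) :=
  liesLeftOf_of_ray (isUpwardContour_verticalLine N) fun t =>
    .inl (by rw [Complex.sub_re, verticalLine_re]; linarith)

lemma liesRightOf_verticalLine {N : ℝ} {p : ℂ} (hp : N < p.re) :
    LiesRightOf p (verticalLine N) :=
  liesRightOf_of_ray (isUpwardContour_verticalLine N) fun t =>
    .inl (by rw [Complex.sub_re, verticalLine_re]; linarith)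

/-- A point far up and to the right of the upper end of a contour lies to its right. -/
lemma eventually_liesRightOf_top {γ : ℝ → ℂ} (hγ : IsUpwardContour γ) {σ : ℝ}
    (hσ : ∀ᶠ t in atTop, γ t = (σ : ℂ) + (t : ℂ) * Complex.I) :
    ∃ T : ℝ, ∀ p : ℂ, T ≤ p.im → σ < p.re → LiesRightOf p γ := by
  obtain ⟨T₁, h₁⟩ := eventually_atTop.1 hσ
  obtain ⟨τ, T₀, h₀⟩ := hγ.bottom_vertical
  obtain ⟨B, hB⟩ := (isCompact_Icc (a := T₀) (b := T₁)).bddAbove_image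
    (Complex.continuous_im.comp hγ.continuous).continuousOn
  refine ⟨max B (max T₀ T₁) + 1, fun p hp1 hp2 => liesRightOf_of_ray hγ fun t => ?_⟩
  rw [Complex.mem_slitPlane_iff]
  have hm1 := le_max_left B (max T₀ T₁)
  have hm2 := (le_max_left T₀ T₁).trans (le_max_right B _)
  rcases le_total T₁ t with h | h
  · left
    simp only [h₁ t h, Complex.sub_re, Complex.add_re, Complex.ofReal_re, Complex.mul_re,
      Complex.I_re, Complex.I_im, Complex.ofReal_im]
    linarith
  · right
    rw [Complex.sub_im, sub_ne_zero]
    rcases le_total t T₀ with h' | h'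
    · simp only [h₀ t h', Complex.add_im, Complex.ofReal_re, Complex.mul_im,
        Complex.I_re, Complex.I_im, Complex.ofReal_im]
      intro; linarith
    · have := hB (Set.mem_image_of_mem _ (show t ∈ Set.Icc T₀ T₁ from ⟨h', h⟩))
      simp only [Function.comp] at this
      intro; linarith

/-- A point far down and to the right of the lower end of a contour lies to its right. -/
lemma eventually_liesRightOf_bot {γ : ℝ → ℂ} (hγ : IsUpwardContour γ) {σ : ℝ}
    (hσ : ∀ᶠ t in atTop, γ (-t) = (σ : ℂ) - (t : ℂ) * Complex.I) :
    ∃ T : ℝ, ∀ p : ℂ, p.im ≤ T → σ < p.re → LiesRightOf p γ := by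
  obtain ⟨T₀, h₀⟩ := eventually_atTop.1 hσ
  obtain ⟨τ, T₁, h₁⟩ := hγ.top_vertical
  obtain ⟨B, hB⟩ := (isCompact_Icc (a := -T₀) (b := T₁)).bddBelow_image
    (Complex.continuous_im.comp hγ.continuous).continuousOn
  refine ⟨min B (min (-T₀) T₁) - 1, fun p hp1 hp2 => liesRightOf_of_ray hγ fun t => ?_⟩
  rw [Complex.mem_slitPlane_iff]
  have hm1 := min_le_left B (min (-T₀) T₁)
  have hm2 := (min_le_right B (min (-T₀) T₁)).trans (min_le_right (-T₀) T₁)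
  rcases le_total t (-T₀) with h | h
  · left
    have := h₀ (-t) (by linarith)
    rw [neg_neg] at this
    simp only [this, Complex.sub_re, Complex.ofReal_re, Complex.mul_re,
      Complex.I_re, Complex.I_im, Complex.ofReal_im]
    linarith
  · right
    rw [Complex.sub_im, sub_ne_zero]
    rcases le_total T₁ t with h' | h'
    · simp only [h₁ t h', Complex.add_im, Complex.ofReal_re, Complex.mul_im,
        Complex.I_re, Complex.I_im, Complex.ofReal_im]
      intro; linarith
    · have := hB (Set.mem_image_of_mem _ (show t ∈ Set.Icc (-T₀) T₁ from ⟨h, h'⟩))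
      simp only [Function.comp] at this
      intro; linarith

lemma countable_of_forall_eventually_notMem {A : Set ℝ} (h : ∀ t ∈ A, ∀ᶠ u in 𝓝[≠] t, u ∉ A) :
    A.Countable := by
  have : DiscreteTopology A := by
    rw [discreteTopology_subtype_iff]
    intro t ht
    rw [← disjoint_iff, disjoint_principal_right]
    exact h t ht
  exact (TopologicalSpace.separableSpace_iff_countable (α := A)).1 inferInstance

/-- A contour meets a set without accumulation points along itself only at negligibly many
parameters, apart from those where its derivative vanishes. -/
lemma ae_deriv_eq_zero_of_mem {γ : ℝ → ℂ} {D : Set ℂ}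
    (hD : ∀ t, ∀ᶠ z in 𝓝[≠] (γ t), z ∉ D) :
    ∀ᵐ t : ℝ, γ t ∈ D → deriv γ t = 0 := by
  have hc : {t : ℝ | ¬ (γ t ∈ D → deriv γ t = 0)}.Countable := by
    refine countable_of_forall_eventually_notMem fun t ht => ?_
    rw [Set.mem_ofPred_eq, Classical.not_imp] at ht
    have hd : HasDerivAt γ (deriv γ t) t :=
      (differentiableAt_of_deriv_ne_zero ht.2).hasDerivAt
    have h1 : Tendsto γ (𝓝[≠] t) (𝓝[≠] (γ t)) :=
      tendsto_nhdsWithin_iff.2 ⟨hd.continuousAt.tendsto.mono_left nhdsWithin_le_nhds,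
        hd.eventually_ne ht.2⟩
    filter_upwards [h1.eventually (hD t)] with u hu hu'
    exact hu (Classical.not_imp.1 hu').1
  exact hc.ae_notMem volume |>.mono fun t ht => not_not.1 ht

end contour

/-! ### Principal parts and the residue theorem for pairs of contours -/

section residue

open MeasureTheory

/-- The finite Laurent tail `∑_{j ≤ n} c_j / (s - p)^{j+1}`; its residue at `p` is `c 0`. -/
noncomputable def principalPart (c : ℕ → ℂ) (n : ℕ) (p s : ℂ) : ℂ :=
  ∑ j ∈ Finset.range (n + 1), c j * ((s - p) ^ (j + 1))⁻¹

lemma analyticAt_dslope {G : ℂ → ℂ} {p : ℂ} (hG : AnalyticAt ℂ G p) :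
    AnalyticAt ℂ (dslope G p) p := by
  obtain ⟨P, hP⟩ := hG
  exact ⟨_, hP.has_fpower_series_dslope_fslope⟩

lemma eq_add_mul_dslope (G : ℂ → ℂ) (p s : ℂ) :
    G s = G p + (s - p) * dslope G p s := by
  have := sub_smul_dslope G p s
  rw [smul_eq_mul] at this
  rw [this]; ring

/-- The Laurent tail of `G / (s - p)^{n+1}` for `G` analytic at `p`. -/
lemma exists_principalPart_of_analyticAt (p : ℂ) (n : ℕ) :
    ∀ G : ℂ → ℂ, AnalyticAt ℂ G p → ∃ (c : ℕ → ℂ) (g : ℂ → ℂ), AnalyticAt ℂ g p ∧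
      (n = 0 → c 0 = G p) ∧
      ∀ s, s ≠ p → G s * ((s - p) ^ (n + 1))⁻¹ = principalPart c n p s + g s := by
  induction n with
  | zero =>
    refine fun G hG => ⟨fun _ => G p, dslope G p, analyticAt_dslope hG, fun _ => rfl, ?_⟩
    intro s hs
    have hs' := sub_ne_zero.2 hs
    rw [eq_add_mul_dslope G p s]
    simp only [principalPart, zero_add, Finset.range_one, Finset.sum_singleton, pow_one]
    field_simp
  | succ n ih =>
    intro G hG
    obtain ⟨c, g, hg, -, h⟩ := ih _ (analyticAt_dslope hG)
    refine ⟨Function.update c (n + 1) (G p), g, hg, by simp, fun s hs => ?_⟩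
    have hs' := sub_ne_zero.2 hs
    have h1 := h s hs
    have h2 : principalPart (Function.update c (n + 1) (G p)) (n + 1) p s =
        principalPart c n p s + G p * ((s - p) ^ (n + 1 + 1))⁻¹ := by
      rw [principalPart, Finset.sum_range_succ, Function.update_self, principalPart]
      congr 1
      refine Finset.sum_congr rfl fun j hj => ?_
      rw [Function.update_of_ne (Finset.mem_range.1 hj).ne]
    have h3 : (G p + (s - p) * dslope G p s) * ((s - p) ^ (n + 1 + 1))⁻¹ =
        G p * ((s - p) ^ (n + 1 + 1))⁻¹ + dslope G p s * ((s - p) ^ (n + 1))⁻¹ := by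
      field_simp
      ring
    rw [h2, eq_add_mul_dslope G p s, h3, h1]
    ring

lemma exists_principalPart {F : ℂ → ℂ} {p : ℂ} (hF : MeromorphicAt F p) :
    ∃ (c : ℕ → ℂ) (n : ℕ) (g : ℂ → ℂ), AnalyticAt ℂ g p ∧
      ∀ᶠ s in 𝓝[≠] p, F s = principalPart c n p s + g s := by
  obtain ⟨n, hn⟩ := hF
  obtain ⟨c, g, hg, -, h⟩ := exists_principalPart_of_analyticAt p n
    (fun z => (z - p) * ((z - p) ^ n • F z)) ((by fun_prop : AnalyticAt ℂ (· - p) p).mul hn)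
  refine ⟨c, n, g, hg, ?_⟩
  filter_upwards [self_mem_nhdsWithin] with s hs
  rw [← h s hs]
  have hs' := sub_ne_zero.2 hs
  simp only [smul_eq_mul]
  field_simp
  ring

lemma analyticAt_principalPart (c : ℕ → ℂ) (n : ℕ) {p s : ℂ} (hs : s ≠ p) :
    AnalyticAt ℂ (principalPart c n p) s := by
  unfold principalPart
  refine Finset.analyticAt_fun_sum _ fun j _ => ?_
  refine analyticAt_const.mul (AnalyticAt.inv (by fun_prop) ?_)
  exact pow_ne_zero _ (sub_ne_zero.2 hs)

lemma meromorphicAt_principalPart (c : ℕ → ℂ) (n : ℕ) (p s : ℂ) :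
    MeromorphicAt (principalPart c n p) s := by
  unfold principalPart
  fun_prop

lemma tendsto_inv_sub_pow_cobounded (p : ℂ) (j : ℕ) :
    Tendsto (fun s : ℂ => ((s - p) ^ (j + 1))⁻¹) (Bornology.cobounded ℂ) (𝓝 0) := by
  have h1 : Tendsto (fun s : ℂ => s - p) (Bornology.cobounded ℂ) (Bornology.cobounded ℂ) := by
    simp [sub_eq_add_neg]
  have h2 := (tendsto_inv₀_cobounded (α := ℂ)).comp h1
  simpa [Function.comp_def, inv_pow] using h2.pow (j + 1)

lemma tendsto_principalPart_cobounded (c : ℕ → ℂ) (n : ℕ) (p : ℂ) :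
    Tendsto (principalPart c n p) (Bornology.cobounded ℂ) (𝓝 0) := by
  have := tendsto_finsetSum (Finset.range (n + 1)) fun j _ =>
    (tendsto_inv_sub_pow_cobounded p j).const_mul (c j)
  simpa [principalPart] using! this

lemma tendsto_contour_cobounded {γ : ℝ → ℂ} (hγ : IsUpwardContour γ) :
    Tendsto γ atTop (Bornology.cobounded ℂ) ∧
      Tendsto (fun t => γ (-t)) atTop (Bornology.cobounded ℂ) := by
  obtain ⟨σ, hσ⟩ := exists_contour_top hγ
  obtain ⟨τ, hτ⟩ := exists_contour_bot hγ
  simp only [← tendsto_norm_atTop_iff_cobounded]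
  constructor
  · refine tendsto_atTop_mono' _ ?_ tendsto_id
    filter_upwards [hσ] with t ht
    refine (le_abs_self t).trans ?_
    have := Complex.abs_im_le_norm (γ t)
    simpa [ht] using this
  · refine tendsto_atTop_mono' _ ?_ tendsto_id
    filter_upwards [hτ] with t ht
    refine (le_abs_self t).trans ?_
    have := Complex.abs_im_le_norm (γ (-t))
    simpa [ht] using this

/-- Only the residue of a Laurent tail contributes to its integral along a contour, with the winding
integral `w` as factor. -/
lemma tendsto_integral_principalPart {γ : ℝ → ℂ} (hγ : IsUpwardContour γ) (c : ℕ → ℂ) (n : ℕ)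
    {p w : ℂ} (hp : ∀ t, γ t ≠ p)
    (hw : Tendsto (fun R : ℝ => ∫ t in (-R)..R, deriv γ t / (γ t - p)) atTop (𝓝 w)) :
    Tendsto (fun R : ℝ => ∫ t in (-R)..R, principalPart c n p (γ t) * deriv γ t) atTop
      (𝓝 (c 0 * w)) := by
  have hne : ∀ t, γ t - p ≠ 0 := fun t => sub_ne_zero.2 (hp t)
  have hcont : ∀ j : ℕ, Continuous fun t => ((γ t - p) ^ (j + 1))⁻¹ := fun j =>
    ((hγ.continuous.sub continuous_const).pow _).inv₀ fun t => pow_ne_zero _ (hne t)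
  have hint : ∀ R : ℝ, ∫ t in (-R)..R, principalPart c n p (γ t) * deriv γ t =
      ∑ j ∈ Finset.range (n + 1),
        c j * ∫ t in (-R)..R, ((γ t - p) ^ (j + 1))⁻¹ * deriv γ t := by
    intro R
    simp_rw [principalPart, Finset.sum_mul, ← intervalIntegral.integral_const_mul]
    rw [← intervalIntegral.integral_finsetSum]
    · simp_rw [mul_assoc]
    · intro j _
      simpa only [mul_assoc] using
        (intervalIntegrable_mul_deriv_contour hγ (hcont j) (-R) R).const_mul (c j)
  simp_rw [hint, Finset.sum_range_succ']
  have h0 : Tendsto (fun R : ℝ => c 0 * ∫ t in (-R)..R, ((γ t - p) ^ (0 + 1))⁻¹ * deriv γ t) atTop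
      (𝓝 (c 0 * w)) := by
    refine Tendsto.const_mul _ (hw.congr fun R => ?_)
    exact intervalIntegral.integral_congr fun t _ => by simp [div_eq_mul_inv, mul_comm]
  have h1 : ∀ j ∈ Finset.range n, Tendsto (fun R : ℝ => c (j + 1) *
      ∫ t in (-R)..R, ((γ t - p) ^ (j + 1 + 1))⁻¹ * deriv γ t) atTop (𝓝 0) := by
    intro j _
    have hj : ((j : ℂ) + 1) ≠ 0 := by exact_mod_cast j.succ_ne_zero
    have h2 : ∀ R : ℝ, ∫ t in (-R)..R, ((γ t - p) ^ (j + 1 + 1))⁻¹ * deriv γ t =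
        -((j : ℂ) + 1)⁻¹ * ((γ R - p) ^ (j + 1))⁻¹ -
          -((j : ℂ) + 1)⁻¹ * ((γ (-R) - p) ^ (j + 1))⁻¹ := by
      intro R
      refine integral_mul_deriv_contour hγ (H := fun z => -((j : ℂ) + 1)⁻¹ * ((z - p) ^ (j + 1))⁻¹)
        (h := fun z => ((z - p) ^ (j + 1 + 1))⁻¹) (fun t => ?_) (hcont (j + 1)) _ _
      have h3 := ((((hasDerivAt_id (γ t)).sub_const p).pow (j + 1)).inv
        (pow_ne_zero _ (hne t))).const_mul (-((j : ℂ) + 1)⁻¹)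
      refine h3.congr_deriv ?_
      have := hne t
      simp only [id, Nat.cast_add, Nat.cast_one, add_tsub_cancel_right, mul_one, Pi.pow_apply]
      field_simp
      ring
    simp_rw [h2]
    obtain ⟨t1, t2⟩ := tendsto_contour_cobounded hγ
    have t3 := ((tendsto_inv_sub_pow_cobounded p j).comp t1).const_mul (-((j : ℂ) + 1)⁻¹)
    have t4 := ((tendsto_inv_sub_pow_cobounded p j).comp t2).const_mul (-((j : ℂ) + 1)⁻¹)
    simpa [Function.comp_def] using (t3.sub t4).const_mul (c (j + 1))
  simpa using (tendsto_finsetSum _ h1).add h0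

/-- The data of a decomposition of `F` on `Ω` into a holomorphic function with primitive `H` and
Laurent tails at the points of `P`, up to values on a set without accumulation points in `Ω`. -/
structure IsLaurentDecomposition (F : ℂ → ℂ) (Ω : Set ℂ) (P : Finset ℂ) (c : ℂ → ℕ → ℂ)
    (n : ℂ → ℕ) (H h : ℂ → ℂ) : Prop where
  hasDerivAt : ∀ z ∈ Ω, HasDerivAt H (h z) z
  continuousOn : ContinuousOn h Ω
  eventually_eq : ∀ z ∈ Ω, ∀ᶠ s in 𝓝[≠] z, F s = h s + ∑ p ∈ P, principalPart (c p) (n p) p s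

/-- Existence of the decomposition for a meromorphic function with poles in `P`, on an open set on
which holomorphic functions have primitives. -/
lemma exists_isLaurentDecomposition {F : ℂ → ℂ} {Ω : Set ℂ}
    (hprim : ∀ h : ℂ → ℂ, DifferentiableOn ℂ h Ω → ∃ H : ℂ → ℂ, ∀ z ∈ Ω, HasDerivAt H (h z) z)
    (hF : ∀ z, MeromorphicAt F z) (P : Finset ℂ)
    (hP : ∀ z ∈ Ω, meromorphicOrderAt F z < 0 → z ∈ P) (c : ℂ → ℕ → ℂ) (n : ℂ → ℕ)
    (hc : ∀ p ∈ P, ∃ g : ℂ → ℂ, AnalyticAt ℂ g p ∧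
      ∀ᶠ s in 𝓝[≠] p, F s = principalPart (c p) (n p) p s + g s) :
    ∃ H h : ℂ → ℂ, IsLaurentDecomposition F Ω P c n H h := by
  classical
  set E : ℂ → ℂ := fun s => F s - ∑ p ∈ P, principalPart (c p) (n p) p s with hE
  have hEm : MeromorphicOn E Ω := fun z _ =>
    (hF z).sub (MeromorphicAt.fun_sum fun p _ => meromorphicAt_principalPart _ _ p z)
  have hord : ∀ z ∈ Ω, 0 ≤ meromorphicOrderAt E z := by
    intro z hz
    rw [(hEm z hz).meromorphicOrderAt_nonneg_iff]
    by_cases hzP : z ∈ P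
    · obtain ⟨g, hg, h⟩ := hc z hzP
      refine ⟨fun s => g s - ∑ p ∈ P.erase z, principalPart (c p) (n p) p s,
        hg.sub (Finset.analyticAt_fun_sum _ fun p hp =>
          analyticAt_principalPart _ _ (Finset.ne_of_mem_erase hp).symm), ?_⟩
      filter_upwards [h] with s hs
      simp only [hE, hs]
      rw [← Finset.add_sum_erase P _ hzP]
      ring
    · have h0 : 0 ≤ meromorphicOrderAt F z := not_lt.1 fun h => hzP (hP z hz h)
      obtain ⟨g, hg, h⟩ := (hF z).meromorphicOrderAt_nonneg_iff.1 h0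
      refine ⟨fun s => g s - ∑ p ∈ P, principalPart (c p) (n p) p s,
        hg.sub (Finset.analyticAt_fun_sum _ fun p hp =>
          analyticAt_principalPart _ _ (fun h' => hzP (h' ▸ hp))), ?_⟩
      filter_upwards [h] with s hs
      simp only [hE, hs]
  set h := toMeromorphicNFOn E Ω
  have hh : ∀ z ∈ Ω, AnalyticAt ℂ h z := by
    intro z hz
    have h1 := meromorphicNFOn_toMeromorphicNFOn E Ω hz
    refine h1.meromorphicOrderAt_nonneg_iff_analyticAt.1 ?_
    rw [meromorphicOrderAt_toMeromorphicNFOn hEm hz]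
    exact hord z hz
  obtain ⟨H, hH⟩ := hprim h fun z hz => (hh z hz).differentiableAt.differentiableWithinAt
  refine ⟨H, h, hH, fun z hz => (hh z hz).continuousAt.continuousWithinAt, fun z hz => ?_⟩
  filter_upwards [hEm.toMeromorphicNFOn_eq_self_on_nhdsNE hz] with s hs
  rw [show h s = E s from hs]
  simp [hE]

/-- Along a contour that avoids the poles, `F` may be replaced by its Laurent decomposition: the
exceptional set is met at negligibly many parameters only. -/
lemma ae_mul_deriv_eq {F : ℂ → ℂ} {Ω : Set ℂ} {P : Finset ℂ}
    {c : ℂ → ℕ → ℂ} {n : ℂ → ℕ} {H h : ℂ → ℂ} (hD : IsLaurentDecomposition F Ω P c n H h)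
    {γ : ℝ → ℂ} (hγΩ : ∀ t, γ t ∈ Ω) :
    ∀ᵐ t : ℝ, F (γ t) * deriv γ t =
      h (γ t) * deriv γ t + ∑ p ∈ P, principalPart (c p) (n p) p (γ t) * deriv γ t := by
  have := ae_deriv_eq_zero_of_mem (γ := γ)
    (D := {s | ¬ F s = h s + ∑ p ∈ P, principalPart (c p) (n p) p s}) fun t => by
      filter_upwards [hD.eventually_eq _ (hγΩ t)] with s hs hs'
      exact hs' hs
  filter_upwards [this] with t ht
  rw [← Finset.sum_mul, ← add_mul]
  by_cases h0 : F (γ t) = h (γ t) + ∑ p ∈ P, principalPart (c p) (n p) p (γ t)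
  · rw [h0]
  · rw [ht h0, mul_zero, mul_zero]

lemma continuous_principalPart_comp {γ : ℝ → ℂ} (hγ : Continuous γ) (c : ℕ → ℂ) (n : ℕ) {p : ℂ}
    (hp : ∀ t, γ t ≠ p) : Continuous fun t => principalPart c n p (γ t) :=
  continuous_iff_continuousAt.2 fun t => ContinuousAt.comp (g := principalPart c n p)
    (analyticAt_principalPart _ _ (hp t)).continuousAt hγ.continuousAt

lemma intervalIntegrable_sum_principalPart {γ : ℝ → ℂ} (hγ : IsUpwardContour γ) {P : Finset ℂ}
    (c : ℂ → ℕ → ℂ) (n : ℂ → ℕ) (hγP : ∀ p ∈ P, ∀ t, γ t ≠ p) (a b : ℝ) :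
    IntervalIntegrable (fun t => ∑ p ∈ P, principalPart (c p) (n p) p (γ t) * deriv γ t)
      volume a b := by
  have := IntervalIntegrable.sum P fun p hp => intervalIntegrable_mul_deriv_contour hγ
    (continuous_principalPart_comp hγ.continuous (c p) (n p) (hγP p hp)) a b
  simpa only [Finset.sum_fn] using this

lemma IsLaurentDecomposition.intervalIntegrable {F : ℂ → ℂ} {Ω : Set ℂ} {P : Finset ℂ}
    {c : ℂ → ℕ → ℂ} {n : ℂ → ℕ} {H h : ℂ → ℂ} (hD : IsLaurentDecomposition F Ω P c n H h)
    {γ : ℝ → ℂ} (hγ : IsUpwardContour γ) (hγΩ : ∀ t, γ t ∈ Ω) (hγP : ∀ p ∈ P, ∀ t, γ t ≠ p)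
    (a b : ℝ) : IntervalIntegrable (fun t => F (γ t) * deriv γ t) volume a b := by
  have h1 := (intervalIntegrable_mul_deriv_contour hγ
    (hD.continuousOn.comp_continuous hγ.continuous hγΩ) a b).add
      (intervalIntegrable_sum_principalPart hγ c n hγP a b)
  exact h1.congr_ae (ae_restrict_of_ae ((ae_mul_deriv_eq hD hγΩ).mono fun t ht => ht.symm))

lemma tendsto_integral_sub_primitive {F : ℂ → ℂ} {Ω : Set ℂ} {P : Finset ℂ}
    {c : ℂ → ℕ → ℂ} {n : ℂ → ℕ} {H h : ℂ → ℂ} (hD : IsLaurentDecomposition F Ω P c n H h)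
    {γ : ℝ → ℂ} (hγ : IsUpwardContour γ) (hγΩ : ∀ t, γ t ∈ Ω) (hγP : ∀ p ∈ P, ∀ t, γ t ≠ p)
    {w : ℂ → ℂ} (hw : ∀ p ∈ P,
      Tendsto (fun R : ℝ => ∫ t in (-R)..R, deriv γ t / (γ t - p)) atTop (𝓝 (w p))) :
    Tendsto (fun R : ℝ => (∫ t in (-R)..R, F (γ t) * deriv γ t) - (H (γ R) - H (γ (-R)))) atTop
      (𝓝 (∑ p ∈ P, c p 0 * w p)) := by
  have hae := ae_mul_deriv_eq hD hγΩ
  have hhc : Continuous fun t => h (γ t) :=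
    hD.continuousOn.comp_continuous hγ.continuous hγΩ
  have hpc := fun p hp => continuous_principalPart_comp hγ.continuous (c p) (n p) (hγP p hp)
  have hint : ∀ R : ℝ, (∫ t in (-R)..R, F (γ t) * deriv γ t) - (H (γ R) - H (γ (-R))) =
      ∑ p ∈ P, ∫ t in (-R)..R, principalPart (c p) (n p) p (γ t) * deriv γ t := by
    intro R
    rw [intervalIntegral.integral_congr_ae (hae.mono fun t ht _ => ht),
      intervalIntegral.integral_add (intervalIntegrable_mul_deriv_contour hγ hhc _ _)
        (intervalIntegrable_sum_principalPart hγ c n hγP _ _),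
      integral_mul_deriv_contour hγ (fun t => hD.hasDerivAt _ (hγΩ t)) hhc,
      intervalIntegral.integral_finsetSum fun p hp =>
        intervalIntegrable_mul_deriv_contour hγ (hpc p hp) _ _]
    ring
  simp_rw [hint]
  exact tendsto_finsetSum _ fun p hp =>
    tendsto_integral_principalPart hγ _ _ (hγP p hp) (hw p hp)

/-- If `F` decays uniformly at both ends of the strip `u < Re s < v`, then so does the increment of
the primitive `H` between points of the strip of equal height. -/
lemma exists_norm_primitive_sub_le {F : ℂ → ℂ} {Ω : Set ℂ} {P : Finset ℂ}
    {c : ℂ → ℕ → ℂ} {n : ℂ → ℕ} {H h : ℂ → ℂ} (hD : IsLaurentDecomposition F Ω P c n H h)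
    {u v : ℝ} (hΩ : ∀ z : ℂ, u < z.re → z.re < v → z ∈ Ω)
    (hdecay : ∀ ε > 0, ∃ T : ℝ, ∀ s : ℂ, u < s.re → s.re < v → T < |s.im| → ‖F s‖ ≤ ε)
    {ε : ℝ} (hε : 0 < ε) :
    ∃ T : ℝ, ∀ z w : ℂ, u < z.re → z.re < v → u < w.re → w.re < v → z.im = w.im → T < |z.im| →
      ‖H z - H w‖ ≤ ε * |z.re - w.re| := by
  obtain ⟨T₁, h₁⟩ := hdecay (ε / 2) (half_pos hε)
  have hpp : Tendsto (fun s => ∑ p ∈ P, principalPart (c p) (n p) p s) (Bornology.cobounded ℂ)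
      (𝓝 0) := by
    simpa using tendsto_finsetSum P fun p _ => tendsto_principalPart_cobounded (c p) (n p) p
  have h2 := hpp.norm.eventually (gt_mem_nhds
    (show ‖(0 : ℂ)‖ < ε / 2 by rw [norm_zero]; exact half_pos hε))
  obtain ⟨T₂, -, h₂⟩ := (Filter.hasBasis_cobounded_norm (E := ℂ)).eventually_iff.1 h2
  have hbd : ∀ s : ℂ, u < s.re → s.re < v → max T₁ T₂ < |s.im| → ‖h s‖ ≤ ε := by
    intro s hs1 hs2 hs3
    have hc : ContinuousAt h s := by
      have : Ω ∈ 𝓝 s := by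
        have ho : IsOpen {z : ℂ | u < z.re ∧ z.re < v} :=
          (isOpen_lt continuous_const Complex.continuous_re).inter
            (isOpen_lt Complex.continuous_re continuous_const)
        exact Filter.mem_of_superset (ho.mem_nhds ⟨hs1, hs2⟩) fun z hz => hΩ z hz.1 hz.2
      exact hD.continuousOn.continuousAt this
    have ht : Tendsto (fun z => ‖h z‖) (𝓝[≠] s) (𝓝 ‖h s‖) :=
      hc.norm.tendsto.mono_left nhdsWithin_le_nhds
    refine le_of_tendsto ht ?_
    have e1 : ∀ᶠ z : ℂ in 𝓝[≠] s, u < z.re :=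
      nhdsWithin_le_nhds (Complex.continuous_re.continuousAt.eventually (lt_mem_nhds hs1))
    have e2 : ∀ᶠ z : ℂ in 𝓝[≠] s, z.re < v :=
      nhdsWithin_le_nhds (Complex.continuous_re.continuousAt.eventually (gt_mem_nhds hs2))
    have e3 : ∀ᶠ z : ℂ in 𝓝[≠] s, max T₁ T₂ < |z.im| :=
      nhdsWithin_le_nhds (Complex.continuous_im.abs.continuousAt.eventually (lt_mem_nhds hs3))
    filter_upwards [e1, e2, e3, hD.eventually_eq s (hΩ s hs1 hs2)] with z z1 z2 z3 z4
    have i1 := h₁ z z1 z2 ((le_max_left _ _).trans_lt z3)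
    have i2 := h₂ (x := z) (((le_max_right _ _).trans_lt z3).le.trans (Complex.abs_im_le_norm z))
    have : h z = F z - ∑ p ∈ P, principalPart (c p) (n p) p z := by rw [z4]; ring
    rw [this]
    refine (norm_sub_le _ _).trans ?_
    linarith
  refine ⟨max T₁ T₂, fun z w z1 z2 w1 w2 hzw hT => ?_⟩
  have hconv : Convex ℝ {s : ℂ | (u < s.re ∧ s.re < v) ∧ s.im = z.im} :=
    (((convex_halfSpace_re_gt u).inter (convex_halfSpace_re_lt v))).inter
      (convex_hyperplane (f := Complex.im) Complex.imLm.isLinear z.im)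
  have := hconv.norm_image_sub_le_of_norm_hasDerivWithin_le (f := H) (f' := h) (C := ε)
    (x := w) (y := z) (fun s hs => (hD.hasDerivAt s (hΩ s hs.1.1 hs.1.2)).hasDerivWithinAt)
    (fun s hs => hbd s hs.1.1 hs.1.2 (by rw [hs.2]; exact hT)) ⟨⟨w1, w2⟩, hzw.symm⟩ ⟨⟨z1, z2⟩, rfl⟩
  refine this.trans_eq ?_
  congr 1
  have : z - w = ((z.re - w.re : ℝ) : ℂ) := by apply Complex.ext <;> simp [hzw]
  rw [this, Complex.norm_real, Real.norm_eq_abs]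

/-- The residue theorem for two contours with the same asymptotic strip: the difference of the
integrals is the sum of the residues weighted with the differences of the winding integrals. -/
theorem tendsto_integral_sub_integral {F : ℂ → ℂ} {Ω : Set ℂ} {P : Finset ℂ}
    {c : ℂ → ℕ → ℂ} {n : ℂ → ℕ} {H h : ℂ → ℂ} (hD : IsLaurentDecomposition F Ω P c n H h)
    {u v : ℝ} (hΩ : ∀ z : ℂ, u < z.re → z.re < v → z ∈ Ω)
    (hdecay : ∀ ε > 0, ∃ T : ℝ, ∀ s : ℂ, u < s.re → s.re < v → T < |s.im| → ‖F s‖ ≤ ε)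
    {γ δ : ℝ → ℂ} (hγ : IsUpwardContour γ) (hγΩ : ∀ t, γ t ∈ Ω) (hγP : ∀ p ∈ P, ∀ t, γ t ≠ p)
    (hδ : IsUpwardContour δ) (hδΩ : ∀ t, δ t ∈ Ω) (hδP : ∀ p ∈ P, ∀ t, δ t ≠ p)
    (hγre : ∀ᶠ t in atTop, (u < (γ t).re ∧ (γ t).re < v) ∧ u < (γ (-t)).re ∧ (γ (-t)).re < v)
    (hδre : ∀ᶠ t in atTop, (u < (δ t).re ∧ (δ t).re < v) ∧ u < (δ (-t)).re ∧ (δ (-t)).re < v)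
    {w w' : ℂ → ℂ} (hw : ∀ p ∈ P,
      Tendsto (fun R : ℝ => ∫ t in (-R)..R, deriv γ t / (γ t - p)) atTop (𝓝 (w p)))
    (hw' : ∀ p ∈ P,
      Tendsto (fun R : ℝ => ∫ t in (-R)..R, deriv δ t / (δ t - p)) atTop (𝓝 (w' p))) :
    Tendsto (fun R : ℝ => (∫ t in (-R)..R, F (γ t) * deriv γ t) -
      ∫ t in (-R)..R, F (δ t) * deriv δ t) atTop (𝓝 (∑ p ∈ P, c p 0 * (w p - w' p))) := by
  have h1 := (tendsto_integral_sub_primitive hD hγ hγΩ hγP hw).sub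
    (tendsto_integral_sub_primitive hD hδ hδΩ hδP hw')
  have him : ∀ {γ : ℝ → ℂ}, IsUpwardContour γ → ∀ᶠ t in atTop, (γ t).im = t ∧ (γ (-t)).im = -t := by
    intro γ hγ
    obtain ⟨σ, hσ⟩ := exists_contour_top hγ
    obtain ⟨τ, hτ⟩ := exists_contour_bot hγ
    filter_upwards [hσ, hτ] with t h3 h4
    simp [h3, h4]
  have hsmall : ∀ {z w : ℝ → ℂ},
      (∀ᶠ t in atTop, ((u < (z t).re ∧ (z t).re < v) ∧ (u < (w t).re ∧ (w t).re < v)) ∧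
        (z t).im = (w t).im ∧ |(z t).im| = |t|) →
      Tendsto (fun t => H (z t) - H (w t)) atTop (𝓝 0) := by
    intro z w hzw
    rw [Metric.tendsto_nhds]
    intro ε hε
    have hL : 0 < |v - u| + 1 := by positivity
    obtain ⟨T, hT⟩ := exists_norm_primitive_sub_le hD hΩ hdecay (div_pos hε hL)
    filter_upwards [hzw, eventually_gt_atTop |T|] with t ht hTt
    obtain ⟨⟨⟨z1, z2⟩, w1, w2⟩, i1, i2⟩ := ht
    rw [dist_zero_right]
    refine (hT (z t) (w t) z1 z2 w1 w2 i1 ?_).trans_lt ?_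
    · rw [i2]; exact (le_abs_self T).trans_lt (hTt.trans_le (le_abs_self t))
    · have : |(z t).re - (w t).re| ≤ |v - u| := by
        refine (abs_le.2 ⟨?_, ?_⟩).trans (le_abs_self (v - u)) <;> linarith
      calc ε / (|v - u| + 1) * |(z t).re - (w t).re| ≤ ε / (|v - u| + 1) * |v - u| := by gcongr
        _ < ε / (|v - u| + 1) * (|v - u| + 1) := by gcongr; linarith
        _ = ε := div_mul_cancel₀ _ hL.ne'
  have h2 : Tendsto (fun t => H (γ t) - H (δ t)) atTop (𝓝 0) := hsmall <| by
    filter_upwards [hγre, hδre, him hγ, him hδ] with t a b c d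
    exact ⟨⟨a.1, b.1⟩, c.1.trans d.1.symm, by rw [c.1]⟩
  have h3 : Tendsto (fun t => H (γ (-t)) - H (δ (-t))) atTop (𝓝 0) := hsmall <| by
    filter_upwards [hγre, hδre, him hγ, him hδ] with t a b c d
    exact ⟨⟨a.2, b.2⟩, c.2.trans d.2.symm, by rw [c.2, abs_neg]⟩
  have h4 := h1.add (h2.sub h3)
  rw [sub_zero, add_zero, ← Finset.sum_sub_distrib] at h4
  simp_rw [← mul_sub] at h4
  refine h4.congr fun R => ?_
  ring

/-- A holomorphic function on the union of two convex open sets has a primitive. -/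
lemma exists_primitive_union {U V : Set ℂ} (hU : IsOpen U) (hV : IsOpen V) (hUc : Convex ℝ U)
    (hVc : Convex ℝ V) {h : ℂ → ℂ} (hh : DifferentiableOn ℂ h (U ∪ V)) :
    ∃ H : ℂ → ℂ, ∀ z ∈ U ∪ V, HasDerivAt H (h z) z := by
  classical
  obtain ⟨A, hA⟩ := hUc.exists_forall_hasDerivWithinAt (hh.mono Set.subset_union_left)
  obtain ⟨B, hB⟩ := hVc.exists_forall_hasDerivWithinAt (hh.mono Set.subset_union_right)
  replace hA : ∀ z ∈ U, HasDerivAt A (h z) z := fun z hz => (hA z hz).hasDerivAt (hU.mem_nhds hz)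
  replace hB : ∀ z ∈ V, HasDerivAt B (h z) z := fun z hz => (hB z hz).hasDerivAt (hV.mem_nhds hz)
  obtain ⟨k, hk⟩ : ∃ k, ∀ z ∈ U ∩ V, A z = B z + k := by
    rcases (U ∩ V).eq_empty_or_nonempty with he | ⟨z₀, hz₀⟩
    · exact ⟨0, by simp [he]⟩
    refine ⟨A z₀ - B z₀, fun z hz => ?_⟩
    have := (hUc.inter hVc).norm_image_sub_le_of_norm_hasDerivWithin_le (f := fun z => A z - B z)
      (f' := fun _ => 0) (C := 0) (x := z₀) (y := z)
      (fun s hs => by simpa using! ((hA s hs.1).sub (hB s hs.2)).hasDerivWithinAt) (by simp) hz₀ hz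
    rw [zero_mul, norm_le_zero_iff] at this
    linear_combination this
  refine ⟨fun z => if z ∈ U then A z else B z + k, fun z hz => ?_⟩
  by_cases hzU : z ∈ U
  · refine (hA z hzU).congr_of_eventuallyEq ?_
    filter_upwards [hU.mem_nhds hzU] with s hs
    simp [hs]
  · have hzV : z ∈ V := hz.resolve_left hzU
    refine ((hB z hzV).add_const k).congr_of_eventuallyEq ?_
    filter_upwards [hV.mem_nhds hzV] with s hs
    by_cases hsU : s ∈ U
    · simp [hsU, hk s ⟨hsU, hs⟩]
    · simp [hsU]

end residue

/-! ### The Barnes integrand: poles and residues -/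

section integrand

open Complex in
lemma cpow_eq_one_iff {q : ℝ} (hq0 : 0 < q) (hq1 : q < 1) (s : ℂ) :
    (q : ℂ) ^ s = 1 ↔ ∃ m : ℤ, s = 2 * (Real.pi : ℂ) * Complex.I * m / (Real.log q : ℂ) := by
  have hq : (q : ℂ) ≠ 0 := by exact_mod_cast hq0.ne'
  have hl : (Real.log q : ℂ) ≠ 0 := by exact_mod_cast (Real.log_neg hq0 hq1).ne
  rw [cpow_def_of_ne_zero hq, ← ofReal_log hq0.le, exp_eq_one_iff]
  refine exists_congr fun m => ?_
  rw [eq_div_iff hl]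
  constructor <;> intro h
  · rw [mul_comm, h]; ring
  · rw [mul_comm, h]; ring

lemma mem_decreasingSeq_iff {q : ℝ} (hq0 : 0 < q) (hq1 : q < 1) (x z : ℂ) :
    z ∈ decreasingSeq q x ↔ ∃ k : ℕ, (q : ℂ) ^ (x + z) * (q : ℂ) ^ k = 1 := by
  have hq : (q : ℂ) ≠ 0 := by exact_mod_cast hq0.ne'
  refine exists_congr fun k => ?_
  rw [← Complex.cpow_natCast, ← Complex.cpow_add _ _ hq, cpow_eq_one_iff hq0 hq1]
  refine exists_congr fun m => ?_
  constructor <;> intro h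
  · rw [h]; ring
  · linear_combination h

lemma norm_ofReal_lt_one {q : ℝ} (hq0 : 0 < q) (hq1 : q < 1) : ‖(q : ℂ)‖ < 1 := by
  rwa [Complex.norm_real, Real.norm_of_nonneg hq0.le]

/-- `π / (sin π(c-s) sin π(d-s))`. -/
noncomputable def sinKernel (c d s : ℂ) : ℂ :=
  (Real.pi : ℂ) / (Complex.sin (Real.pi * (c - s)) * Complex.sin (Real.pi * (d - s)))

/-- The Barnes integrand in terms of `t = q^s`. -/
lemma barnesIntegrand_eq {q : ℝ} (hq0 : 0 < q) (a b c d e f s : ℂ) :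
    barnesIntegrand q a b c d e f s =
      barnesTerm q ((q : ℂ) ^ c) ((q : ℂ) ^ d) ((q : ℂ) ^ a) ((q : ℂ) ^ b) ((q : ℂ) ^ e)
        ((q : ℂ) ^ f) ((q : ℂ) ^ s) * sinKernel c d s := by
  have hq : (q : ℂ) ≠ 0 := by exact_mod_cast hq0.ne'
  have h : ∀ c : ℂ, (q : ℂ) ^ (1 - c + s) = q * (q : ℂ) ^ s / (q : ℂ) ^ c := fun c => by
    rw [Complex.cpow_add _ _ hq, Complex.cpow_sub _ _ hq, Complex.cpow_one]; ring
  rw [barnesIntegrand, barnesTerm, sinKernel, h c, h d]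
  simp only [Complex.cpow_add _ _ hq]
  ring

lemma barnesIntegrand_swap (q : ℝ) (a b c d e f s : ℂ) :
    barnesIntegrand q a b c d e f s = barnesIntegrand q a b d c e f s := by
  simp only [barnesIntegrand]; ring

lemma barnesTerm_swap (q x y α β A h t : ℂ) :
    barnesTerm q x y α β A h t = barnesTerm q y x α β A h t := by
  simp only [barnesTerm]; ring

lemma differentiable_qPochInf_cpow {q : ℝ} (hq0 : 0 < q) (hq1 : q < 1) (x : ℂ) :
    Differentiable ℂ fun s : ℂ => qPochInf ((q : ℂ) ^ (x + s)) q := by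
  have hq : (q : ℂ) ≠ 0 := by exact_mod_cast hq0.ne'
  refine (differentiable_qPochInf (norm_ofReal_lt_one hq0 hq1)).comp ?_
  exact fun s => (differentiableAt_id.const_add x).const_cpow (.inl hq)

lemma differentiable_sin_pi_sub (c : ℂ) :
    Differentiable ℂ fun s : ℂ => Complex.sin (Real.pi * (c - s)) := by fun_prop

lemma sin_pi_mul_eq_zero_iff (z : ℂ) :
    Complex.sin (Real.pi * z) = 0 ↔ ∃ m : ℤ, z = m := by
  have hpi : (Real.pi : ℂ) ≠ 0 := by exact_mod_cast Real.pi_ne_zero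
  rw [Complex.sin_eq_zero_iff]
  refine exists_congr fun m => ?_
  rw [mul_comm, mul_left_inj' hpi]

/-- The part of the Barnes integrand other than the factors with zeros or poles on `c + ℤ`. -/
noncomputable def barnesCofactor (q : ℝ) (a b d e f s : ℂ) : ℂ :=
  qPochInf ((q : ℂ) ^ (1 - d + s)) q * qPochInf ((q : ℂ) ^ (e + f + s)) q
    / (qPochInf ((q : ℂ) ^ (a + s)) q * qPochInf ((q : ℂ) ^ (b + s)) q
      * qPochInf ((q : ℂ) ^ (f + s)) q)
    * ((Real.pi : ℂ) * (q : ℂ) ^ s / Complex.sin (Real.pi * (d - s)))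

lemma barnesIntegrand_eq_cofactor (q : ℝ) (a b c d e f s : ℂ) :
    barnesIntegrand q a b c d e f s = qPochInf ((q : ℂ) ^ (1 - c + s)) q *
      barnesCofactor q a b d e f s / Complex.sin (Real.pi * (c - s)) := by
  simp only [barnesIntegrand, barnesCofactor]
  ring

lemma qPochInf_cpow_ne_zero {q : ℝ} (hq0 : 0 < q) (hq1 : q < 1) {x z : ℂ}
    (hz : z ∉ decreasingSeq q x) : qPochInf ((q : ℂ) ^ (x + z)) q ≠ 0 :=
  qPochInf_ne_zero (norm_ofReal_lt_one hq0 hq1) fun k hk =>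
    hz ((mem_decreasingSeq_iff hq0 hq1 x z).2 ⟨k, hk⟩)

lemma analyticAt_barnesCofactor {q : ℝ} (hq0 : 0 < q) (hq1 : q < 1) (a b d e f : ℂ) {z : ℂ}
    (ha : z ∉ decreasingSeq q a) (hb : z ∉ decreasingSeq q b) (hf : z ∉ decreasingSeq q f)
    (hd : Complex.sin (Real.pi * (d - z)) ≠ 0) :
    AnalyticAt ℂ (barnesCofactor q a b d e f) z := by
  have hq : (q : ℂ) ≠ 0 := by exact_mod_cast hq0.ne'
  have h := fun x => (differentiable_qPochInf_cpow hq0 hq1 x).analyticAt z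
  have h' : AnalyticAt ℂ (fun s : ℂ => (q : ℂ) ^ s) z :=
    Differentiable.analyticAt (fun s => differentiableAt_id.const_cpow (.inl hq)) z
  refine (((h _).mul (h _)).div (((h _).mul (h _)).mul (h _)) ?_).mul
    ((analyticAt_const.mul h').div ((differentiable_sin_pi_sub d).analyticAt z) hd)
  exact mul_ne_zero (mul_ne_zero (qPochInf_cpow_ne_zero hq0 hq1 ha)
    (qPochInf_cpow_ne_zero hq0 hq1 hb)) (qPochInf_cpow_ne_zero hq0 hq1 hf)

lemma meromorphicAt_barnesIntegrand {q : ℝ} (hq0 : 0 < q) (hq1 : q < 1) (a b c d e f z : ℂ) :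
    MeromorphicAt (barnesIntegrand q a b c d e f) z := by
  have hq : (q : ℂ) ≠ 0 := by exact_mod_cast hq0.ne'
  have h := fun x => ((differentiable_qPochInf_cpow hq0 hq1 x).analyticAt z).meromorphicAt
  have h' : MeromorphicAt (fun s : ℂ => (q : ℂ) ^ s) z :=
    (Differentiable.analyticAt (fun s => differentiableAt_id.const_cpow (.inl hq)) z).meromorphicAt
  have h2 := fun c => ((differentiable_sin_pi_sub c).analyticAt z).meromorphicAt
  exact ((((h _).mul (h _)).mul (h _)).div (((h _).mul (h _)).mul (h _))).mul
    (((MeromorphicAt.const _ _).mul h').div ((h2 c).mul (h2 d)))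

lemma measurable_barnesIntegrand {q : ℝ} (hq0 : 0 < q) (hq1 : q < 1) (a b c d e f : ℂ) :
    Measurable (barnesIntegrand q a b c d e f) := by
  have hq : (q : ℂ) ≠ 0 := by exact_mod_cast hq0.ne'
  have h := fun x => (differentiable_qPochInf_cpow hq0 hq1 x).continuous.measurable
  have h' : Measurable (fun s : ℂ => (q : ℂ) ^ s) :=
    (Differentiable.continuous
      (fun s : ℂ => differentiableAt_id.const_cpow (.inl hq) : Differentiable ℂ _)).measurable
  have h2 := fun c => (differentiable_sin_pi_sub c).continuous.measurable
  exact ((((h _).mul (h _)).mul (h _)).div (((h _).mul (h _)).mul (h _))).mul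
    ((measurable_const.mul h').div ((h2 c).mul (h2 d)))

/-- The quotient of an analytic function by one with a simple zero at `p`. -/
lemma exists_div_eq_mul_inv_sub {B : ℂ → ℂ} {p : ℂ} (hB : AnalyticAt ℂ B p)
    (hB0 : B p = 0) (hB1 : deriv B p ≠ 0) {A : ℂ → ℂ} (hA : AnalyticAt ℂ A p) :
    ∃ G : ℂ → ℂ, AnalyticAt ℂ G p ∧ G p = A p / deriv B p ∧
      ∀ s, s ≠ p → A s / B s = G s * (s - p)⁻¹ := by
  refine ⟨fun s => A s / dslope B p s, hA.div (analyticAt_dslope hB) (by rwa [dslope_same]),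
    by simp [dslope_same], fun s hs => ?_⟩
  have h := eq_add_mul_dslope B p s
  rw [hB0, zero_add] at h
  rw [h, mul_comm (s - p), ← div_div, div_eq_mul_inv _ (s - p)]

lemma deriv_sin_pi_sub (c z : ℂ) :
    deriv (fun s : ℂ => Complex.sin (Real.pi * (c - s))) z =
      -(Real.pi * Complex.cos (Real.pi * (c - z))) := by
  have h := (((hasDerivAt_id z).const_sub c).const_mul (Real.pi : ℂ)).csin
  refine h.deriv.trans ?_
  simp only [id]
  ring

lemma deriv_sin_pi_sub_ne_zero {c z : ℂ} (hz : Complex.sin (Real.pi * (c - z)) = 0) :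
    deriv (fun s : ℂ => Complex.sin (Real.pi * (c - s))) z ≠ 0 := by
  rw [deriv_sin_pi_sub, neg_ne_zero]
  refine mul_ne_zero (by exact_mod_cast Real.pi_ne_zero) fun h => ?_
  have := Complex.sin_sq_add_cos_sq (Real.pi * (c - z))
  rw [hz, h] at this
  simp at this

lemma sin_pi_sub_ne_zero {c d z : ℂ} (hsin : Complex.sin (Real.pi * (c - d)) ≠ 0)
    (hz : Complex.sin (Real.pi * (c - z)) = 0) : Complex.sin (Real.pi * (d - z)) ≠ 0 := by
  intro h
  obtain ⟨m, hm⟩ := (sin_pi_mul_eq_zero_iff _).1 hz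
  obtain ⟨n, hn⟩ := (sin_pi_mul_eq_zero_iff _).1 h
  refine hsin ((sin_pi_mul_eq_zero_iff _).2 ⟨m - n, ?_⟩)
  push_cast
  rw [← hm, ← hn]; ring

/-- A zero of `sin π(c-s)` that is not of the form `c + k`, `k ≥ 0`, is cancelled by a zero of
`(q^{1-c+s}; q)_∞`. -/
lemma meromorphicOrderAt_nonneg_of_sin_eq_zero {q : ℝ} (hq0 : 0 < q) (hq1 : q < 1) (a b c d e f : ℂ)
    (hsin : Complex.sin (Real.pi * (c - d)) ≠ 0) {z : ℂ}
    (ha : z ∉ decreasingSeq q a) (hb : z ∉ decreasingSeq q b) (hf : z ∉ decreasingSeq q f)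
    (hc : z ∉ increasingSeq c) (hz : Complex.sin (Real.pi * (c - z)) = 0) :
    0 ≤ meromorphicOrderAt (barnesIntegrand q a b c d e f) z := by
  have hq : (q : ℂ) ≠ 0 := by exact_mod_cast hq0.ne'
  obtain ⟨m, hm⟩ := (sin_pi_mul_eq_zero_iff _).1 hz
  have hm0 : 0 < m := by
    by_contra h
    obtain ⟨k, hk⟩ := Int.eq_ofNat_of_zero_le (show 0 ≤ -m by omega)
    refine hc ⟨k, ?_⟩
    have : (k : ℂ) = -(m : ℂ) := by exact_mod_cast hk.symm
    rw [this, ← hm]; ring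
  obtain ⟨k, hk⟩ := Int.eq_ofNat_of_zero_le (show 0 ≤ m - 1 by omega)
  have hzero : qPochInf ((q : ℂ) ^ (1 - c + z)) q = 0 := by
    refine (qPochInf_eq_zero_iff (norm_ofReal_lt_one hq0 hq1)).2 ⟨k, ?_⟩
    have hk' : (k : ℂ) = (m : ℂ) - 1 := by exact_mod_cast hk.symm
    rw [← Complex.cpow_natCast, ← Complex.cpow_add _ _ hq, hk', ← hm]
    ring_nf
    exact Complex.cpow_zero _
  have hN := (differentiable_qPochInf_cpow hq0 hq1 (1 - c)).analyticAt z
  have hR := analyticAt_barnesCofactor hq0 hq1 a b d e f ha hb hf (sin_pi_sub_ne_zero hsin hz)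
  obtain ⟨G, hG, hGp, h⟩ := exists_div_eq_mul_inv_sub
    ((differentiable_sin_pi_sub c).analyticAt z) hz (deriv_sin_pi_sub_ne_zero hz) (hN.mul hR)
  refine (meromorphicAt_barnesIntegrand hq0 hq1 a b c d e f z).meromorphicOrderAt_nonneg_iff.2
    ⟨dslope G z, analyticAt_dslope hG, ?_⟩
  filter_upwards [self_mem_nhdsWithin] with s hs
  have hs' := sub_ne_zero.2 hs
  have h1 := h s hs
  have h2 := eq_add_mul_dslope G z s
  simp only [Pi.mul_apply, hzero, zero_mul, zero_div] at hGp h1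
  rw [barnesIntegrand_eq_cofactor, h1, h2, hGp]
  field_simp
  ring

/-- Every pole of the Barnes integrand lies in one of the increasing or decreasing sequences. -/
lemma mem_of_meromorphicOrderAt_neg {q : ℝ} (hq0 : 0 < q) (hq1 : q < 1) (a b c d e f : ℂ)
    (hsin : Complex.sin (Real.pi * (c - d)) ≠ 0) {z : ℂ}
    (hz : meromorphicOrderAt (barnesIntegrand q a b c d e f) z < 0) :
    z ∈ increasingSeq c ∪ increasingSeq d ∨
      z ∈ decreasingSeq q a ∪ decreasingSeq q b ∪ decreasingSeq q f := by
  by_contra hcon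
  simp only [Set.mem_union, not_or] at hcon
  obtain ⟨⟨hc, hd⟩, ⟨ha, hb⟩, hf⟩ := hcon
  refine hz.not_ge ?_
  by_cases h1 : Complex.sin (Real.pi * (c - z)) = 0
  · exact meromorphicOrderAt_nonneg_of_sin_eq_zero hq0 hq1 a b c d e f hsin ha hb hf hc h1
  by_cases h2 : Complex.sin (Real.pi * (d - z)) = 0
  · have hsin' : Complex.sin (Real.pi * (d - c)) ≠ 0 := by
      rwa [← neg_sub, mul_neg, Complex.sin_neg, neg_ne_zero]
    have := meromorphicOrderAt_nonneg_of_sin_eq_zero hq0 hq1 a b d c e f hsin' ha hb hf hd h2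
    rwa [show barnesIntegrand q a b c d e f = barnesIntegrand q a b d c e f from
      funext fun s => barnesIntegrand_swap q a b c d e f s]
  · have hN := (differentiable_qPochInf_cpow hq0 hq1 (1 - c)).analyticAt z
    have hR := analyticAt_barnesCofactor hq0 hq1 a b d e f ha hb hf h2
    have h3 := (hN.mul hR).div ((differentiable_sin_pi_sub c).analyticAt z) h1
    have h4 : barnesIntegrand q a b c d e f = _ :=
      funext fun s => barnesIntegrand_eq_cofactor q a b c d e f s
    rw [h4]
    exact h3.meromorphicOrderAt_nonneg

lemma sin_pi_sub_natCast (z : ℂ) (k : ℕ) :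
    Complex.sin (Real.pi * (z - k)) = (-1) ^ k * Complex.sin (Real.pi * z) := by
  rw [mul_sub, mul_comm (Real.pi : ℂ) k]
  exact Complex.sin_antiperiodic.sub_nat_mul_eq k

lemma cos_pi_sub_self_add_natCast (c : ℂ) (k : ℕ) :
    Complex.cos (Real.pi * (c - (c + k))) = (-1) ^ k := by
  have h := Complex.cos_antiperiodic.sub_nat_mul_eq (x := 0) k
  rw [Complex.cos_zero, mul_one] at h
  rw [← h]
  ring_nf

/-- The Laurent expansion of the Barnes integrand at `c + k`. -/
lemma exists_principalPart_barnesIntegrand {q : ℝ} (hq0 : 0 < q) (hq1 : q < 1) (a b c d e f : ℂ)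
    (hsin : Complex.sin (Real.pi * (c - d)) ≠ 0) (k : ℕ)
    (ha : c + k ∉ decreasingSeq q a) (hb : c + k ∉ decreasingSeq q b)
    (hf : c + k ∉ decreasingSeq q f) :
    ∃ g : ℂ → ℂ, AnalyticAt ℂ g (c + k) ∧ ∀ᶠ s in 𝓝[≠] (c + k), barnesIntegrand q a b c d e f s =
      principalPart (fun _ => -(barnesTerm q ((q : ℂ) ^ c) ((q : ℂ) ^ d) ((q : ℂ) ^ a)
        ((q : ℂ) ^ b) ((q : ℂ) ^ e) ((q : ℂ) ^ f) ((q : ℂ) ^ (c + k)) /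
          Complex.sin (Real.pi * (d - c)))) 0 (c + k) s + g s := by
  have hpi : (Real.pi : ℂ) ≠ 0 := by exact_mod_cast Real.pi_ne_zero
  have hsin' : Complex.sin (Real.pi * (d - c)) ≠ 0 := by
    rwa [← neg_sub, mul_neg, Complex.sin_neg, neg_ne_zero]
  have hz : Complex.sin (Real.pi * (c - (c + k))) = 0 := by
    rw [show c - (c + k) = 0 - (k : ℂ) by ring, sin_pi_sub_natCast]; simp
  have hd0 := sin_pi_sub_ne_zero hsin hz
  have hN := (differentiable_qPochInf_cpow hq0 hq1 (1 - c)).analyticAt (c + k)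
  have hR := analyticAt_barnesCofactor hq0 hq1 a b d e f ha hb hf hd0
  obtain ⟨G, hG, hGp, h⟩ := exists_div_eq_mul_inv_sub
    ((differentiable_sin_pi_sub c).analyticAt (c + k)) hz (deriv_sin_pi_sub_ne_zero hz) (hN.mul hR)
  obtain ⟨c', g, hg, hc', h'⟩ := exists_principalPart_of_analyticAt (c + k) 0 G hG
  refine ⟨g, hg, ?_⟩
  filter_upwards [self_mem_nhdsWithin] with s hs
  have h1 := h s hs
  have h2 := h' s hs
  rw [barnesIntegrand_eq_cofactor]
  simp only [Pi.mul_apply] at h1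
  rw [h1]
  rw [zero_add, pow_one] at h2
  rw [h2]
  congr 1
  simp only [principalPart, zero_add, Finset.range_one, Finset.sum_singleton, hc' rfl, hGp]
  congr 1
  -- the value of the cofactor at `c + k` is the residue times the derivative of `sin π(c-s)`
  have h3 : qPochInf ((q : ℂ) ^ (1 - c + (c + k))) q * barnesCofactor q a b d e f (c + k) =
      barnesTerm q ((q : ℂ) ^ c) ((q : ℂ) ^ d) ((q : ℂ) ^ a) ((q : ℂ) ^ b) ((q : ℂ) ^ e)
        ((q : ℂ) ^ f) ((q : ℂ) ^ (c + k)) * (Real.pi / Complex.sin (Real.pi * (d - (c + k)))) := by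
    have hq : (q : ℂ) ≠ 0 := by exact_mod_cast hq0.ne'
    have h : ∀ c z : ℂ, (q : ℂ) ^ (1 - c + z) = q * (q : ℂ) ^ z / (q : ℂ) ^ c := fun c z => by
      rw [Complex.cpow_add _ _ hq, Complex.cpow_sub _ _ hq, Complex.cpow_one]; ring
    rw [barnesTerm, barnesCofactor, h c, h d, Complex.cpow_add a _ hq, Complex.cpow_add b _ hq,
      Complex.cpow_add f _ hq, Complex.cpow_add (e + f) _ hq, Complex.cpow_add e _ hq]
    ring
  rw [Pi.mul_apply, h3, deriv_sin_pi_sub, show d - (c + k) = (d - c) - (k : ℂ) by ring,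
    sin_pi_sub_natCast, cos_pi_sub_self_add_natCast]
  have h4 : ((-1 : ℂ) ^ k) * (-1) ^ k = 1 := by rw [← mul_pow]; simp
  have h5 : ((-1 : ℂ) ^ k) ≠ 0 := by simp
  field_simp
  rw [pow_two, h4, mul_one]

end integrand

/-! ### Boundedness of the ratio of `q`-shifted factorials -/

section bounds

/-- The ratio `(qt/x, qt/y, Aht; q)_∞ / (αt, βt, ht; q)_∞`. -/
noncomputable def barnesRatio (q x y α β A h t : ℂ) : ℂ :=
  qPochInf (q * t / x) q * qPochInf (q * t / y) q * qPochInf (A * h * t) q /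
    (qPochInf (α * t) q * qPochInf (β * t) q * qPochInf (h * t) q)

lemma barnesTerm_eq_mul_barnesRatio (q x y α β A h t : ℂ) :
    barnesTerm q x y α β A h t = t * barnesRatio q x y α β A h t := rfl

/-- A meromorphic function without poles on a compact set is bounded near the set. -/
lemma exists_isOpen_bounded_of_meromorphicOrderAt_nonneg {f : ℂ → ℂ} {K : Set ℂ}
    (hK : IsCompact K) (hf : ∀ z ∈ K, MeromorphicAt f z)
    (hord : ∀ z ∈ K, 0 ≤ meromorphicOrderAt f z) :
    ∃ U : Set ℂ, IsOpen U ∧ K ⊆ U ∧ ∃ C : ℝ, ∀ z ∈ U, ‖f z‖ ≤ C := by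
  refine hK.induction_on (p := fun s => ∃ U : Set ℂ, IsOpen U ∧ s ⊆ U ∧ ∃ C : ℝ, ∀ z ∈ U, ‖f z‖ ≤ C)
    ⟨∅, isOpen_empty, Set.empty_subset _, 0, by simp⟩ ?_ ?_ ?_
  · rintro s t hst ⟨U, hU, htU, hC⟩
    exact ⟨U, hU, hst.trans htU, hC⟩
  · rintro s t ⟨U, hU, hsU, C, hC⟩ ⟨V, hV, htV, D, hD⟩
    refine ⟨U ∪ V, hU.union hV, Set.union_subset_union hsU htV, max C D, ?_⟩
    rintro z (hz | hz)
    · exact (hC z hz).trans (le_max_left _ _)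
    · exact (hD z hz).trans (le_max_right _ _)
  · intro z hz
    obtain ⟨g, hg, h⟩ := (hf z hz).meromorphicOrderAt_nonneg_iff.1 (hord z hz)
    have h1 : ∀ᶠ w in 𝓝 z, ‖g w‖ < ‖g z‖ + 1 :=
      hg.continuousAt.norm.eventually (gt_mem_nhds (lt_add_one _))
    have h2 : ∀ᶠ w in 𝓝 z, ‖f w‖ ≤ max (‖f z‖) (‖g z‖ + 1) := by
      filter_upwards [h1, eventually_nhdsWithin_iff.1 h] with w hw1 hw2
      by_cases hwz : w = z
      · rw [hwz]; exact le_max_left _ _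
      · rw [hw2 hwz]; exact hw1.le.trans (le_max_right _ _)
    obtain ⟨U, hU, hUo, hzU⟩ := eventually_nhds_iff.1 h2
    exact ⟨U, nhdsWithin_le_nhds (hUo.mem_nhds hzU), U, hUo, subset_rfl, _, hU⟩

lemma analyticAt_qPochInf_mul {q : ℝ} (hq0 : 0 < q) (hq1 : q < 1) (a z : ℂ) :
    AnalyticAt ℂ (fun t : ℂ => qPochInf (a * t) q) z :=
  ((differentiable_qPochInf (norm_ofReal_lt_one hq0 hq1)).comp
    (differentiable_id.const_mul a)).analyticAt z

lemma analyticAt_barnesRatio {q : ℝ} (hq0 : 0 < q) (hq1 : q < 1) (x y α β A h : ℂ) {z : ℂ}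
    (hα : qPochInf (α * z) q ≠ 0) (hβ : qPochInf (β * z) q ≠ 0) (hh : qPochInf (h * z) q ≠ 0) :
    AnalyticAt ℂ (barnesRatio q x y α β A h) z := by
  have H := fun a => analyticAt_qPochInf_mul hq0 hq1 a z
  have H' : ∀ x : ℂ, AnalyticAt ℂ (fun t : ℂ => qPochInf (q * t / x) q) z := fun x => by
    simpa only [mul_div_right_comm] using H (q / x)
  exact (((H' x).mul (H' y)).mul (H _)).div (((H _).mul (H _)).mul (H _))
    (mul_ne_zero (mul_ne_zero hα hβ) hh)

lemma meromorphicAt_barnesRatio {q : ℝ} (hq0 : 0 < q) (hq1 : q < 1) (x y α β A h z : ℂ) :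
    MeromorphicAt (barnesRatio q x y α β A h) z := by
  have H := fun a => (analyticAt_qPochInf_mul hq0 hq1 a z).meromorphicAt
  have H' : ∀ x : ℂ, MeromorphicAt (fun t : ℂ => qPochInf (q * t / x) q) z := fun x => by
    simpa only [mul_div_right_comm] using H (q / x)
  exact (((H' x).mul (H' y)).mul (H _)).div (((H _).mul (H _)).mul (H _))

/-- A pole `q^z` of the ratio is a pole `z` of the Barnes integrand, unless `z` is a pole of the
trigonometric factor. -/
lemma meromorphicOrderAt_barnesIntegrand {q : ℝ} (hq0 : 0 < q) (hq1 : q < 1) (a b c d e f : ℂ)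
    {z : ℂ} (hc : Complex.sin (Real.pi * (c - z)) ≠ 0)
    (hd : Complex.sin (Real.pi * (d - z)) ≠ 0) :
    meromorphicOrderAt (barnesIntegrand q a b c d e f) z =
      meromorphicOrderAt (barnesRatio q ((q : ℂ) ^ c) ((q : ℂ) ^ d) ((q : ℂ) ^ a) ((q : ℂ) ^ b)
        ((q : ℂ) ^ e) ((q : ℂ) ^ f)) ((q : ℂ) ^ z) := by
  have hq : (q : ℂ) ≠ 0 := by exact_mod_cast hq0.ne'
  have hpi : (Real.pi : ℂ) ≠ 0 := by exact_mod_cast Real.pi_ne_zero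
  have hl : Complex.log q ≠ 0 := by
    rw [← Complex.ofReal_log hq0.le]
    exact_mod_cast (Real.log_neg hq0 hq1).ne
  have hz : (q : ℂ) ^ z ≠ 0 := by simp [Complex.cpow_eq_zero_iff, hq]
  have h1 : AnalyticAt ℂ (fun s : ℂ => (q : ℂ) ^ s) z :=
    Differentiable.analyticAt (fun s => differentiableAt_id.const_cpow (.inl hq)) z
  have h2 : deriv (fun s : ℂ => (q : ℂ) ^ s) z ≠ 0 := by
    have := (hasDerivAt_id z).const_cpow (c := (q : ℂ)) (.inl hq)
    rw [show deriv (fun s : ℂ => (q : ℂ) ^ s) z = _ from this.deriv]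
    exact mul_ne_zero (mul_ne_zero hz hl) one_ne_zero
  have h3 : AnalyticAt ℂ (fun s : ℂ => (q : ℂ) ^ s * sinKernel c d s) z :=
    h1.mul (analyticAt_const.div (((differentiable_sin_pi_sub c).analyticAt z).mul
      ((differentiable_sin_pi_sub d).analyticAt z)) (mul_ne_zero hc hd))
  have h4 : meromorphicOrderAt (fun s : ℂ => (q : ℂ) ^ s * sinKernel c d s) z = 0 := by
    rw [h3.meromorphicNFAt.meromorphicOrderAt_eq_zero_iff]
    exact mul_ne_zero hz (div_ne_zero hpi (mul_ne_zero hc hd))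
  have h5 : barnesIntegrand q a b c d e f = (fun s : ℂ => (q : ℂ) ^ s * sinKernel c d s) *
      (barnesRatio q ((q : ℂ) ^ c) ((q : ℂ) ^ d) ((q : ℂ) ^ a) ((q : ℂ) ^ b)
        ((q : ℂ) ^ e) ((q : ℂ) ^ f) ∘ fun s : ℂ => (q : ℂ) ^ s) := by
    funext s
    rw [barnesIntegrand_eq hq0, barnesTerm_eq_mul_barnesRatio]
    simp only [Pi.mul_apply, Function.comp]
    ring
  have h6 := meromorphicAt_barnesRatio hq0 hq1 ((q : ℂ) ^ c) ((q : ℂ) ^ d) ((q : ℂ) ^ a)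
    ((q : ℂ) ^ b) ((q : ℂ) ^ e) ((q : ℂ) ^ f) ((q : ℂ) ^ z)
  rw [h5, meromorphicOrderAt_mul h3.meromorphicAt (h6.comp_analyticAt h1), h4, zero_add,
    meromorphicOrderAt_comp_of_deriv_ne_zero h1 h2]

/-- Every nonzero number is `q^z` with `z` as far up (`ε = 1`) or down (`ε = -1`) as desired. -/
lemma exists_cpow_eq_and_le_im {q : ℝ} (hq0 : 0 < q) (hq1 : q < 1) {t : ℂ} (ht : t ≠ 0) {ε : ℤ}
    (hε : ε * ε = 1) (T : ℝ) : ∃ z : ℂ, (q : ℂ) ^ z = t ∧ T ≤ ε * z.im := by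
  have hq : (q : ℂ) ≠ 0 := by exact_mod_cast hq0.ne'
  have hl' : Real.log q < 0 := Real.log_neg hq0 hq1
  have hl : (Real.log q : ℂ) ≠ 0 := by exact_mod_cast hl'.ne
  set z₀ : ℂ := Complex.log t / Real.log q
  obtain ⟨k, hk⟩ := exists_nat_ge ((T - ε * z₀.im) / (2 * Real.pi / -Real.log q))
  rw [div_le_iff₀ (div_pos (by positivity) (by linarith))] at hk
  refine ⟨z₀ + 2 * (Real.pi : ℂ) * Complex.I * ((-ε * k : ℤ) : ℂ) / (Real.log q : ℂ), ?_, ?_⟩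
  · rw [Complex.cpow_add _ _ hq, ((cpow_eq_one_iff hq0 hq1 _).2 ⟨_, rfl⟩), mul_one,
      Complex.cpow_def_of_ne_zero hq, ← Complex.ofReal_log hq0.le, mul_div_cancel₀ _ hl,
      Complex.exp_log ht]
  · have h1 : 2 * (Real.pi : ℂ) * Complex.I * ((-ε * k : ℤ) : ℂ) / (Real.log q : ℂ) =
        ((2 * Real.pi / -Real.log q * (ε * k) : ℝ) : ℂ) * Complex.I := by
      push_cast
      field_simp
    have h2 : (ε : ℝ) * ε = 1 := by exact_mod_cast hε
    rw [h1, Complex.add_im, Complex.im_ofReal_mul, Complex.I_im, mul_one]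
    linear_combination hk - (2 * Real.pi / -Real.log q) * k * h2

/-- If the poles `z` of the integrand in the decreasing sequences satisfy `Re z < σ` near one end of
the contour, then the ratio has no poles in `0 < |t| ≤ q^σ`, by periodicity of `s ↦ q^s`. -/
lemma meromorphicOrderAt_barnesRatio_nonneg {q : ℝ} (hq0 : 0 < q) (hq1 : q < 1)
    {a b c d e f : ℂ} (hsin : Complex.sin (Real.pi * (c - d)) ≠ 0) {γ : ℝ → ℂ}
    (hγ : IsBarnesContour (barnesIntegrand q a b c d e f)
      (increasingSeq c ∪ increasingSeq d)
      (decreasingSeq q a ∪ decreasingSeq q b ∪ decreasingSeq q f) γ)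
    {ε : ℤ} (hε : ε * ε = 1) {σ T : ℝ}
    (hT : ∀ p : ℂ, T ≤ ε * p.im → σ ≤ p.re → ¬ LiesLeftOf p γ) {t : ℂ} (ht : t ≠ 0)
    (htσ : ‖t‖ ≤ q ^ σ) :
    0 ≤ meromorphicOrderAt (barnesRatio q ((q : ℂ) ^ c) ((q : ℂ) ^ d) ((q : ℂ) ^ a)
      ((q : ℂ) ^ b) ((q : ℂ) ^ e) ((q : ℂ) ^ f)) t := by
  by_contra! hneg
  obtain ⟨z, rfl, hz⟩ := exists_cpow_eq_and_le_im hq0 hq1 ht hε (max T (|c.im| + |d.im| + 1))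
  rw [Complex.norm_cpow_eq_rpow_re_of_pos hq0, Real.rpow_le_rpow_left_iff_of_base_lt_one hq0 hq1]
    at htσ
  have hεz : |(ε : ℝ) * z.im| = |z.im| := by
    have h2 : (ε : ℝ) * ε = 1 := by exact_mod_cast hε
    rw [abs_mul]
    have : |(ε : ℝ)| = 1 := by
      rcases mul_self_eq_one_iff.1 h2 with h | h <;> simp [h]
    rw [this, one_mul]
  have him : |c.im| + |d.im| + 1 ≤ |z.im| :=
    hεz ▸ ((le_max_right _ _).trans hz).trans (le_abs_self _)
  have hne : ∀ c' : ℂ, |c'.im| ≤ |c.im| + |d.im| → Complex.sin (Real.pi * (c' - z)) ≠ 0 := by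
    intro c' hc' h0
    obtain ⟨m, hm⟩ := (sin_pi_mul_eq_zero_iff _).1 h0
    have := congrArg Complex.im hm
    rw [Complex.sub_im, Complex.intCast_im, sub_eq_zero] at this
    rw [this] at hc'
    linarith
  have hc := hne c (by linarith [abs_nonneg d.im])
  have hd := hne d (by linarith [abs_nonneg c.im])
  rw [← meromorphicOrderAt_barnesIntegrand hq0 hq1 a b c d e f hc hd] at hneg
  refine hT z ((le_max_left _ _).trans hz) htσ (hγ.left z ?_ hneg)
  refine (mem_of_meromorphicOrderAt_neg hq0 hq1 a b c d e f hsin hneg).resolve_left ?_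
  rintro (⟨k, rfl⟩ | ⟨k, rfl⟩)
  · exact hc (by rw [show c - (c + k) = 0 - (k : ℂ) by ring, sin_pi_sub_natCast]; simp)
  · exact hd (by rw [show d - (d + k) = 0 - (k : ℂ) by ring, sin_pi_sub_natCast]; simp)

/-- The ratio is bounded on a half-plane containing both ends of a Barnes contour. -/
lemma exists_norm_barnesRatio_le {q : ℝ} (hq0 : 0 < q) (hq1 : q < 1)
    {a b c d e f : ℂ} (hsin : Complex.sin (Real.pi * (c - d)) ≠ 0) {γ : ℝ → ℂ}
    (hγ : IsBarnesContour (barnesIntegrand q a b c d e f)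
      (increasingSeq c ∪ increasingSeq d)
      (decreasingSeq q a ∪ decreasingSeq q b ∪ decreasingSeq q f) γ) {σ τ : ℝ}
    (hσ : ∀ᶠ t in atTop, γ t = (σ : ℂ) + (t : ℂ) * Complex.I)
    (hτ : ∀ᶠ t in atTop, γ (-t) = (τ : ℂ) - (t : ℂ) * Complex.I) :
    ∃ u C : ℝ, u < σ ∧ u < τ ∧ ∀ s : ℂ, u < s.re →
      ‖barnesRatio q ((q : ℂ) ^ c) ((q : ℂ) ^ d) ((q : ℂ) ^ a) ((q : ℂ) ^ b) ((q : ℂ) ^ e)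
        ((q : ℂ) ^ f) ((q : ℂ) ^ s)‖ ≤ C := by
  set μ := min σ τ with hμ
  have hord : ∀ t : ℂ, t ≠ 0 → ‖t‖ ≤ q ^ μ →
      0 ≤ meromorphicOrderAt (barnesRatio q ((q : ℂ) ^ c) ((q : ℂ) ^ d) ((q : ℂ) ^ a)
        ((q : ℂ) ^ b) ((q : ℂ) ^ e) ((q : ℂ) ^ f)) t := by
    intro t ht htμ
    rcases min_choice σ τ with h | h
    · obtain ⟨T₁, h₁⟩ := eventually_liesRightOf_top hγ.upward hσ
      obtain ⟨T₂, h₂⟩ := eventually_atTop.1 hσ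
      refine meromorphicOrderAt_barnesRatio_nonneg hq0 hq1 hsin hγ (ε := 1) (σ := σ)
        (T := max T₁ T₂) (by norm_num) (fun p hp1 hp2 => ?_) ht (by rwa [hμ, h] at htμ)
      rw [Int.cast_one, one_mul] at hp1
      rcases hp2.lt_or_eq with hlt | heq
      · exact not_liesLeftOf_of_liesRightOf (h₁ p ((le_max_left _ _).trans hp1) hlt)
      · refine fun hL => hL.1 p.im ?_
        rw [h₂ _ ((le_max_right _ _).trans hp1), heq, Complex.re_add_im]
    · obtain ⟨T₁, h₁⟩ := eventually_liesRightOf_bot hγ.upward hτ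
      obtain ⟨T₂, h₂⟩ := eventually_atTop.1 hτ
      refine meromorphicOrderAt_barnesRatio_nonneg hq0 hq1 hsin hγ (ε := -1) (σ := τ)
        (T := max (-T₁) T₂) (by norm_num) (fun p hp1 hp2 => ?_) ht (by rwa [hμ, h] at htμ)
      push_cast at hp1
      rw [neg_one_mul] at hp1
      rcases hp2.lt_or_eq with hlt | heq
      · exact not_liesLeftOf_of_liesRightOf
          (h₁ p (by linarith [(le_max_left (-T₁) T₂).trans hp1]) hlt)
      · refine fun hL => hL.1 p.im ?_
        have := h₂ _ ((le_max_right _ _).trans hp1)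
        rw [neg_neg] at this
        rw [this, heq]
        apply Complex.ext <;> simp
  obtain ⟨U, hU, hKU, C, hC⟩ := exists_isOpen_bounded_of_meromorphicOrderAt_nonneg
    (f := barnesRatio q ((q : ℂ) ^ c) ((q : ℂ) ^ d) ((q : ℂ) ^ a)
        ((q : ℂ) ^ b) ((q : ℂ) ^ e) ((q : ℂ) ^ f))
    (isCompact_closedBall (0 : ℂ) (q ^ μ))
    (fun z _ => meromorphicAt_barnesRatio hq0 hq1 _ _ _ _ _ _ z) (fun t ht => by
      by_cases h0 : t = 0
      · have h1 : ∀ x : ℂ, qPochInf (x * t) q ≠ 0 := fun x => by simp [h0, qPochInf_zero]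
        exact (analyticAt_barnesRatio hq0 hq1 _ _ _ _ _ _ (h1 _) (h1 _)
          (h1 _)).meromorphicOrderAt_nonneg
      · exact hord t h0 (by simpa using ht))
  obtain ⟨δ, hδ, hδU⟩ := (isCompact_closedBall (0 : ℂ) (q ^ μ)).exists_thickening_subset_open hU hKU
  rw [thickening_closedBall hδ (by positivity)] at hδU
  have hcont : ContinuousAt (fun u : ℝ => q ^ u) μ :=
    Real.continuousAt_const_rpow hq0.ne'
  obtain ⟨u, hu1, hu2⟩ := ((hcont.eventually (gt_mem_nhds (show q ^ μ < δ + q ^ μ by linarith))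
    |>.filter_mono (nhdsWithin_le_nhds (s := Set.Iio μ))).and self_mem_nhdsWithin).exists
  refine ⟨u, C, lt_of_lt_of_le hu2 (min_le_left _ _), lt_of_lt_of_le hu2 (min_le_right _ _),
    fun s hs => hC _ (hδU ?_)⟩
  rw [mem_ball_zero_iff, Complex.norm_cpow_eq_rpow_re_of_pos hq0]
  exact (Real.rpow_lt_rpow_of_exponent_gt hq0 hq1 hs).trans hu1

end bounds

/-! ### Bounds for the trigonometric factor -/

section kernel

open MeasureTheory

lemma norm_sin_sq (z : ℂ) :
    ‖Complex.sin z‖ ^ 2 = Real.sin z.re ^ 2 + Real.sinh z.im ^ 2 := by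
  have h := Complex.sin_eq z
  rw [← Complex.ofReal_sin, ← Complex.ofReal_cosh, ← Complex.ofReal_cos, ← Complex.ofReal_sinh] at h
  rw [h, Complex.sq_norm, ← Complex.ofReal_mul, ← Complex.ofReal_mul, Complex.normSq_add_mul_I]
  have h1 := Real.cosh_sq z.im
  have h2 := Real.sin_sq_add_cos_sq z.re
  linear_combination Real.sin z.re ^ 2 * h1 + Real.sinh z.im ^ 2 * h2

lemma sq_le_sinh_sq (y : ℝ) : y ^ 2 ≤ Real.sinh y ^ 2 := by
  rcases le_total 0 y with h | h
  · exact pow_le_pow_left₀ h (Real.self_le_sinh_iff.2 h) 2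
  · rw [← neg_sq, ← neg_sq (Real.sinh y), ← Real.sinh_neg]
    exact pow_le_pow_left₀ (neg_nonneg.2 h) (Real.self_le_sinh_iff.2 (neg_nonneg.2 h)) 2

lemma inv_norm_sin_sq_le_of_one_le {z : ℂ} (hz : 1 ≤ |z.im|) :
    (‖Complex.sin z‖ ^ 2)⁻¹ ≤ 2 * (1 + z.im ^ 2)⁻¹ := by
  have h1 : 1 ≤ z.im ^ 2 := (one_le_sq_iff_one_le_abs _).2 hz
  have h2 := sq_le_sinh_sq z.im
  have h3 : (1 + z.im ^ 2) / 2 ≤ ‖Complex.sin z‖ ^ 2 := by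
    rw [norm_sin_sq]; nlinarith [sq_nonneg (Real.sin z.re)]
  calc (‖Complex.sin z‖ ^ 2)⁻¹ ≤ ((1 + z.im ^ 2) / 2)⁻¹ := inv_anti₀ (by positivity) h3
    _ = 2 * (1 + z.im ^ 2)⁻¹ := by rw [inv_div, div_eq_mul_inv]

lemma inv_norm_sin_sq_le {z : ℂ} (hz : Real.sin z.re ≠ 0) :
    (‖Complex.sin z‖ ^ 2)⁻¹ ≤ (Real.sin z.re ^ 2)⁻¹ * (1 + z.im ^ 2)⁻¹ := by
  have h0 : 0 < Real.sin z.re ^ 2 := by positivity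
  have h1 := Real.sin_sq_le_one z.re
  have h2 := sq_le_sinh_sq z.im
  rw [← mul_inv]
  refine inv_anti₀ (by positivity) ?_
  rw [norm_sin_sq]
  nlinarith [sq_nonneg z.im]

/-- The majorant for `sinKernel c d s` as a function of `Im s`. -/
noncomputable def kernelBound (c d : ℂ) (t : ℝ) : ℝ :=
  (1 + (Real.pi * (c.im - t)) ^ 2)⁻¹ + (1 + (Real.pi * (d.im - t)) ^ 2)⁻¹

lemma kernelBound_nonneg (c d : ℂ) (t : ℝ) : 0 ≤ kernelBound c d t := by
  unfold kernelBound; positivity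

lemma integrable_kernelBound (c d : ℂ) : Integrable (kernelBound c d) := by
  have h : ∀ y : ℝ, Integrable fun t : ℝ => (1 + (Real.pi * (y - t)) ^ 2)⁻¹ := fun y =>
    (integrable_inv_one_add_sq.comp_mul_left' Real.pi_ne_zero).comp_sub_left y
  exact (h _).add (h _)

lemma tendsto_kernelBound (c d : ℂ) :
    Tendsto (kernelBound c d) (Bornology.cobounded ℝ) (𝓝 0) := by
  have h : ∀ y : ℝ, Tendsto (fun t : ℝ => (1 + (Real.pi * (y - t)) ^ 2)⁻¹)
      (Bornology.cobounded ℝ) (𝓝 0) := by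
    intro y
    refine tendsto_inv_atTop_zero.comp (tendsto_atTop_add_const_left _ _ ?_)
    have h1 : Tendsto (fun t : ℝ => ‖t - y‖) (Bornology.cobounded ℝ) atTop :=
      tendsto_atTop_mono (fun t => norm_sub_norm_le t y)
        (tendsto_atTop_add_const_right _ (-‖y‖) tendsto_norm_cobounded_atTop)
    have h2 := ((tendsto_pow_atTop two_ne_zero).comp h1).const_mul_atTop
      (show (0 : ℝ) < Real.pi ^ 2 by positivity)
    refine h2.congr fun t => ?_
    simp only [Function.comp, Real.norm_eq_abs, sq_abs]
    ring
  simpa [kernelBound] using! (h c.im).add (h d.im)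

/-- Bounds for the reciprocal squares of the two sines give a bound for the reciprocal of
their product. -/
lemma norm_sinKernel_le_of_inv_le {c d s : ℂ} {K : ℝ}
    (hc : (‖Complex.sin (Real.pi * (c - s))‖ ^ 2)⁻¹ ≤
      K * (1 + (Real.pi * (c.im - s.im)) ^ 2)⁻¹)
    (hd : (‖Complex.sin (Real.pi * (d - s))‖ ^ 2)⁻¹ ≤
      K * (1 + (Real.pi * (d.im - s.im)) ^ 2)⁻¹) :
    ‖sinKernel c d s‖ ≤ Real.pi / 2 * K * kernelBound c d s.im := by
  rw [sinKernel, norm_div, norm_mul, Complex.norm_real, Real.norm_of_nonneg Real.pi_pos.le,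
    kernelBound, div_eq_mul_inv, mul_inv]
  rw [← inv_pow] at hc hd
  have h := two_mul_le_add_sq (‖Complex.sin (Real.pi * (c - s))‖⁻¹)
    (‖Complex.sin (Real.pi * (d - s))‖⁻¹)
  nlinarith [Real.pi_pos]

lemma im_pi_mul_sub (c s : ℂ) : ((Real.pi : ℂ) * (c - s)).im = Real.pi * (c.im - s.im) := by
  rw [Complex.im_ofReal_mul, Complex.sub_im]

lemma re_pi_mul_sub (c s : ℂ) : ((Real.pi : ℂ) * (c - s)).re = Real.pi * (c.re - s.re) := by
  rw [Complex.re_ofReal_mul, Complex.sub_re]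

lemma norm_sinKernel_le (c d : ℂ) {s : ℂ} (hs : |c.im| + |d.im| + 1 ≤ |s.im|) :
    ‖sinKernel c d s‖ ≤ Real.pi * kernelBound c d s.im := by
  have h : ∀ c' : ℂ, |c'.im| ≤ |c.im| + |d.im| → (‖Complex.sin (Real.pi * (c' - s))‖ ^ 2)⁻¹ ≤
      2 * (1 + (Real.pi * (c'.im - s.im)) ^ 2)⁻¹ := by
    intro c' hc'
    rw [← im_pi_mul_sub]
    refine inv_norm_sin_sq_le_of_one_le ?_
    rw [im_pi_mul_sub, abs_mul, abs_of_pos Real.pi_pos]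
    have h1 : 1 ≤ |c'.im - s.im| := by
      have := abs_sub_abs_le_abs_sub s.im c'.im
      rw [abs_sub_comm] at this
      linarith
    nlinarith [Real.pi_gt_three]
  refine (norm_sinKernel_le_of_inv_le (h c (by linarith [abs_nonneg d.im]))
    (h d (by linarith [abs_nonneg c.im]))).trans_eq ?_
  ring

/-- On the vertical lines through `x + j`, `j ∈ ℕ`, the trigonometric factor has one and the same
integrable majorant. -/
lemma exists_norm_sinKernel_le {c d : ℂ} {x : ℝ} (hc : Real.sin (Real.pi * (c.re - x)) ≠ 0)
    (hd : Real.sin (Real.pi * (d.re - x)) ≠ 0) :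
    ∃ C : ℝ, ∀ (j : ℕ) (s : ℂ), s.re = x + j → ‖sinKernel c d s‖ ≤ C * kernelBound c d s.im := by
  set K := max (Real.sin (Real.pi * (c.re - x)) ^ 2)⁻¹ (Real.sin (Real.pi * (d.re - x)) ^ 2)⁻¹
  have h : ∀ (c' : ℂ) (j : ℕ) (s : ℂ), s.re = x + j → Real.sin (Real.pi * (c'.re - x)) ≠ 0 →
      (Real.sin (Real.pi * (c'.re - x)) ^ 2)⁻¹ ≤ K →
      (‖Complex.sin (Real.pi * (c' - s))‖ ^ 2)⁻¹ ≤
        K * (1 + (Real.pi * (c'.im - s.im)) ^ 2)⁻¹ := by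
    intro c' j s hs h0 hK
    have h1 : Real.sin (Real.pi * (c'.re - s.re)) ^ 2 = Real.sin (Real.pi * (c'.re - x)) ^ 2 := by
      rw [hs, show Real.pi * (c'.re - (x + j)) = Real.pi * (c'.re - x) - j * Real.pi by ring,
        Real.sin_sub_nat_mul_pi, mul_pow, ← pow_mul, mul_comm j 2, pow_mul]
      simp
    have h2 : Real.sin (Real.pi * (c'.re - s.re)) ≠ 0 := by
      rw [← sq_eq_zero_iff.ne, h1]; positivity
    rw [← re_pi_mul_sub] at h2
    have h3 := inv_norm_sin_sq_le h2
    rw [re_pi_mul_sub, im_pi_mul_sub, h1] at h3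
    exact h3.trans (by gcongr)
  exact ⟨Real.pi / 2 * K, fun j s hs => norm_sinKernel_le_of_inv_le
    (h c j s hs hc (le_max_left _ _)) (h d j s hs hd (le_max_right _ _))⟩

end kernel

/-! ### Moving the contour to the right -/

section shift

open MeasureTheory

/-- A meromorphic function has finitely many poles in a compact set. -/
lemma finite_setOf_meromorphicOrderAt_neg {F : ℂ → ℂ} (hF : ∀ z, MeromorphicAt F z) {K : Set ℂ}
    (hK : IsCompact K) : {z ∈ K | meromorphicOrderAt F z < 0}.Finite := by
  refine hK.induction_on (p := fun s => {z ∈ s | meromorphicOrderAt F z < 0}.Finite) (by simp)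
    ?_ ?_ ?_
  · exact fun s t hst ht => ht.subset fun z hz => ⟨hst hz.1, hz.2⟩
  · intro s t hs ht
    refine (hs.union ht).subset ?_
    rintro z ⟨h1 | h1, h2⟩
    · exact .inl ⟨h1, h2⟩
    · exact .inr ⟨h1, h2⟩
  · intro z _
    refine ⟨{w | w ≠ z → AnalyticAt ℂ F w}, nhdsWithin_le_nhds
      (eventually_nhdsWithin_iff.1 (hF z).eventually_analyticAt),
      (Set.finite_singleton z).subset ?_⟩
    rintro w ⟨h1, h2⟩
    by_contra hwz
    exact h2.not_ge (h1 hwz).meromorphicOrderAt_nonneg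

/-- A meromorphic function bounded near a point has no pole there. -/
lemma meromorphicOrderAt_nonneg_of_bounded {F : ℂ → ℂ} {z : ℂ} (hF : MeromorphicAt F z) {C : ℝ}
    (h : ∀ᶠ s in 𝓝[≠] z, ‖F s‖ ≤ C) : 0 ≤ meromorphicOrderAt F z := by
  by_contra! hneg
  have h1 := tendsto_norm_cobounded_atTop.comp
    ((tendsto_cobounded_iff_meromorphicOrderAt_neg hF).2 hneg)
  obtain ⟨s, hs1, hs2⟩ := (h.and (h1.eventually (eventually_gt_atTop C))).exists
  exact hs2.not_ge hs1

/-- At a point that is not a pole the residue vanishes. -/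
lemma eq_zero_of_eventually_eq_principalPart {F g : ℂ → ℂ} {p r : ℂ} (hF : MeromorphicAt F p)
    (hord : 0 ≤ meromorphicOrderAt F p) (hg : AnalyticAt ℂ g p)
    (h : ∀ᶠ s in 𝓝[≠] p, F s = principalPart (fun _ => r) 0 p s + g s) : r = 0 := by
  obtain ⟨L, hL⟩ := tendsto_nhds_of_meromorphicOrderAt_nonneg hF hord
  have h0 : Tendsto (fun s => s - p) (𝓝[≠] p) (𝓝 0) := by
    have : ContinuousAt (fun s => s - p) p := by fun_prop
    simpa using this.tendsto.mono_left nhdsWithin_le_nhds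
  have h1 := h0.mul (hL.sub (hg.continuousAt.tendsto.mono_left nhdsWithin_le_nhds))
  rw [zero_mul] at h1
  refine tendsto_nhds_unique (tendsto_const_nhds.congr' ?_) h1
  filter_upwards [h, self_mem_nhdsWithin] with s hs hsp
  rw [hs]
  have := sub_ne_zero.2 hsp
  simp only [principalPart, zero_add, Finset.range_one, Finset.sum_singleton, pow_one]
  field_simp
  ring

lemma re_le_of_mem_decreasingSeq {q : ℝ} {x z : ℂ} (hz : z ∈ decreasingSeq q x) :
    z.re ≤ -x.re := by
  obtain ⟨n, m, rfl⟩ := hz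
  have h1 : 2 * (Real.pi : ℂ) * Complex.I * m / (Real.log q : ℂ) =
      ((2 * Real.pi * m / Real.log q : ℝ) : ℂ) * Complex.I := by
    push_cast; ring
  rw [h1]
  simp

lemma disjoint_increasingSeq {c d : ℂ} (hsin : Complex.sin (Real.pi * (c - d)) ≠ 0) :
    Disjoint (increasingSeq c) (increasingSeq d) := by
  rw [Set.disjoint_left]
  rintro z ⟨k, rfl⟩ ⟨j, hj⟩
  refine hsin ((sin_pi_mul_eq_zero_iff _).2 ⟨j - k, ?_⟩)
  push_cast
  linear_combination hj

lemma norm_barnesIntegrand {q : ℝ} (hq0 : 0 < q) (a b c d e f s : ℂ) :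
    ‖barnesIntegrand q a b c d e f s‖ = q ^ s.re *
      ‖barnesRatio q ((q : ℂ) ^ c) ((q : ℂ) ^ d) ((q : ℂ) ^ a) ((q : ℂ) ^ b) ((q : ℂ) ^ e)
        ((q : ℂ) ^ f) ((q : ℂ) ^ s)‖ * ‖sinKernel c d s‖ := by
  rw [barnesIntegrand_eq hq0, barnesTerm_eq_mul_barnesRatio, norm_mul, norm_mul,
    Complex.norm_cpow_eq_rpow_re_of_pos hq0]

/-- The residue of the Barnes integrand at `c + k`. -/
noncomputable def barnesResidue (q : ℝ) (a b c d e f : ℂ) (k : ℕ) : ℂ :=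
  -(barnesTerm q ((q : ℂ) ^ c) ((q : ℂ) ^ d) ((q : ℂ) ^ a) ((q : ℂ) ^ b) ((q : ℂ) ^ e)
    ((q : ℂ) ^ f) ((q : ℂ) ^ (c + k)) / Complex.sin (Real.pi * (d - c)))

/-- A choice of Laurent tails with the known residues on the increasing sequences, and with
vanishing residue where there is no pole. -/
lemma exists_laurentTail {q : ℝ} (hq0 : 0 < q) (hq1 : q < 1) {a b c d e f : ℂ}
    (hsin : Complex.sin (Real.pi * (c - d)) ≠ 0)
    (hdisj : Disjoint (increasingSeq c ∪ increasingSeq d)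
      (decreasingSeq q a ∪ decreasingSeq q b ∪ decreasingSeq q f)) (p : ℂ) :
    ∃ (κ : ℕ → ℂ) (n : ℕ),
      (∃ g : ℂ → ℂ, AnalyticAt ℂ g p ∧
        ∀ᶠ s in 𝓝[≠] p, barnesIntegrand q a b c d e f s = principalPart κ n p s + g s) ∧
      (0 ≤ meromorphicOrderAt (barnesIntegrand q a b c d e f) p → κ 0 = 0) ∧
      (∀ k : ℕ, p = c + k → κ 0 = barnesResidue q a b c d e f k) ∧
      (∀ k : ℕ, p = d + k → κ 0 = barnesResidue q a b d c e f k) := by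
  have hF := meromorphicAt_barnesIntegrand hq0 hq1 a b c d e f p
  have hsin' : Complex.sin (Real.pi * (d - c)) ≠ 0 := by
    rwa [← neg_sub, mul_neg, Complex.sin_neg, neg_ne_zero]
  have hdc := Set.disjoint_left.1 (disjoint_increasingSeq hsin)
  have hinc := Set.disjoint_left.1 hdisj
  by_cases hpc : p ∈ increasingSeq c
  · have hp := hinc (.inl hpc)
    simp only [Set.mem_union, not_or] at hp
    obtain ⟨k, rfl⟩ := hpc
    obtain ⟨g, hg, h⟩ := exists_principalPart_barnesIntegrand hq0 hq1 a b c d e f hsin k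
      hp.1.1 hp.1.2 hp.2
    refine ⟨_, 0, ⟨g, hg, h⟩, fun h0 => eq_zero_of_eventually_eq_principalPart hF h0 hg h,
      fun j hj => ?_, fun j hj => (hdc ⟨k, rfl⟩ ⟨j, hj⟩).elim⟩
    obtain rfl : k = j := by simpa using hj
    rfl
  by_cases hpd : p ∈ increasingSeq d
  · have hp := hinc (.inr hpd)
    simp only [Set.mem_union, not_or] at hp
    obtain ⟨k, rfl⟩ := hpd
    obtain ⟨g, hg, h⟩ := exists_principalPart_barnesIntegrand hq0 hq1 a b d c e f hsin' k
      hp.1.1 hp.1.2 hp.2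
    simp only [barnesIntegrand_swap q a b d c] at h
    refine ⟨_, 0, ⟨g, hg, h⟩, fun h0 => eq_zero_of_eventually_eq_principalPart hF h0 hg h,
      fun j hj => (hpc ⟨j, hj⟩).elim, fun j hj => ?_⟩
    obtain rfl : k = j := by simpa using hj
    rfl
  by_cases h0 : 0 ≤ meromorphicOrderAt (barnesIntegrand q a b c d e f) p
  · obtain ⟨g, hg, h⟩ := hF.meromorphicOrderAt_nonneg_iff.1 h0
    exact ⟨fun _ => 0, 0, ⟨g, hg, h.mono fun s hs => by simp [principalPart, hs]⟩, fun _ => rfl,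
      fun j hj => (hpc ⟨j, hj⟩).elim, fun j hj => (hpd ⟨j, hj⟩).elim⟩
  · obtain ⟨κ, n, g, hg, h⟩ := exists_principalPart hF
    exact ⟨κ, n, ⟨g, hg, h⟩, fun h1 => (h0 h1).elim,
      fun j hj => (hpc ⟨j, hj⟩).elim, fun j hj => (hpd ⟨j, hj⟩).elim⟩

/-- The decay of the integrand on a half-plane containing both ends of the contour. -/
lemma norm_barnesIntegrand_le {q : ℝ} (hq0 : 0 < q) (hq1 : q < 1)
    {a b c d e f : ℂ} {u C : ℝ} (hC : ∀ s : ℂ, u < s.re →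
      ‖barnesRatio q ((q : ℂ) ^ c) ((q : ℂ) ^ d) ((q : ℂ) ^ a) ((q : ℂ) ^ b) ((q : ℂ) ^ e)
        ((q : ℂ) ^ f) ((q : ℂ) ^ s)‖ ≤ C) {s : ℂ} (hs : u < s.re)
    (him : |c.im| + |d.im| + 1 ≤ |s.im|) :
    ‖barnesIntegrand q a b c d e f s‖ ≤ q ^ u * C * Real.pi * kernelBound c d s.im := by
  rw [norm_barnesIntegrand hq0, mul_assoc _ Real.pi]
  have h1 := hC s hs
  have h2 := norm_sinKernel_le c d him
  have h3 : q ^ s.re ≤ q ^ u := (Real.rpow_lt_rpow_of_exponent_gt hq0 hq1 hs).le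
  have h4 : 0 ≤ C := (norm_nonneg _).trans h1
  gcongr

/-- Moving the contour to the line `Re s = N` picks up the residues on the increasing sequences to
the left of this line. -/
lemma tendsto_integral_sub_verticalLine {q : ℝ} (hq0 : 0 < q) (hq1 : q < 1)
    {a b c d e f : ℂ} (hsin : Complex.sin (Real.pi * (c - d)) ≠ 0)
    (hdisj : Disjoint (increasingSeq c ∪ increasingSeq d)
      (decreasingSeq q a ∪ decreasingSeq q b ∪ decreasingSeq q f)) {γ : ℝ → ℂ}
    (hγ : IsBarnesContour (barnesIntegrand q a b c d e f)
      (increasingSeq c ∪ increasingSeq d)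
      (decreasingSeq q a ∪ decreasingSeq q b ∪ decreasingSeq q f) γ) {σ τ u C : ℝ}
    (hσ : ∀ᶠ t in atTop, γ t = (σ : ℂ) + (t : ℂ) * Complex.I)
    (hτ : ∀ᶠ t in atTop, γ (-t) = (τ : ℂ) - (t : ℂ) * Complex.I) (huσ : u < σ) (huτ : u < τ)
    (hF : ∀ s : ℂ, u < s.re → |c.im| + |d.im| + 1 ≤ |s.im| →
      ‖barnesIntegrand q a b c d e f s‖ ≤ C * kernelBound c d s.im) {N : ℝ} (hNu : u < N)
    (hNdec : ∀ z ∈ decreasingSeq q a ∪ decreasingSeq q b ∪ decreasingSeq q f, z.re < N)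
    (hNinc : ∀ z ∈ increasingSeq c ∪ increasingSeq d, z.re ≠ N) :
    (∀ t₁ t₂, IntervalIntegrable (fun t => barnesIntegrand q a b c d e f (γ t) * deriv γ t)
      volume t₁ t₂) ∧
    Tendsto (fun R : ℝ => (∫ t in (-R)..R, barnesIntegrand q a b c d e f (γ t) * deriv γ t) -
      ∫ t in (-R)..R, barnesIntegrand q a b c d e f (verticalLine N t) *
        deriv (verticalLine N) t) atTop
      (𝓝 (-(2 * (Real.pi : ℂ) * Complex.I) *
        ((∑ k ∈ Finset.range ⌈N - c.re⌉₊, barnesResidue q a b c d e f k) +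
          ∑ k ∈ Finset.range ⌈N - d.re⌉₊, barnesResidue q a b d c e f k))) := by
  classical
  set F := barnesIntegrand q a b c d e f with hFdef
  set inc := increasingSeq c ∪ increasingSeq d with hinc
  set dec := decreasingSeq q a ∪ decreasingSeq q b ∪ decreasingSeq q f with hdec
  have hmer : ∀ z, MeromorphicAt F z := meromorphicAt_barnesIntegrand hq0 hq1 a b c d e f
  -- a number exceeding all coordinates that occur
  obtain ⟨T₁, hT₁⟩ := eventually_atTop.1 hσ
  obtain ⟨T₂, hT₂⟩ := eventually_atTop.1 hτ
  obtain ⟨D₀, hD₀⟩ := (isCompact_Icc (a := -T₂) (b := T₁)).bddAbove_image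
    hγ.upward.continuous.norm.continuousOn
  set D := |D₀| + |u| + |σ| + |τ| + |N| + |c.re| + |d.re| + (|c.im| + |d.im| + 1) with hD
  have hDpos : |D₀| < D ∧ |u| < D ∧ |σ| < D ∧ |τ| < D ∧ |N| < D ∧ |c.re| < D ∧ |d.re| < D ∧
      |c.im| + |d.im| + 1 ≤ D := by
    have := abs_nonneg D₀; have := abs_nonneg u; have := abs_nonneg σ; have := abs_nonneg τ
    have := abs_nonneg N; have := abs_nonneg c.re; have := abs_nonneg d.re
    have := abs_nonneg c.im; have := abs_nonneg d.im
    refine ⟨?_, ?_, ?_, ?_, ?_, ?_, ?_, ?_⟩ <;> linarith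
  obtain ⟨hDD₀, hDu, hDσ, hDτ, hDN, hDc, hDd, hDim⟩ := hDpos
  set U : Set ℂ := {z | u < z.re ∧ z.re < D} with hU
  set V : Set ℂ := {z | (-D < z.re ∧ z.re < D) ∧ -D < z.im ∧ z.im < D} with hV
  have hUo : IsOpen U := (isOpen_lt continuous_const Complex.continuous_re).inter
    (isOpen_lt Complex.continuous_re continuous_const)
  have hVo : IsOpen V := ((isOpen_lt continuous_const Complex.continuous_re).inter
    (isOpen_lt Complex.continuous_re continuous_const)).inter
      ((isOpen_lt continuous_const Complex.continuous_im).inter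
        (isOpen_lt Complex.continuous_im continuous_const))
  have hUc : Convex ℝ U := (convex_halfSpace_re_gt u).inter (convex_halfSpace_re_lt D)
  have hVc : Convex ℝ V := ((convex_halfSpace_re_gt _).inter (convex_halfSpace_re_lt D)).inter
    ((convex_halfSpace_im_gt _).inter (convex_halfSpace_im_lt D))
  set K : Set ℂ := Set.Icc (-D) D ×ℂ Set.Icc (-D) D
  have hKfin := finite_setOf_meromorphicOrderAt_neg hmer
    ((isCompact_Icc (a := -D) (b := D)).reProdIm (isCompact_Icc (a := -D) (b := D)))
  set P : Finset ℂ := hKfin.toFinset with hP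
  have hmemP : ∀ z, z ∈ P ↔ z ∈ K ∧ meromorphicOrderAt F z < 0 := fun z => by
    rw [hP, Set.Finite.mem_toFinset]; rfl
  -- the half-plane contains no poles far from the real axis
  have hfar : ∀ z : ℂ, u < z.re → meromorphicOrderAt F z < 0 → |z.im| ≤ |c.im| + |d.im| + 1 := by
    intro z hz hneg
    by_contra! hcon
    refine hneg.not_ge (meromorphicOrderAt_nonneg_of_bounded (hmer z) (C := |C| * 2) ?_)
    refine nhdsWithin_le_nhds ?_
    filter_upwards [Complex.continuous_re.continuousAt.eventually (lt_mem_nhds hz),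
      Complex.continuous_im.abs.continuousAt.eventually (lt_mem_nhds hcon)] with s h1 h2
    refine (hF s h1 h2.le).trans ?_
    have h3 : kernelBound c d s.im ≤ 2 := by
      have : ∀ y : ℝ, (1 + y ^ 2)⁻¹ ≤ 1 := fun y => inv_le_one_of_one_le₀ (by nlinarith)
      unfold kernelBound
      linarith [this (Real.pi * (c.im - s.im)), this (Real.pi * (d.im - s.im))]
    exact (mul_le_mul_of_nonneg_right (le_abs_self C) (kernelBound_nonneg _ _ _)).trans
      (mul_le_mul_of_nonneg_left h3 (abs_nonneg C))
  have hpoles : ∀ z ∈ U ∪ V, meromorphicOrderAt F z < 0 → z ∈ P := by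
    intro z hz hneg
    refine (hmemP z).2 ⟨?_, hneg⟩
    rw [Complex.mem_reProdIm, Set.mem_Icc, Set.mem_Icc]
    rcases hz with ⟨h1, h2⟩ | ⟨⟨h1, h2⟩, h3, h4⟩
    · have h5 := abs_le.1 ((hfar z h1 hneg).trans hDim)
      exact ⟨⟨(abs_lt.1 hDu).1.le.trans h1.le, h2.le⟩, h5⟩
    · exact ⟨⟨h1.le, h2.le⟩, h3.le, h4.le⟩
  choose κ n hκ hκ0 hκc hκd using fun p => exists_laurentTail (e := e) hq0 hq1 hsin hdisj p
  obtain ⟨H, h, hLD⟩ := exists_isLaurentDecomposition (F := F) (Ω := U ∪ V)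
    (fun h hh => exists_primitive_union hUo hVo hUc hVc hh) hmer P hpoles κ n fun p _ => hκ p
  have hside : ∀ p, meromorphicOrderAt F p < 0 →
      (p ∈ inc ∧ LiesRightOf p γ) ∨ (p ∈ dec ∧ LiesLeftOf p γ) := by
    intro p hp
    rcases mem_of_meromorphicOrderAt_neg hq0 hq1 a b c d e f hsin hp with h | h
    · exact .inl ⟨h, hγ.right p h hp⟩
    · exact .inr ⟨h, hγ.left p h hp⟩
  have hγΩ : ∀ t, γ t ∈ U ∪ V := by
    intro t
    by_cases h1 : T₁ ≤ t
    · left; rw [hT₁ t h1]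
      exact ⟨by simpa using huσ, by simpa using (abs_lt.1 hDσ).2⟩
    by_cases h2 : T₂ ≤ -t
    · left
      have := hT₂ _ h2
      rw [neg_neg] at this
      rw [this]
      exact ⟨by simpa using huτ, by simpa using (abs_lt.1 hDτ).2⟩
    · right
      have h3 : ‖γ t‖ < D := (hD₀ ⟨t, ⟨by linarith, by linarith⟩, rfl⟩).trans_lt
        ((le_abs_self _).trans_lt hDD₀)
      exact ⟨abs_lt.1 ((Complex.abs_re_le_norm _).trans_lt h3),
        abs_lt.1 ((Complex.abs_im_le_norm _).trans_lt h3)⟩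
  have hγP : ∀ p ∈ P, ∀ t, γ t ≠ p := by
    intro p hp
    rcases hside p ((hmemP p).1 hp).2 with h | h
    · exact h.2.1
    · exact h.2.1
  have hreN : ∀ p ∈ P, p.re ≠ N := by
    intro p hp
    rcases hside p ((hmemP p).1 hp).2 with h | h
    · exact hNinc p h.1
    · exact (hNdec p h.1).ne
  have hdecay : ∀ ε > 0, ∃ T : ℝ, ∀ s : ℂ, u < s.re → s.re < D → T < |s.im| → ‖F s‖ ≤ ε := by
    intro ε hε
    have h1 := (tendsto_kernelBound c d).const_mul C
    rw [mul_zero] at h1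
    obtain ⟨T, -, hT⟩ := (Filter.hasBasis_cobounded_norm (E := ℝ)).eventually_iff.1
      (h1.eventually (gt_mem_nhds hε))
    refine ⟨max T (|c.im| + |d.im| + 1), fun s h2 _ h3 => (hF s h2 ?_).trans ?_⟩
    · exact ((le_max_right _ _).trans_lt h3).le
    · exact (hT (x := s.im) ((le_max_left _ _).trans_lt h3).le).le
  set w : ℂ → ℂ := fun p => if LiesLeftOf p γ then Real.pi * Complex.I
    else -(Real.pi * Complex.I) with hw
  set w' : ℂ → ℂ := fun p => if p.re < N then Real.pi * Complex.I
    else -(Real.pi * Complex.I) with hw'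
  have hlim := tendsto_integral_sub_integral hLD (u := u) (v := D)
    (fun z h1 h2 => .inl ⟨h1, h2⟩) hdecay hγ.upward hγΩ hγP
    (isUpwardContour_verticalLine N)
    (fun t => .inl ⟨by rwa [verticalLine_re], by rw [verticalLine_re]; exact (abs_lt.1 hDN).2⟩)
    (fun p hp t ht => hreN p hp (by rw [← ht, verticalLine_re]))
    (by
      filter_upwards [hσ, hτ] with t h1 h2
      rw [h1, h2]
      simpa using ⟨⟨huσ, (abs_lt.1 hDσ).2⟩, huτ, (abs_lt.1 hDτ).2⟩)
    (.of_forall fun t => by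
      simpa only [verticalLine_re, and_self] using ⟨hNu, (abs_lt.1 hDN).2⟩)
    (w := w) (w' := w')
    (fun p hp => by
      rcases hside p ((hmemP p).1 hp).2 with h | h
      · simp only [hw, if_neg (not_liesLeftOf_of_liesRightOf h.2)]
        exact h.2.2
      · simp only [hw, if_pos h.2]
        exact h.2.2)
    (fun p hp => by
      by_cases h : p.re < N
      · simp only [hw', if_pos h]
        exact (liesLeftOf_verticalLine h).2
      · simp only [hw', if_neg h]
        exact (liesRightOf_verticalLine (lt_of_le_of_ne (not_lt.1 h) (hreN p hp).symm)).2)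
  refine ⟨hLD.intervalIntegrable hγ.upward hγΩ hγP, ?_⟩
  convert hlim using 2
  -- evaluation of the sum of the residues
  set S₁ := (Finset.range ⌈N - c.re⌉₊).image fun k : ℕ => c + (k : ℂ) with hS₁
  set S₂ := (Finset.range ⌈N - d.re⌉₊).image fun k : ℕ => d + (k : ℂ) with hS₂
  have hinj : ∀ c : ℂ, Function.Injective fun k : ℕ => c + (k : ℂ) := fun c k j hkj => by
    simpa using hkj
  have hS₁₂ : Disjoint S₁ S₂ := by
    rw [Finset.disjoint_left]
    intro z h1 h2
    obtain ⟨k, -, rfl⟩ := Finset.mem_image.1 h1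
    obtain ⟨j, -, hj⟩ := Finset.mem_image.1 h2
    exact Set.disjoint_left.1 (disjoint_increasingSeq hsin) ⟨k, rfl⟩ ⟨j, hj.symm⟩
  have hsum : (∑ k ∈ Finset.range ⌈N - c.re⌉₊, barnesResidue q a b c d e f k) +
      ∑ k ∈ Finset.range ⌈N - d.re⌉₊, barnesResidue q a b d c e f k =
        ∑ p ∈ S₁ ∪ S₂, κ p 0 := by
    rw [Finset.sum_union hS₁₂, hS₁, hS₂, Finset.sum_image (hinj c).injOn,
      Finset.sum_image (hinj d).injOn]
    congr 1
    · exact Finset.sum_congr rfl fun k _ => (hκc _ k rfl).symm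
    · exact Finset.sum_congr rfl fun k _ => (hκd _ k rfl).symm
  have hmemS : ∀ z, z ∈ S₁ ∪ S₂ ↔ z ∈ inc ∧ z.re < N := by
    intro z
    simp only [hS₁, hS₂, Finset.mem_union, Finset.mem_image, Finset.mem_range, Nat.lt_ceil]
    constructor
    · rintro (⟨k, hk, rfl⟩ | ⟨k, hk, rfl⟩)
      · exact ⟨.inl ⟨k, rfl⟩, by simp; linarith⟩
      · exact ⟨.inr ⟨k, rfl⟩, by simp; linarith⟩
    · rintro ⟨⟨k, rfl⟩ | ⟨k, rfl⟩, h⟩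
      · exact .inl ⟨k, by simp at h; linarith, rfl⟩
      · exact .inr ⟨k, by simp at h; linarith, rfl⟩
  have hSK : ∀ z ∈ S₁ ∪ S₂, z ∈ K := by
    intro z hz
    obtain ⟨h1, h2⟩ := (hmemS z).1 hz
    have hN' := (abs_lt.1 hDN).2
    have := abs_nonneg c.im; have := abs_nonneg d.im
    rw [Complex.mem_reProdIm, Set.mem_Icc, Set.mem_Icc]
    rcases h1 with ⟨k, rfl⟩ | ⟨k, rfl⟩
    · have h3 := abs_le.1 (show |c.im| ≤ D by linarith)
      have h4 := (abs_lt.1 hDc).1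
      have h5 : (0 : ℝ) ≤ k := k.cast_nonneg
      simp only [Complex.add_re, Complex.natCast_re, Complex.add_im, Complex.natCast_im,
        add_zero] at h2 ⊢
      exact ⟨⟨by linarith, by linarith⟩, h3⟩
    · have h3 := abs_le.1 (show |d.im| ≤ D by linarith)
      have h4 := (abs_lt.1 hDd).1
      have h5 : (0 : ℝ) ≤ k := k.cast_nonneg
      simp only [Complex.add_re, Complex.natCast_re, Complex.add_im, Complex.natCast_im,
        add_zero] at h2 ⊢
      exact ⟨⟨by linarith, by linarith⟩, h3⟩
  have hκP : ∀ p ∈ S₁ ∪ S₂, p ∉ P → κ p 0 = 0 := fun p hp hpP =>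
    hκ0 p (not_lt.1 fun hneg => hpP ((hmemP p).2 ⟨hSK p hp, hneg⟩))
  rw [hsum, Finset.mul_sum]
  have e1 : ∑ p ∈ P, κ p 0 * (w p - w' p) = ∑ p ∈ P ∪ (S₁ ∪ S₂), κ p 0 * (w p - w' p) :=
    Finset.sum_subset Finset.subset_union_left fun p hp hpP => by
      rw [hκP p ((Finset.mem_union.1 hp).resolve_left hpP) hpP, zero_mul]
  rw [e1]
  refine Finset.sum_subset_zero_on_sdiff Finset.subset_union_right (fun p hp => ?_) fun p hp => ?_
  · obtain ⟨h1, h2⟩ := Finset.mem_sdiff.1 hp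
    have hpP := (Finset.mem_union.1 h1).resolve_right h2
    rcases hside p ((hmemP p).1 hpP).2 with ⟨h3, h4⟩ | ⟨h3, h4⟩
    · have h5 : ¬ p.re < N := fun h5 => h2 ((hmemS p).2 ⟨h3, h5⟩)
      simp only [hw, hw', if_neg (not_liesLeftOf_of_liesRightOf h4), if_neg h5, sub_self, mul_zero]
    · simp only [hw, hw', if_pos h4, if_pos (hNdec p h3), sub_self, mul_zero]
  · by_cases hpP : p ∈ P
    · obtain ⟨h1, h2⟩ := (hmemS p).1 hp
      rcases hside p ((hmemP p).1 hpP).2 with ⟨h3, h4⟩ | ⟨h3, h4⟩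
      · simp only [hw, hw', if_neg (not_liesLeftOf_of_liesRightOf h4), if_pos h2]
        ring
      · exact (Set.disjoint_left.1 hdisj h1 h3).elim
    · rw [hκP p hp hpP]; ring

end shift

/-! ### Evaluation of the Barnes integral -/

section evaluation

open MeasureTheory

/-- The integrand is absolutely integrable along the contour: it is so on bounded parameter
intervals, and the contour is eventually vertical. -/
lemma integrable_barnesIntegrand_mul_deriv {q : ℝ} (hq0 : 0 < q) (hq1 : q < 1)
    {a b c d e f : ℂ} {γ : ℝ → ℂ} (hγ : IsUpwardContour γ) {σ τ u C : ℝ}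
    (hσ : ∀ᶠ t in atTop, γ t = (σ : ℂ) + (t : ℂ) * Complex.I)
    (hτ : ∀ᶠ t in atTop, γ (-t) = (τ : ℂ) - (t : ℂ) * Complex.I) (huσ : u < σ) (huτ : u < τ)
    (hF : ∀ s : ℂ, u < s.re → |c.im| + |d.im| + 1 ≤ |s.im| →
      ‖barnesIntegrand q a b c d e f s‖ ≤ C * kernelBound c d s.im)
    (hint : ∀ t₁ t₂, IntervalIntegrable
      (fun t => barnesIntegrand q a b c d e f (γ t) * deriv γ t) volume t₁ t₂) :
    Integrable fun t => barnesIntegrand q a b c d e f (γ t) * deriv γ t := by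
  obtain ⟨T₁, hT₁⟩ := eventually_atTop.1 hσ
  obtain ⟨T₂, hT₂⟩ := eventually_atTop.1 hτ
  obtain ⟨M, hM⟩ := hγ.deriv_bounded
  set T := max (max T₁ T₂) (|c.im| + |d.im| + 1) with hT
  have hTpos : 0 ≤ T :=
    (by positivity : (0 : ℝ) ≤ |c.im| + |d.im| + 1).trans (le_max_right _ _)
  have hbd : ∀ t, T ≤ |t| → ‖barnesIntegrand q a b c d e f (γ t) * deriv γ t‖ ≤
      C * kernelBound c d t * M := by
    intro t ht
    have h1 : u < (γ t).re ∧ (γ t).im = t := by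
      rcases le_total 0 t with h0 | h0
      · rw [abs_of_nonneg h0] at ht
        rw [hT₁ t (((le_max_left _ _).trans (le_max_left _ _)).trans ht)]
        simpa using huσ
      · rw [abs_of_nonpos h0] at ht
        have := hT₂ (-t) (((le_max_right _ _).trans (le_max_left _ _)).trans ht)
        rw [neg_neg] at this
        rw [this]
        simpa using huτ
    have h2 := hF (γ t) h1.1 (by rw [h1.2]; exact (le_max_right _ _).trans ht)
    rw [h1.2] at h2
    rw [norm_mul]
    exact mul_le_mul h2 (hM t) (norm_nonneg _) ((norm_nonneg _).trans h2)
  have hmeas : AEStronglyMeasurable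
      (fun t => barnesIntegrand q a b c d e f (γ t) * deriv γ t) volume :=
    (((measurable_barnesIntegrand hq0 hq1 a b c d e f).comp hγ.continuous.measurable).mul
      (measurable_deriv γ)).aestronglyMeasurable
  have h1 : IntegrableOn (fun t => barnesIntegrand q a b c d e f (γ t) * deriv γ t)
      (Set.Ioc (-T) T) :=
    (intervalIntegrable_iff_integrableOn_Ioc_of_le (by linarith)).1 (hint (-T) T)
  have h2 : IntegrableOn (fun t => barnesIntegrand q a b c d e f (γ t) * deriv γ t)
      (Set.Ioc (-T) T)ᶜ := by
    refine Integrable.mono' (((integrable_kernelBound c d).const_mul C).mul_const M).integrableOn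
      hmeas.restrict (ae_restrict_of_forall_mem measurableSet_Ioc.compl fun t ht => hbd t ?_)
    rw [Set.mem_compl_iff, Set.mem_Ioc, not_and_or, not_lt, not_le] at ht
    rcases ht with h | h
    · exact (by linarith : T ≤ -t).trans (neg_le_abs t)
    · exact h.le.trans (le_abs_self t)
  rw [← integrableOn_univ, ← Set.union_compl_self (Set.Ioc (-T) T)]
  exact h1.union h2

/-- The contour integral as the sum of the residues on the right. -/
lemma integral_barnesIntegrand {q : ℝ} (hq0 : 0 < q) (hq1 : q < 1)
    {a b c d e f : ℂ} (hsin : Complex.sin (Real.pi * (c - d)) ≠ 0)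
    (hdisj : Disjoint (increasingSeq c ∪ increasingSeq d)
      (decreasingSeq q a ∪ decreasingSeq q b ∪ decreasingSeq q f)) {γ : ℝ → ℂ}
    (hγ : IsBarnesContour (barnesIntegrand q a b c d e f)
      (increasingSeq c ∪ increasingSeq d)
      (decreasingSeq q a ∪ decreasingSeq q b ∪ decreasingSeq q f) γ)
    (hsc : Summable (barnesResidue q a b c d e f)) (hsd : Summable (barnesResidue q a b d c e f)) :
    Integrable (fun t => barnesIntegrand q a b c d e f (γ t) * deriv γ t) ∧
    ∫ t, barnesIntegrand q a b c d e f (γ t) * deriv γ t = -(2 * (Real.pi : ℂ) * Complex.I) *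
      ((∑' k, barnesResidue q a b c d e f k) + ∑' k, barnesResidue q a b d c e f k) := by
  obtain ⟨σ, hσ⟩ := exists_contour_top hγ.upward
  obtain ⟨τ, hτ⟩ := exists_contour_bot hγ.upward
  obtain ⟨u, C, huσ, huτ, hC⟩ := exists_norm_barnesRatio_le hq0 hq1 hsin hγ hσ hτ
  have hF := fun s hs him => norm_barnesIntegrand_le (s := s) hq0 hq1 hC hs him
  -- the abscissa of the first line avoids the two increasing sequences modulo 1
  obtain ⟨x, hxM, hxc, hxd⟩ : ∃ x : ℝ, |u| + |a.re| + |b.re| + |f.re| < x ∧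
      Real.sin (Real.pi * (c.re - x)) ≠ 0 ∧ Real.sin (Real.pi * (d.re - x)) ≠ 0 := by
    have hcount : ((Set.range fun m : ℤ => c.re - m) ∪ Set.range fun m : ℤ => d.re - m).Countable :=
      (Set.countable_range _).union (Set.countable_range _)
    obtain ⟨x, hx1, hx2⟩ := (hcount.dense_compl ℝ).exists_gt (|u| + |a.re| + |b.re| + |f.re|)
    rw [Set.mem_compl_iff, Set.mem_union, not_or] at hx1
    have hsin0 : ∀ r : ℝ, Real.sin (Real.pi * (r - x)) = 0 → x ∈ Set.range fun m : ℤ => r - m := by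
      intro r hr
      obtain ⟨m, hm⟩ := Real.sin_eq_zero_iff.1 hr
      rw [mul_comm, mul_right_inj' Real.pi_ne_zero] at hm
      exact ⟨m, by simp only [hm]; ring⟩
    exact ⟨x, hx2, fun h => hx1.1 (hsin0 _ h), fun h => hx1.2 (hsin0 _ h)⟩
  have hxu : u < x ∧ -a.re < x ∧ -b.re < x ∧ -f.re < x := by
    have := abs_nonneg u; have := abs_nonneg a.re
    have := abs_nonneg b.re; have := abs_nonneg f.re
    have := le_abs_self u; have := neg_le_abs a.re
    have := neg_le_abs b.re; have := neg_le_abs f.re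
    refine ⟨?_, ?_, ?_, ?_⟩ <;> linarith
  have hshift := fun j : ℕ => tendsto_integral_sub_verticalLine hq0 hq1 hsin hdisj hγ hσ hτ huσ huτ
    hF (N := x + j) (by linarith [hxu.1, (j.cast_nonneg : (0 : ℝ) ≤ j)])
    (by
      have hj : (0 : ℝ) ≤ j := j.cast_nonneg
      rintro z ((hz | hz) | hz) <;> have := re_le_of_mem_decreasingSeq hz <;> linarith)
    (by
      have h : ∀ (r : ℝ) (k : ℕ), Real.sin (Real.pi * (r - x)) ≠ 0 → r + k ≠ x + j := by
        intro r k hr h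
        refine hr (Real.sin_eq_zero_iff.2 ⟨j - k, ?_⟩)
        push_cast
        rw [show r - x = j - k by linarith]
        ring
      rintro z (⟨k, rfl⟩ | ⟨k, rfl⟩)
      · simpa using h c.re k hxc
      · simpa using h d.re k hxd)
  have hint := integrable_barnesIntegrand_mul_deriv hq0 hq1 hγ.upward hσ hτ huσ huτ hF (hshift 0).1
  refine ⟨hint, ?_⟩
  -- the integrals along the lines `Re s = x + j` tend to zero
  obtain ⟨K, hK⟩ := exists_norm_sinKernel_le hxc hxd
  have hC0 : 0 ≤ C := (norm_nonneg _).trans (hC (x : ℂ) (by simpa using hxu.1))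
  have hline : ∀ (j : ℕ) (t : ℝ), ‖barnesIntegrand q a b c d e f (verticalLine (x + j) t) *
      deriv (verticalLine (x + j)) t‖ ≤ q ^ (x + j) * C * (K * kernelBound c d t) := by
    intro j t
    have h1 := hK j (verticalLine (x + j) t) (verticalLine_re _ _)
    rw [verticalLine_im] at h1
    have h2 := hC (verticalLine (x + j) t) (by
      rw [verticalLine_re]; linarith [hxu.1, (j.cast_nonneg : (0 : ℝ) ≤ j)])
    rw [norm_mul, deriv_verticalLine, Complex.norm_I, mul_one, norm_barnesIntegrand hq0,
      verticalLine_re]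
    gcongr
  have hlineint : ∀ j : ℕ, Integrable fun t => barnesIntegrand q a b c d e f
      (verticalLine (x + j) t) * deriv (verticalLine (x + j)) t := by
    intro j
    refine Integrable.mono' (((integrable_kernelBound c d).const_mul K).const_mul _) ?_
      (.of_forall (hline j))
    exact (((measurable_barnesIntegrand hq0 hq1 a b c d e f).comp
      (isUpwardContour_verticalLine _).continuous.measurable).mul
        (measurable_deriv _)).aestronglyMeasurable
  have hlim0 : Tendsto (fun j : ℕ => ∫ t, barnesIntegrand q a b c d e f
      (verticalLine (x + j) t) * deriv (verticalLine (x + j)) t) atTop (𝓝 0) := by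
    refine squeeze_zero_norm (a := fun j : ℕ =>
      q ^ j * (q ^ x * C * (K * ∫ t, kernelBound c d t))) (fun j => ?_) ?_
    · refine (norm_integral_le_of_norm_le
        (((integrable_kernelBound c d).const_mul K).const_mul _)
        (.of_forall (hline j))).trans_eq ?_
      rw [integral_const_mul, integral_const_mul, Real.rpow_add hq0, Real.rpow_natCast]
      ring
    · simpa using (tendsto_pow_atTop_nhds_zero_of_lt_one hq0.le hq1).mul_const
        (q ^ x * C * (K * ∫ t, kernelBound c d t))
  have heq : ∀ j : ℕ, (∫ t, barnesIntegrand q a b c d e f (γ t) * deriv γ t) -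
      (∫ t, barnesIntegrand q a b c d e f (verticalLine (x + j) t) *
        deriv (verticalLine (x + j)) t) = -(2 * (Real.pi : ℂ) * Complex.I) *
        ((∑ k ∈ Finset.range ⌈x + j - c.re⌉₊, barnesResidue q a b c d e f k) +
          ∑ k ∈ Finset.range ⌈x + j - d.re⌉₊, barnesResidue q a b d c e f k) := fun j =>
    tendsto_nhds_unique
      ((intervalIntegral_tendsto_integral hint tendsto_neg_atTop_atBot tendsto_id).sub
        (intervalIntegral_tendsto_integral (hlineint j) tendsto_neg_atTop_atBot tendsto_id))
      (hshift j).2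
  have hceil : ∀ r : ℝ, Tendsto (fun j : ℕ => ⌈x + j - r⌉₊) atTop atTop := fun r => by
    refine tendsto_nat_ceil_atTop.comp ?_
    have := tendsto_atTop_add_const_right _ (x - r) (tendsto_natCast_atTop_atTop (R := ℝ))
    exact this.congr fun j => by ring
  refine tendsto_nhds_unique (tendsto_const_nhds.sub hlim0 |>.congr heq |> fun h => ?_)
    (((hsc.hasSum.tendsto_sum_nat.comp (hceil c.re)).add
      (hsd.hasSum.tendsto_sum_nat.comp (hceil d.re))).const_mul
        (-(2 * (Real.pi : ℂ) * Complex.I)))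
  simpa only [sub_zero] using! h

end evaluation

theorem mainTheorem10 (q : ℝ) (hq0 : 0 < q) (hq1 : q < 1) (a b c d e f : ℂ)
    (hf : ‖(q : ℂ) ^ f‖ < 1) (hcf : ‖(q : ℂ) ^ (c + f)‖ < 1) (hdf : ‖(q : ℂ) ^ (d + f)‖ < 1)
    (hsin : Complex.sin (Real.pi * (c - d)) ≠ 0)
    (hac : ∀ n : ℕ, (q : ℂ) ^ (a + c + n) ≠ 1) (had : ∀ n : ℕ, (q : ℂ) ^ (a + d + n) ≠ 1)
    (hbc : ∀ n : ℕ, (q : ℂ) ^ (b + c + n) ≠ 1) (hbd : ∀ n : ℕ, (q : ℂ) ^ (b + d + n) ≠ 1)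
    (hcef : ∀ n : ℕ, (q : ℂ) ^ (c + e + f + n) ≠ 1)
    (habcd : ∀ n : ℕ, (q : ℂ) ^ (a + b + c + d + n) ≠ 1)
    (γ : ℝ → ℂ)
    (hγ : IsBarnesContour (barnesIntegrand q a b c d e f)
      (increasingSeq c ∪ increasingSeq d)
      (decreasingSeq q a ∪ decreasingSeq q b ∪ decreasingSeq q f) γ) :
    MeasureTheory.Integrable (fun t : ℝ => barnesIntegrand q a b c d e f (γ t) * deriv γ t) ∧
    Summable (basicHypergeometricTerm [(q : ℂ) ^ e, (q : ℂ) ^ (a + c), (q : ℂ) ^ (b + c)]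
      [(q : ℂ) ^ (c + e + f), (q : ℂ) ^ (a + b + c + d)] q ((q : ℂ) ^ (d + f))) ∧
    1 / (2 * (Real.pi : ℂ) * Complex.I)
        * ∫ t : ℝ, barnesIntegrand q a b c d e f (γ t) * deriv γ t =
      (q : ℂ) ^ c / Complex.sin (Real.pi * (d - c))
        * (qPochInf q q * qPochInf ((q : ℂ) ^ (1 + c - d)) q * qPochInf ((q : ℂ) ^ (d - c)) q
            * qPochInf ((q : ℂ) ^ (a + b + c + d)) q * qPochInf ((q : ℂ) ^ (c + e + f)) q
          / (qPochInf ((q : ℂ) ^ (a + c)) q * qPochInf ((q : ℂ) ^ (a + d)) q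
            * qPochInf ((q : ℂ) ^ (b + c)) q * qPochInf ((q : ℂ) ^ (b + d)) q
            * qPochInf ((q : ℂ) ^ (c + f)) q))
        * basicHypergeometric [(q : ℂ) ^ e, (q : ℂ) ^ (a + c), (q : ℂ) ^ (b + c)]
            [(q : ℂ) ^ (c + e + f), (q : ℂ) ^ (a + b + c + d)] q ((q : ℂ) ^ (d + f)) := by
  have hq : (q : ℂ) ≠ 0 := by exact_mod_cast hq0.ne'
  have hqn := norm_ofReal_lt_one hq0 hq1
  have hne : ∀ z : ℂ, (q : ℂ) ^ z ≠ 0 := fun z => by simp [Complex.cpow_eq_zero_iff, hq]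
  have hadd := fun x y : ℂ => Complex.cpow_add x y hq
  have hnat : ∀ (z : ℂ) (n : ℕ), (q : ℂ) ^ (z + n) = (q : ℂ) ^ z * (q : ℂ) ^ n := fun z n => by
    rw [hadd, Complex.cpow_natCast]
  simp only [hnat] at hac had hbc hbd hcef habcd
  have hsin' : Complex.sin (Real.pi * (d - c)) ≠ 0 := by
    rwa [← neg_sub, mul_neg, Complex.sin_neg, neg_ne_zero]
  -- the increasing and the decreasing sequences have no common points
  have hdisj : Disjoint (increasingSeq c ∪ increasingSeq d)
      (decreasingSeq q a ∪ decreasingSeq q b ∪ decreasingSeq q f) := by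
    have key : ∀ x c : ℂ, (∀ n : ℕ, (q : ℂ) ^ (x + c) * (q : ℂ) ^ n ≠ 1) → ∀ k : ℕ,
        c + k ∉ decreasingSeq q x := by
      intro x c h k hk
      obtain ⟨j, hj⟩ := (mem_decreasingSeq_iff hq0 hq1 x _).1 hk
      refine h (k + j) ?_
      rw [← hj, ← add_assoc, hnat, mul_assoc, pow_add]
    have keyf : ∀ c : ℂ, ‖(q : ℂ) ^ (c + f)‖ < 1 → ∀ k : ℕ, c + k ∉ decreasingSeq q f :=
      fun c h => key f c (mul_pow_ne_one_of_norm_lt hqn (by rwa [add_comm]))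
    rw [Set.disjoint_left]
    rintro z (⟨k, rfl⟩ | ⟨k, rfl⟩) ((h | h) | h)
    · exact key a c hac k h
    · exact key b c hbc k h
    · exact keyf c hcf k h
    · exact key a d had k h
    · exact key b d hbd k h
    · exact keyf d hdf k h
  have hcf' : ‖(q : ℂ) ^ f * (q : ℂ) ^ c‖ < 1 := by rwa [← hadd, add_comm]
  have hdf' : ‖(q : ℂ) ^ f * (q : ℂ) ^ d‖ < 1 := by rwa [← hadd, add_comm]
  rw [hadd a c] at hac
  rw [hadd a d] at had
  rw [hadd b c] at hbc
  rw [hadd b d] at hbd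
  have ecef : (q : ℂ) ^ (c + e + f) = (q : ℂ) ^ e * (q : ℂ) ^ f * (q : ℂ) ^ c := by
    rw [hadd, hadd]; ring
  have eabcd : (q : ℂ) ^ (a + b + c + d) =
      (q : ℂ) ^ a * (q : ℂ) ^ b * (q : ℂ) ^ c * (q : ℂ) ^ d := by
    rw [hadd, hadd, hadd]
  rw [ecef] at hcef
  rw [eabcd] at habcd
  have hsc := (hasSum_barnesTerm_sum hqn hq (hne c) (hne c) ((q : ℂ) ^ d) hcf' hcf' hcef hac hbc).1
  have hsd := (hasSum_barnesTerm_sum hqn hq (hne c) (hne d) ((q : ℂ) ^ d) hdf' hcf' hcef had hbd).1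
  have hrc : barnesResidue q a b c d e f = fun k : ℕ => barnesTerm q ((q : ℂ) ^ c) ((q : ℂ) ^ d)
      ((q : ℂ) ^ a) ((q : ℂ) ^ b) ((q : ℂ) ^ e) ((q : ℂ) ^ f) ((q : ℂ) ^ c * (q : ℂ) ^ k) *
        -(Complex.sin (Real.pi * (d - c)))⁻¹ := by
    funext k
    rw [barnesResidue, hnat]
    ring
  have hrd : barnesResidue q a b d c e f = fun k : ℕ => barnesTerm q ((q : ℂ) ^ c) ((q : ℂ) ^ d)
      ((q : ℂ) ^ a) ((q : ℂ) ^ b) ((q : ℂ) ^ e) ((q : ℂ) ^ f) ((q : ℂ) ^ d * (q : ℂ) ^ k) *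
        (Complex.sin (Real.pi * (d - c)))⁻¹ := by
    funext k
    rw [barnesResidue, hnat, barnesTerm_swap, ← neg_sub d c, mul_neg, Complex.sin_neg]
    ring
  obtain ⟨hint, hval⟩ := integral_barnesIntegrand hq0 hq1 hsin hdisj hγ
    (hrc ▸ hsc.mul_right _) (hrd ▸ hsd.mul_right _)
  refine ⟨hint, ?_, ?_⟩
  · rw [ecef, eabcd]
    exact summable_basicHypergeometricTerm_three_two hqn _ _ _ hdf hcef habcd
  have h3 := tsum_barnesTerm_sub_tsum_barnesTerm hqn hq (hne c) (hne d) hcf' hdf' hcef hac had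
    hbc hbd habcd
  have hstep := qPochInf_step hqn ((q : ℂ) ^ (d - c))
  rw [hval, hrc, hrd, tsum_mul_right, tsum_mul_right]
  have e1 : (q : ℂ) * (q : ℂ) ^ c / (q : ℂ) ^ d = (q : ℂ) ^ (1 + c - d) := by
    rw [Complex.cpow_sub _ _ hq, hadd, Complex.cpow_one]
  have e2 : (q : ℂ) * (q : ℂ) ^ d / (q : ℂ) ^ c = (q : ℂ) ^ (d - c) * q := by
    rw [Complex.cpow_sub _ _ hq]; ring
  have e3 : (q : ℂ) ^ c - (q : ℂ) ^ d = (q : ℂ) ^ c * (1 - (q : ℂ) ^ (d - c)) := by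
    rw [Complex.cpow_sub _ _ hq]
    have := hne c
    field_simp
  have hpi : 2 * (Real.pi : ℂ) * Complex.I ≠ 0 := by simp [Real.pi_ne_zero]
  rw [e1, e2, e3, ← hadd a c, ← hadd a d, ← hadd b c, ← hadd b d, ← ecef, ← eabcd, ← hadd f c,
    ← hadd f d, add_comm f c, add_comm f d] at h3
  rw [hstep]
  have key : ∀ A B r w : ℂ, w ≠ 0 → 1 / w * (-w * (A * -r + B * r)) = r * (A - B) := by
    intro A B r w hw
    field_simp
    ring
  rw [key _ _ _ _ hpi, h3]
  ring
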